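/- **Setting.** Let $n,m,N\in\mathbb N$, $D\ge 1$, $\Phi\subseteq[-1,1]^N$, $f:\mathbb R^n\times\mathbb R^N\to\mathbb R^m$, $\ell:\mathbb R^m\times\mathbb R^m\to\mathbb R$, and let $\mathcal L$ be a Lipschitz constant, in the maximum norm, of $(x,\phi,y)\mapsto \ell(f(x,\phi),y)$ on $[-1,1]^n\times\Phi\times[-1,1]^m$. Let $0<\epsilon<2\mathcal L$, $\gamma=\epsilon/(2\mathcal L)\in(0,1)$, $k=\lceil\log_2(2\mathcal L/\epsilon)\rceil$ and $K=2^k$. Thus $K$ is $2\mathcal L/\epsilon$ rounded up to a power of two: $2\mathcal L/\epsilon\le K<2\cdot 2\mathcal L/\epsilon$, and $K=2\mathcal L/\epsilon$ if $2\mathcal L/\epsilon$ is a power of two. A *grid point* is a vector with coordinates $-1+2\sum_{h=1}^k2^{-h}z_h$, where $z_h\in\{0,1\}$. Let $S^\epsilon(D,\Phi,\ell,f)$ be the set of all $(x^1,\dots,x^D,y^1,\dots,y^D,\phi,L)\in[-1,1]^{(n+m)D}\times\Phi\times\mathbb R^D$ such that $L_d=\ell(f(x^d,\phi),y^d)$ for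 all $d$ and all $x^d,y^d$ and $\phi$ are grid points. **Theorem.** $\operatorname{conv}(S^\epsilon(D,\Phi,\ell,f))$ has a linear programming formulation, chosen independently of any data set: a bounded polyhedron $P$, given by finitely many linear equalities and inequalities, and linear forms on $P$ for the (relaxed) digits $z^x,z^y,z^\phi$ and for $L$, such that the image of $P$ under $v\mapsto(x,y,\phi,L)$ is $\operatorname{conv}(S^\epsilon(D,\Phi,\ell,f))$, where $x,y,\phi$ are computed from the digits by the affine formula $-1+2\sum_h2^{-h}z_h$. It has the following properties. (a) It has at most $4DK^{n+m+N}$ variables and at most $2D(2K^{n+m+N}+1)$ constraints (equalities and inequalities). (b) There are an absolute constant $C$ and a single program that, on input $(n,m,N,D,k)$ and with oracle access to $f$, $\ell$ and $\Phi$, writes down all nonzero coefficients of this formulation (the constraints and the linear forms for $z^x,z^y,z^\phi,L$) in at most $C\,K^{n+m+N}D$ steps, including at most $C\,K^{n+m+N}$ evaluations of $f$, at most $C\,K^{n+m+N}$ evaluations of $\ell$, and at most $C\,K^{n+m+N}$ membership queries to $\Phi$. Here a program is one for a register machine with natural-number registers, a real memory addressed through them, and counted loops. Each of the following costs one step: loading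 a constant, addition or truncated subtraction of registers, a real arithmetic operation, writing one coefficient, a loop iteration or test, and an oracle call. Grid points are passed to the oracles as binary code words. (c), (d) Let $(\hat X,\hat Y)=(\hat x^d,\hat y^d)_{d=1}^D$ be any data set with $\hat x^d\in[-1,1]^n$, $\hat y^d\in[-1,1]^m$. There are digits $\hat z^x,\hat z^y$ of grid points $\tilde x^d,\tilde y^d$ with $\tilde x^d_i\le\hat x^d_i\le\tilde x^d_i+2\gamma$ and $\tilde y^d_i\le\hat y^d_i\le\tilde y^d_i+2\gamma$ for all $d,i$. For every such choice of digits, let $\mathcal F_{\hat X,\hat Y}=\{v\in P: z^x(v)=\hat z^x,\ z^y(v)=\hat z^y\}$. This is a face of $P$ (possibly empty), and it arises from $P$ by fixing certain variables of the linear program to $0$. Suppose moreover that $\Phi=[-1,1]^N$ or, more generally, that every $\phi\in\Phi$ has maximum-norm distance at most $2\gamma=\epsilon/\mathcal L$ from some grid point in $\Phi$. Let $Q=\operatorname{proj}_{\phi,L}(\mathcal F_{\hat X,\hat Y})$. If $\Phi\ne\emptyset$, then the linear objective $\frac1D\sum_{d=1}^DL_d$ attains its minimum over $Q$ at an extreme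 point of $Q$. For every extreme point $(\tilde\phi,\tilde L)$ of $Q$ that minimizes this objective over $Q$, we have $\tilde\phi\in\Phi$ and $$\left|\frac1D\sum_{d=1}^D\bigl[\ell(f(\hat x^d,\phi^*),\hat y^d)-\ell(f(\hat x^d,\tilde\phi),\hat y^d)\bigr]\right|\le2\epsilon$$ for every optimal solution $\phi^*$ of the ERM problem $\min_{\phi\in\Phi}\frac1D\sum_{d=1}^D\ell(f(\hat x^d,\phi),\hat y^d)$. -/

import Mathlib

open scoped NNReal Matrix

noncomputable section

namespace ERM

/-! ### The discretization -/

/-- The cube `[-1,1]^n`. -/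
def box (n : ℕ) : Set (Fin n → ℝ) := Set.Icc (fun _ => -1) (fun _ => 1)

/-- The number `k` of binary digits per coordinate, `⌈log₂ (1/γ)⌉` for `γ = ε / (2𝓛)`. -/
def digits (Lc ε : ℝ) : ℕ := ⌈Real.logb 2 (2 * Lc / ε)⌉₊

/-- The number `-1 + 2 ∑_{h=1}^k 2^{-h} z_h`; the index `h : Fin k` stands for the digit `h + 1`. -/
def decode {k : ℕ} (z : Fin k → ℝ) : ℝ := -1 + 2 * ∑ h : Fin k, (1 / 2 : ℝ) ^ ((h : ℕ) + 1) * z h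

/-- A binary digit as a real number. -/
def bit (b : Bool) : ℝ := if b then 1 else 0

/-- The grid point of `[-1,1]^q` with the binary digits `z`. -/
def gridPoint {q k : ℕ} (z : Fin q → Fin k → Bool) : Fin q → ℝ :=
  fun i => decode fun h => bit (z i h)

/-- `z` consists of digits of a grid point that approximates `r ∈ [-1,1]^q` from below
within `2γ` in every coordinate. -/
def Approximates {q k : ℕ} (γ : ℝ) (z : Fin q → Fin k → Bool) (r : Fin q → ℝ) : Prop :=
  ∀ i, gridPoint z i ≤ r i ∧ r i ≤ gridPoint z i + 2 * γ

/-- The space of the variables `(x, y, φ, L)`. -/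
abbrev Point (n m N D : ℕ) : Type :=
  (Fin D → Fin n → ℝ) × (Fin D → Fin m → ℝ) × (Fin N → ℝ) × (Fin D → ℝ)

/-- The discretized feasible region `S^ε(D, Φ, ℓ, f)`, with `k` binary digits per coordinate. -/
def discreteRegion {n m N : ℕ} (D k : ℕ) (Φ : Set (Fin N → ℝ))
    (ℓ : (Fin m → ℝ) → (Fin m → ℝ) → ℝ) (f : (Fin n → ℝ) → (Fin N → ℝ) → (Fin m → ℝ)) :
    Set (Point n m N D) :=
  {p | (∀ d, p.1 d ∈ box n) ∧ (∀ d, p.2.1 d ∈ box m) ∧ p.2.2.1 ∈ Φ ∧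
    (∀ d, p.2.2.2 d = ℓ (f (p.1 d) p.2.2.1) (p.2.1 d)) ∧
    ∃ (zx : Fin D → Fin n → Fin k → Bool) (zy : Fin D → Fin m → Fin k → Bool)
      (zφ : Fin N → Fin k → Bool),
      (∀ d, p.1 d = gridPoint (zx d)) ∧ (∀ d, p.2.1 d = gridPoint (zy d)) ∧
        p.2.2.1 = gridPoint zφ}

/-- The empirical risk of the parameter `φ` on the data set `(X, Y)`. -/
def risk {n m N D : ℕ} (ℓ : (Fin m → ℝ) → (Fin m → ℝ) → ℝ)
    (f : (Fin n → ℝ) → (Fin N → ℝ) → (Fin m → ℝ))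
    (X : Fin D → Fin n → ℝ) (Y : Fin D → Fin m → ℝ) (φ : Fin N → ℝ) : ℝ :=
  (1 / (D : ℝ)) * ∑ d, ℓ (f (X d) φ) (Y d)

/-- The Lipschitz inequality for `(x, φ, y) ↦ ℓ(f(x, φ), y)` over `[-1,1]^n × Φ × [-1,1]^m`
in the maximum norm (the metric of finite products). -/
def IsArchitectureLipschitz {n m N : ℕ} (Lc : ℝ≥0) (Φ : Set (Fin N → ℝ))
    (ℓ : (Fin m → ℝ) → (Fin m → ℝ) → ℝ)
    (f : (Fin n → ℝ) → (Fin N → ℝ) → (Fin m → ℝ)) : Prop :=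
  LipschitzOnWith Lc
    (fun p : (Fin n → ℝ) × (Fin N → ℝ) × (Fin m → ℝ) => ℓ (f p.1 p.2.1) p.2.2)
    (box n ×ˢ Φ ×ˢ box m)

/-- Every parameter in `Φ` is within `2γ` of a grid point that belongs to `Φ`. -/
def GridDense {N : ℕ} (k : ℕ) (γ : ℝ) (Φ : Set (Fin N → ℝ)) : Prop :=
  ∀ φ ∈ Φ, ∃ z : Fin N → Fin k → Bool, gridPoint z ∈ Φ ∧ dist φ (gridPoint z) ≤ 2 * γ

/-! ### Linear programs -/

/-- A linear system with equality rows and inequality rows in `nv` real variables, together with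
linear forms in these variables that give the (relaxed) binary digits of `x`, `y`, `φ` and the
values `L`. -/
structure Formulation (n m N D k : ℕ) where
  nv : ℕ
  neq : ℕ
  nle : ℕ
  eqA : Matrix (Fin neq) (Fin nv) ℝ
  eqb : Fin neq → ℝ
  leA : Matrix (Fin nle) (Fin nv) ℝ
  leb : Fin nle → ℝ
  zx : Fin D → Fin n → Fin k → Fin nv → ℝ
  zy : Fin D → Fin m → Fin k → Fin nv → ℝ
  zφ : Fin N → Fin k → Fin nv → ℝ
  L : Fin D → Fin nv → ℝ

namespace Formulation

variable {n m N D k : ℕ} (P : Formulation n m N D k)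

/-- The feasible set of the linear program. -/
def polytope : Set (Fin P.nv → ℝ) := {v | P.eqA *ᵥ v = P.eqb ∧ P.leA *ᵥ v ≤ P.leb}

/-- The parameter `φ` described by a vector of LP variables. -/
def phi (v : Fin P.nv → ℝ) : Fin N → ℝ := fun i => decode fun h => P.zφ i h ⬝ᵥ v

/-- The loss values `L` described by a vector of LP variables. -/
def loss (v : Fin P.nv → ℝ) : Fin D → ℝ := fun d => P.L d ⬝ᵥ v

/-- The point `(x, y, φ, L)` described by a vector of LP variables. -/
def point (v : Fin P.nv → ℝ) : Point n m N D :=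
  (fun d i => decode fun h => P.zx d i h ⬝ᵥ v, fun d i => decode fun h => P.zy d i h ⬝ᵥ v,
    P.phi v, P.loss v)

/-- The part of the polytope on which the digits of the data variables `x`, `y` are fixed. -/
def dataFace (ax : Fin D → Fin n → Fin k → Bool) (ay : Fin D → Fin m → Fin k → Bool) :
    Set (Fin P.nv → ℝ) :=
  {v ∈ P.polytope | (∀ d i h, P.zx d i h ⬝ᵥ v = bit (ax d i h)) ∧
    (∀ d i h, P.zy d i h ⬝ᵥ v = bit (ay d i h))}

/-- The projection of that part to the variables `(φ, L)`. -/
def projFace (ax : Fin D → Fin n → Fin k → Bool) (ay : Fin D → Fin m → Fin k → Bool) :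
    Set ((Fin N → ℝ) × (Fin D → ℝ)) :=
  (fun v => (P.phi v, P.loss v)) '' P.dataFace ax ay

end Formulation

/-! ### The machine that writes down linear programs

A register machine with natural-number registers, a real memory that is addressed through the
registers, counted loops, and oracles for `f`, `ℓ` and `Φ`. Grid points are handled as binary code
words. Every instruction and every loop iteration costs one unit of time. -/

/-- The oracles, and the number `k` of binary digits per coordinate in code words. -/
structure Oracles (n m N : ℕ) where
  k : ℕ
  f : (Fin n → ℝ) → (Fin N → ℝ) → (Fin m → ℝ)
  ℓ : (Fin m → ℝ) → (Fin m → ℝ) → ℝ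
  Φ : Set (Fin N → ℝ)

/-- The grid point of `[-1,1]^q` with code word `w`: digit `h` of coordinate `i` is the bit
`i * k + h` of `w`. -/
def wordPoint (q k w : ℕ) : Fin q → ℝ :=
  gridPoint fun (i : Fin q) (h : Fin k) => w.testBit ((i : ℕ) * k + (h : ℕ))

/-- The output tables of the machine. -/
inductive Table
  | eqA | eqb | leA | leb | zx | zy | zphi | loss
  deriving DecidableEq

/-- The elementary instructions; the arguments are names of registers (except for the constant
of `const`). -/
inductive Instr
  /-- register `r` becomes the constant `c` -/
  | const (r c : ℕ)
  /-- register `r` becomes the sum of registers `a` and `b` -/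
  | add (r a b : ℕ)
  /-- register `r` becomes the truncated difference of registers `a` and `b` -/
  | sub (r a b : ℕ)
  /-- the memory cell addressed by register `a` becomes `1` -/
  | one (a : ℕ)
  /-- real addition, on the memory cells addressed by the registers `b`, `c`, result in `a` -/
  | radd (a b c : ℕ)
  /-- real subtraction -/
  | rsub (a b c : ℕ)
  /-- real multiplication -/
  | rmul (a b c : ℕ)
  /-- real division -/
  | rdiv (a b c : ℕ)
  /-- evaluate `f` at the grid points coded in registers `rx`, `rp`, and store the `m` values from
  the address in register `a` on -/
  | evalF (rx rp a : ℕ)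
  /-- evaluate `ℓ` at the `m` values stored from the address in `b` on and the grid point coded in
  register `ry`, and store the value at the address in register `a` -/
  | evalL (b ry a : ℕ)
  /-- ask whether the grid point coded in register `rp` is in `Φ`, and store `1` or `0` at the
  address in register `a` -/
  | testPhi (rp a : ℕ)
  /-- write the real stored at the address in register `a` to the entry of table `t` whose row and
  column are in registers `r` and `c` -/
  | emit (t : Table) (r c a : ℕ)

/-- Programs. -/
inductive Cmd
  | instr (i : Instr)
  | seq (c₁ c₂ : Cmd)
  /-- repeat `c` as many times as register `r` says when the loop is entered -/
  | loop (r : ℕ) (c : Cmd)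
  /-- run `c₁` if register `r` holds `0` and `c₂` otherwise -/
  | ifZero (r : ℕ) (c₁ c₂ : Cmd)

/-- Configurations of the machine, with the step counter and the counters of oracle calls. -/
structure Config where
  reg : ℕ → ℕ
  mem : ℕ → ℝ
  out : Table → ℕ → ℕ → ℝ
  time : ℕ
  callsF : ℕ
  callsL : ℕ
  callsPhi : ℕ

open Classical in
/-- The effect of an instruction, apart from the step counter. -/
def Instr.exec {n m N : ℕ} (O : Oracles n m N) : Instr → Config → Config
  | .const r c, s => { s with reg := Function.update s.reg r c }
  | .add r a b, s => { s with reg := Function.update s.reg r (s.reg a + s.reg b) }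
  | .sub r a b, s => { s with reg := Function.update s.reg r (s.reg a - s.reg b) }
  | .one a, s => { s with mem := Function.update s.mem (s.reg a) 1 }
  | .radd a b c, s =>
      { s with mem := Function.update s.mem (s.reg a) (s.mem (s.reg b) + s.mem (s.reg c)) }
  | .rsub a b c, s =>
      { s with mem := Function.update s.mem (s.reg a) (s.mem (s.reg b) - s.mem (s.reg c)) }
  | .rmul a b c, s =>
      { s with mem := Function.update s.mem (s.reg a) (s.mem (s.reg b) * s.mem (s.reg c)) }
  | .rdiv a b c, s =>
      { s with mem := Function.update s.mem (s.reg a) (s.mem (s.reg b) / s.mem (s.reg c)) }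
  | .evalF rx rp a, s =>
      { s with
        mem := fun j =>
          if h : s.reg a ≤ j ∧ j < s.reg a + m then
            O.f (wordPoint n O.k (s.reg rx)) (wordPoint N O.k (s.reg rp)) ⟨j - s.reg a, by omega⟩
          else s.mem j
        callsF := s.callsF + 1 }
  | .evalL b ry a, s =>
      { s with
        mem := Function.update s.mem (s.reg a)
          (O.ℓ (fun i => s.mem (s.reg b + (i : ℕ))) (wordPoint m O.k (s.reg ry)))
        callsL := s.callsL + 1 }
  | .testPhi rp a, s =>
      { s with
        mem := Function.update s.mem (s.reg a)
          (if wordPoint N O.k (s.reg rp) ∈ O.Φ then 1 else 0)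
        callsPhi := s.callsPhi + 1 }
  | .emit t r c a, s =>
      { s with
        out := fun t' i j =>
          if t' = t ∧ i = s.reg r ∧ j = s.reg c then s.mem (s.reg a) else s.out t' i j }

/-- One unit of time passes. -/
def Config.tick (s : Config) : Config := { s with time := s.time + 1 }

/-- Running a program. -/
def Cmd.run {n m N : ℕ} (O : Oracles n m N) : Cmd → Config → Config
  | .instr i => fun s => (i.exec O s).tick
  | .seq c₁ c₂ => fun s => c₂.run O (c₁.run O s)
  | .loop r c => fun s => (fun t => (c.run O t).tick)^[s.reg r] s.tick
  | .ifZero r c₁ c₂ => fun s => if s.reg r = 0 then c₁.run O s.tick else c₂.run O s.tick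

/-- The start configuration: registers `0, …, 4` hold `n`, `m`, `N`, `D`, `k`, everything else
is zero. -/
def startConfig (n m N D k : ℕ) : Config where
  reg := fun r => [n, m, N, D, k].getD r 0
  mem := fun _ => 0
  out := fun _ _ _ => 0
  time := 0
  callsF := 0
  callsL := 0
  callsPhi := 0

/-- The formulation that is written in the output tables; registers `0`, `1`, `2` hold the numbers
of variables, of equality rows and of inequality rows. -/
def Config.formulation (s : Config) (n m N D k : ℕ) : Formulation n m N D k where
  nv := s.reg 0
  neq := s.reg 1
  nle := s.reg 2
  eqA := Matrix.of fun r j => s.out .eqA r j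
  eqb := fun r => s.out .eqb r 0
  leA := Matrix.of fun r j => s.out .leA r j
  leb := fun r => s.out .leb r 0
  zx := fun d i h j => s.out .zx (((d : ℕ) * n + (i : ℕ)) * k + (h : ℕ)) j
  zy := fun d i h j => s.out .zy (((d : ℕ) * m + (i : ℕ)) * k + (h : ℕ)) j
  zφ := fun i h j => s.out .zphi ((i : ℕ) * k + (h : ℕ)) j
  L := fun d j => s.out .loss d j

end ERM

end

noncomputable section

namespace ERM

/-! ### Reasoning about programs -/

/-! A code word of T = (N + n + m)k bits lists a grid parameter φ, then a grid input x, then a grid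
label y. For every d take a complete binary tree of depth T whose leaves are the code words. The
variables are the node weights: roots have weight one, an inner node is the sum of its children,
leaves are nonnegative. So tree d carries a probability measure on triples (φ, x^d, y^d), and its
level Nk carries the marginal on φ. Link equations identify these marginals for all d, and an upper
bound 0 removes the parameters outside Φ.

The image of this polytope is the convex hull because, once φ is fixed, nothing couples different d.
Measures with a common marginal are glued by choosing the data words independently given φ
(`mem_convexHull_of_marginals`, which rests on the hull of a product being the product of the
hulls). Conversely, a point of S^ε comes from the 0/1 vector that marks the paths from the roots to
its leaves (`pathVector_mem`). Together these give `treeMap_image_wordFace`. The size stays linear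
in D although S^ε is exponential in D.

A digit of a leaf is the parity of one of its ancestors, so its linear form is the sum of the odd
nodes of one level (`sum_odd_nodes`). Every node enters at most one such form, hence the number of
nonzero coefficients has no factor T. Losses depend on the code word and not on d, hence the number
of oracle calls has no factor D. The program is verified by triples `Spec` against an explicit table
`target`. The output starts at zero, so it is enough that written entries are correct and that all
nonzero entries get written (`mem_items_of_target_ne_zero`).

Fixing a digit to 0 or 1 forces a mean of bits to an extreme value, which kills exactly the leaves
with another data word (`dataFace_eq_wordFace`). As all variables are nonnegative, this is an
exposed face. The gluing argument on the remaining leaves shows that Q is the hull of the points (φ,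
L) with φ a grid point in Φ and L the losses on the rounded data (`projFace_eq_convexHull`). Extreme
points are among these generators, so a minimizing one is a best grid parameter for the rounded
data. Rounding the data, and φ* along with it, changes a risk by at most 𝓛·2γ = ε
(`abs_risk_sub_risk_le`), and two such comparisons give 2ε. -/

/-- Passing from `s` to `s'` keeps the entries of the output tables that agree with `G`, establishes
agreement at the positions `items`, and takes at most `B` steps and `Q` oracle calls. -/
structure Progress (G : Table → ℕ → ℕ → ℝ) (s s' : Config) (items : Table → ℕ → ℕ → Prop)
    (B Q : ℕ) : Prop where
  -- Agreement is preserved, not the entry itself: the tables start at zero, so zero entries of `G`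
  -- agree from the beginning, and rewriting an entry with its correct value does no harm.
  mono : ∀ t r j, s.out t r j = G t r j → s'.out t r j = G t r j
  covers : ∀ t r j, items t r j → s'.out t r j = G t r j
  time_le : s'.time ≤ s.time + B
  calls_le : s'.callsF + s'.callsL + s'.callsPhi ≤ s.callsF + s.callsL + s.callsPhi + Q

/-- `c` leads from `pre` to `post`, with the progress described by `items`, `B`, `Q`. -/
def Spec {n m N : ℕ} (O : Oracles n m N) (G : Table → ℕ → ℕ → ℝ) (c : Cmd)
    (pre post : (ℕ → ℕ) → (ℕ → ℝ) → Prop) (items : Table → ℕ → ℕ → Prop) (B Q : ℕ) : Prop :=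
  ∀ s, pre s.reg s.mem → post (c.run O s).reg (c.run O s).mem ∧ Progress G s (c.run O s) items B Q

section rules

variable {n m N : ℕ} {O : Oracles n m N} {G : Table → ℕ → ℕ → ℝ}

theorem Spec.seq {c₁ c₂ : Cmd} {p q r : (ℕ → ℕ) → (ℕ → ℝ) → Prop}
    {I₁ I₂ : Table → ℕ → ℕ → Prop} {B₁ B₂ Q₁ Q₂ : ℕ} (h₁ : Spec O G c₁ p q I₁ B₁ Q₁)
    (h₂ : Spec O G c₂ q r I₂ B₂ Q₂) :
    Spec O G (.seq c₁ c₂) p r (fun t i j => I₁ t i j ∨ I₂ t i j) (B₁ + B₂) (Q₁ + Q₂) := by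
  intro s hs
  obtain ⟨hq, p₁⟩ := h₁ s hs
  obtain ⟨hr, p₂⟩ := h₂ _ hq
  refine ⟨hr, fun t i j h => p₂.mono _ _ _ (p₁.mono _ _ _ h), ?_, ?_, ?_⟩
  · rintro t i j (h | h)
    · exact p₂.mono _ _ _ (p₁.covers _ _ _ h)
    · exact p₂.covers _ _ _ h
  · have := p₁.time_le; have := p₂.time_le; simp only [Cmd.run]; omega
  · have := p₁.calls_le; have := p₂.calls_le; simp only [Cmd.run]; omega

theorem Spec.weaken {c : Cmd} {p q p' q' : (ℕ → ℕ) → (ℕ → ℝ) → Prop}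
    {I I' : Table → ℕ → ℕ → Prop} {B B' Q Q' : ℕ} (h : Spec O G c p q I B Q)
    (hp : ∀ R M, p' R M → p R M) (hq : ∀ R M, q R M → q' R M)
    (hI : ∀ t i j, I' t i j → I t i j) (hB : B ≤ B') (hQ : Q ≤ Q') : Spec O G c p' q' I' B' Q' := by
  intro s hs
  obtain ⟨h₁, h₂⟩ := h s (hp _ _ hs)
  exact ⟨hq _ _ h₁, h₂.mono, fun t i j ht => h₂.covers _ _ _ (hI _ _ _ ht),
    h₂.time_le.trans (by omega), h₂.calls_le.trans (by omega)⟩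

/-- The register is read only on entry, so the body may change it. The leading 1 in the cost is the
entry, the 1 in each summand the tick of an iteration. -/
theorem Spec.loop {c : Cmd} {r cnt : ℕ} (I : ℕ → (ℕ → ℕ) → (ℕ → ℝ) → Prop)
    {items : ℕ → Table → ℕ → ℕ → Prop} {B Q : ℕ → ℕ} (hr : ∀ R M, I 0 R M → R r = cnt)
    (h : ∀ i < cnt, Spec O G c (I i) (I (i + 1)) (items i) (B i) (Q i)) :
    Spec O G (.loop r c) (I 0) (I cnt) (fun t x y => ∃ i < cnt, items i t x y)
      (1 + ∑ i ∈ Finset.range cnt, (B i + 1)) (∑ i ∈ Finset.range cnt, Q i) := by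
  intro s hs
  have key : ∀ i ≤ cnt, I i ((fun t => (c.run O t).tick)^[i] s.tick).reg
      ((fun t => (c.run O t).tick)^[i] s.tick).mem ∧
      Progress G s ((fun t => (c.run O t).tick)^[i] s.tick) (fun t x y => ∃ i' < i, items i' t x y)
        (1 + ∑ i' ∈ Finset.range i, (B i' + 1)) (∑ i' ∈ Finset.range i, Q i') := by
    intro i
    induction i with
    | zero =>
      intro _
      refine ⟨hs, fun t x y h => h, fun t x y h => by simp at h, ?_, ?_⟩ <;>
        simp [Config.tick]
    | succ i ih =>
      intro hi
      obtain ⟨h₁, p₁⟩ := ih (by omega)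
      obtain ⟨h₂, p₂⟩ := h i (by omega) _ h₁
      rw [Function.iterate_succ_apply']
      refine ⟨h₂, fun t x y h => p₂.mono _ _ _ (p₁.mono _ _ _ h), ?_, ?_, ?_⟩
      · rintro t x y ⟨i', hi', h⟩
        rcases Nat.lt_succ_iff_lt_or_eq.1 hi' with h' | rfl
        · exact p₂.mono _ _ _ (p₁.covers _ _ _ ⟨i', h', h⟩)
        · exact p₂.covers _ _ _ h
      · have := p₁.time_le; have := p₂.time_le
        rw [Finset.sum_range_succ]; simp only [Config.tick] at *; omega
      · have := p₁.calls_le; have := p₂.calls_le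
        rw [Finset.sum_range_succ]; simp only [Config.tick] at *; omega
  have := key cnt le_rfl
  simpa only [Cmd.run, hr _ _ hs] using this

end rules

/-- Straight-line programs. -/
def block : List Instr → Cmd
  -- A substitute for a skip instruction: register 34 is never read. A block of q instructions
  -- therefore costs q + 1 steps.
  | [] => .instr (.const 34 0)
  | i :: l => .seq (.instr i) (block l)

/-- Registers can only be added and subtracted, so products are computed by repeated addition and
powers of two by repeated doubling. -/
theorem run_loop_add {n m N : ℕ} (O : Oracles n m N) (r x y : ℕ) (hxy : x ≠ y) (s : Config) :
    (Cmd.loop r (.instr (.add x x y))).run O s =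
      { s with
        reg := Function.update s.reg x (s.reg x + s.reg r * s.reg y)
        time := s.time + 1 + 2 * s.reg r } := by
  simp only [Cmd.run]
  generalize s.reg r = i
  induction i with
  | zero => simp [Config.tick]
  | succ i ih =>
    rw [Function.iterate_succ_apply', ih]
    simp only [Instr.exec, Config.tick, Function.update_self, Function.update_idem,
      Function.update_of_ne hxy.symm, Config.mk.injEq, and_true, true_and]
    constructor
    · congr 1; ring
    · ring

theorem run_loop_double {n m N : ℕ} (O : Oracles n m N) (r x : ℕ) (s : Config) :
    (Cmd.loop r (.instr (.add x x x))).run O s =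
      { s with
        reg := Function.update s.reg x (s.reg x * 2 ^ s.reg r)
        time := s.time + 1 + 2 * s.reg r } := by
  simp only [Cmd.run]
  generalize s.reg r = i
  induction i with
  | zero => simp [Config.tick]
  | succ i ih =>
    rw [Function.iterate_succ_apply', ih]
    simp only [Instr.exec, Config.tick, Function.update_self, Function.update_idem,
      Config.mk.injEq, and_true, true_and]
    constructor
    · congr 1; ring
    · ring

/-! ### The tables of the linear program -/

/-- The coefficient, in the linear form for the digit `s` (of `q` digits, of data set member `d`), of
column `j`. Node `p` of the tree of `d` has column `(p - 1) * D + d`; the digit is the sum of the odd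
nodes of one level. -/
def digitCoeff (D level d j : ℕ) : ℝ :=
  if j % D = d ∧ (j / D + 1) % 2 = 1 ∧ 2 ^ level ≤ j / D + 1 ∧ j / D + 1 < 2 ^ (level + 1)
    then 1 else 0

/-- The loss for the grid points whose code words are the parts of `w`. -/
def leafLoss {n m N : ℕ} (O : Oracles n m N) (w : ℕ) : ℝ :=
  O.ℓ (O.f (wordPoint n O.k (w / 2 ^ (m * O.k))) (wordPoint N O.k (w / 2 ^ (n * O.k + m * O.k))))
    (wordPoint m O.k w)

/-- The indicator of an equation between natural numbers. -/
def eqInd (i j : ℕ) : ℝ := if i = j then 1 else 0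

open Classical in
/-- The tables of the linear program. With `a = N * k`, `T = (N + n + m) * k`, there is a binary
tree with root `1` and leaves `2 ^ T, …, 2 ^ (T + 1) - 1` for every `d`. -/
def target {n m N : ℕ} (D : ℕ) (O : Oracles n m N) : Table → ℕ → ℕ → ℝ
  | .eqA, r, j =>
      -- Row pD + d belongs to node p of tree d for 0 < p < 2^T. The rows with p = 0 fix the roots,
      -- those with p = 2^T + u link node 2^(Nk) + u of tree d to that of tree 0. Node p has column
      -- (p - 1)D + d, so the children 2p and 2p + 1 have columns r + pD - D and r + pD.
      if r < D then eqInd j r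
      else if r < 2 ^ (N * O.k + n * O.k + m * O.k) * D then
        eqInd j (r - D) - eqInd j (r + r / D * D - D) - eqInd j (r + r / D * D)
      else if r / D < 2 ^ (N * O.k + n * O.k + m * O.k) + 2 ^ (N * O.k) then
        eqInd j ((2 ^ (N * O.k) + (r / D - 2 ^ (N * O.k + n * O.k + m * O.k)) - 1) * D + r % D) -
          eqInd j ((2 ^ (N * O.k) + (r / D - 2 ^ (N * O.k + n * O.k + m * O.k)) - 1) * D)
      else 0
  | .eqb, r, j => if r < D ∧ j = 0 then 1 else 0
  | .leA, r, j =>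
      if r < 2 ^ (N * O.k + n * O.k + m * O.k) * D then
        -eqInd j (2 ^ (N * O.k + n * O.k + m * O.k) * D - D + r)
      else if r < 2 ^ (N * O.k + n * O.k + m * O.k) * D + 2 ^ (N * O.k) then
        eqInd j ((2 ^ (N * O.k) + (r - 2 ^ (N * O.k + n * O.k + m * O.k) * D) - 1) * D)
      else 0
  | .leb, r, j =>
      -- The bound on a parameter node is 1 inside Φ, where it is redundant, and 0 outside.
      if j = 0 ∧ 2 ^ (N * O.k + n * O.k + m * O.k) * D ≤ r ∧
        r < 2 ^ (N * O.k + n * O.k + m * O.k) * D + 2 ^ (N * O.k) ∧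
        wordPoint N O.k (r - 2 ^ (N * O.k + n * O.k + m * O.k) * D) ∈ O.Φ then 1 else 0
  -- Low bits lie deep in the tree: bit r of the parameter word is read r levels above level Nk.
  -- Tree 0 suffices because the parameter marginals agree.
  | .zphi, r, j => if r < N * O.k then digitCoeff D (N * O.k - r) 0 j else 0
  | .zx, r, j =>
      if r < D * (n * O.k) then
        digitCoeff D (N * O.k + n * O.k - r % (n * O.k)) (r / (n * O.k)) j else 0
  | .zy, r, j =>
      if r < D * (m * O.k) then
        digitCoeff D (N * O.k + n * O.k + m * O.k - r % (m * O.k)) (r / (m * O.k)) j else 0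
  | .loss, r, j =>
      if j % D = r ∧ 2 ^ (N * O.k + n * O.k + m * O.k) ≤ j / D + 1 ∧
        j / D + 1 < 2 ^ (N * O.k + n * O.k + m * O.k + 1) then
        leafLoss O (j / D + 1 - 2 ^ (N * O.k + n * O.k + m * O.k)) else 0

/-! ### The program -/

/-- The three groups of digits. -/
inductive Stage
  | param | input | label

namespace Stage

def table : Stage → Table
  | param => .zphi | input => .zx | label => .zy

/-- The register with the number of digits. -/
def lenReg : Stage → ℕ
  | param => 5 | input => 6 | label => 7

/-- The register with the number of rows per data point. -/
def strideReg : Stage → ℕ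
  -- φ has no separate rows for each d: register 9 holds 0 and register 21 the column in tree 0, so
  -- the same correct entry is written D times.
  | param => 9 | input => 6 | label => 7

/-- The register with the column. -/
def colReg : Stage → ℕ
  | param => 21 | input => 17 | label => 17

end Stage

/-- Registers 5, 6, 7 receive Nk, nk, mk, and 22, 23, 24 the corresponding powers of two. Registers
9, 8, 10, 11, 12 hold 0, 1, 2, 3, 4 and serve as addresses: cell 0 contains 1, cell 1 contains -1
(the still empty cell 2 minus cell 0), cell 2 later takes the answers on Φ, cell 3 a loss, and the
cells from 4 on the values of f. -/
def setupCmd : Cmd :=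
  .seq (block [.const 8 1, .const 10 2, .const 11 3, .const 12 4, .one 9, .rsub 8 10 9]) <|
  .seq (.loop 2 (.instr (.add 5 5 4))) <| .seq (.loop 0 (.instr (.add 6 6 4))) <|
  .seq (.loop 1 (.instr (.add 7 7 4))) <| .seq (block [.const 22 1, .const 23 1, .const 24 1]) <|
  .seq (.loop 5 (.instr (.add 22 22 22))) <| .seq (.loop 6 (.instr (.add 23 23 23))) <|
  .seq (.loop 7 (.instr (.add 24 24 24))) (block [.sub 33 3 8, .const 14 1, .add 15 3 9])

def rootBody : Cmd := block [.emit .eqA 13 13 9, .emit .eqb 13 9 9, .add 13 13 8]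

/-- Register 13 is the row pD + d and register 15 is pD. Registers 16, 18, 17 become the columns of
the node, its left child and its right child. Only the right child has an odd number and enters a
digit form. -/
def nodeBody (S : Stage) : Cmd :=
  block [.sub 16 13 3, .add 17 13 15, .sub 18 17 3, .emit .eqA 13 16 9, .emit .eqA 13 18 8,
    .emit .eqA 13 17 8, .emit S.table 19 S.colReg 9, .add 19 19 S.strideReg, .add 13 13 8]

def nodesBody (S : Stage) : Cmd :=
  .seq (block [.add 19 20 9, .add 21 15 15]) <| .seq (.loop 3 (nodeBody S)) (block [.add 15 15 3])

def levelBody (S : Stage) : Cmd :=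
  .seq (block [.sub 20 20 8]) <| .seq (.loop 14 (nodesBody S)) (block [.add 14 14 14])

def stageCmd (S : Stage) : Cmd :=
  .seq (block [.add 20 S.lenReg 9]) (.loop S.lenReg (levelBody S))

/-- The loops run over φ, x, y and innermost d, which is the order of the leaf columns, so counters
suffice as addresses. The value of an oracle call is shared by all D trees. -/
def leafBody : Cmd :=
  block [.emit .leA 26 25 8, .emit .loss 30 25 11, .add 25 25 8, .add 26 26 8, .add 30 30 8]

def labelBody : Cmd :=
  .seq (block [.evalL 12 29 11, .const 30 0]) <| .seq (.loop 3 leafBody) (block [.add 29 29 8])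

def inputBody : Cmd :=
  .seq (block [.evalF 28 27 12, .const 29 0]) <| .seq (.loop 24 labelBody) (block [.add 28 28 8])

def paramBody : Cmd :=
  .seq (block [.const 28 0]) <| .seq (.loop 23 inputBody) (block [.add 27 27 8])

def leavesCmd : Cmd :=
  .seq (block [.sub 25 13 3, .const 26 0, .const 27 0]) (.loop 22 paramBody)

def linkBody : Cmd :=
  block [.emit .eqA 13 31 9, .emit .eqA 13 32 8, .add 13 13 8, .add 31 31 8]

/-- The link of tree 0 with itself is a zero row; the counters step over it, and the loop treats the
other D - 1 trees. -/
def linksBody : Cmd :=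
  .seq (block [.testPhi 27 10, .emit .leA 26 31 9, .emit .leb 26 9 10, .add 26 26 8, .add 27 27 8,
    .add 32 31 9, .add 13 13 8, .add 31 31 8]) (.loop 33 linkBody)

def linksCmd : Cmd :=
  .seq (block [.const 31 0, .const 27 0]) <| .seq (.loop 3 (.instr (.add 31 31 22))) <|
  .seq (block [.sub 31 31 3]) (.loop 22 linksBody)

/-- The program that writes down the linear program. -/
def lpProgram : Cmd :=
  .seq setupCmd <| .seq (.loop 3 rootBody) <| .seq (stageCmd .param) <| .seq (stageCmd .input) <|
  .seq (stageCmd .label) <| .seq leavesCmd <| .seq linksCmd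
    (block [.add 0 25 9, .add 1 13 9, .add 2 26 9])

/-- The registers and memory cells that do not change after the setup. -/
structure Base (D a b e : ℕ) (R : ℕ → ℕ) (M : ℕ → ℝ) : Prop where
  r3 : R 3 = D
  r5 : R 5 = a
  r6 : R 6 = b
  r7 : R 7 = e
  r8 : R 8 = 1
  r9 : R 9 = 0
  r10 : R 10 = 2
  r11 : R 11 = 3
  r12 : R 12 = 4
  r22 : R 22 = 2 ^ a
  r23 : R 23 = 2 ^ b
  r24 : R 24 = 2 ^ e
  r33 : R 33 = D - 1
  m0 : M 0 = 1
  m1 : M 1 = -1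

theorem Base.update {D a b e : ℕ} {R : ℕ → ℕ} {M : ℕ → ℝ} (h : Base D a b e R M) {r : ℕ} (x : ℕ)
    (hr : r ∉ [3, 5, 6, 7, 8, 9, 10, 11, 12, 22, 23, 24, 33]) :
    Base D a b e (Function.update R r x) M := by
  simp only [List.mem_cons, List.not_mem_nil, or_false, not_or] at hr
  obtain ⟨h1, h2, h3, h4, h5, h6, h7, h8, h9, h10, h11, h12, h13⟩ := hr
  obtain ⟨g1, g2, g3, g4, g5, g6, g7, g8, g9, g10, g11, g12, g13, g14, g15⟩ := h
  constructor <;> first | assumption | (rw [Function.update_of_ne (Ne.symm ‹_›)]; assumption)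

theorem Base.of_mem {D a b e : ℕ} {R : ℕ → ℕ} {M M' : ℕ → ℝ} (h : Base D a b e R M)
    (h0 : M' 0 = M 0) (h1 : M' 1 = M 1) : Base D a b e R M' :=
  { h with m0 := h0.trans h.m0, m1 := h1.trans h.m1 }

theorem mul_add_div_of_lt {D p d : ℕ} (hd : d < D) : (p * D + d) / D = p := by
  rw [Nat.add_comm, Nat.add_mul_div_right _ _ (by omega), Nat.div_eq_of_lt hd, Nat.zero_add]

theorem mul_add_mod_of_lt {D p d : ℕ} (hd : d < D) : (p * D + d) % D = d := by
  rw [Nat.add_comm, Nat.add_mul_mod_self_right, Nat.mod_eq_of_lt hd]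

theorem mul_add_lt_mul {D p q d : ℕ} (hd : d < D) (hp : p < q) : p * D + d < q * D :=
  calc p * D + d < (p + 1) * D := by rw [Nat.add_mul]; omega
    _ ≤ q * D := Nat.mul_le_mul_right _ hp

namespace Stage

variable (S : Stage) (a b e d : ℕ)

def len : ℕ := match S with | param => a | input => b | label => e

/-- The level above the digits of the group. The parameter takes the top levels, so that its
marginal appears as node weights. -/
def start : ℕ := match S with | param => 0 | input => a | label => a + b

def stride : ℕ := match S with | param => 0 | input => b | label => e

def colShift : ℕ := match S with | param => 0 | input => d | label => d

end Stage

/-! ### Correctness and cost of the tree rows and digit forms -/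

section specs

variable {n m N D : ℕ} {O : Oracles n m N}

section target

theorem target_node {p d : ℕ} (hd : d < D) (hp : 0 < p)
    (hT : p < 2 ^ (N * O.k + n * O.k + m * O.k)) (j : ℕ) :
    target D O .eqA (p * D + d) j =
      eqInd j (p * D + d - D) - eqInd j (p * D + d + p * D - D) - eqInd j (p * D + d + p * D) := by
  have h1 : ¬ p * D + d < D := by nlinarith
  simp only [target, h1, mul_add_div_of_lt hd, mul_add_lt_mul hd hT, if_true, if_false]

theorem target_node_self {p d : ℕ} (hd : d < D) (hp : 0 < p)
    (hT : p < 2 ^ (N * O.k + n * O.k + m * O.k)) :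
    target D O .eqA (p * D + d) (p * D + d - D) = 1 := by
  have h1 : D ≤ p * D := by nlinarith
  rw [target_node hd hp hT, eqInd, eqInd, eqInd, if_pos rfl, if_neg (by omega), if_neg (by omega)]
  norm_num

theorem target_node_left {p d : ℕ} (hd : d < D) (hp : 0 < p)
    (hT : p < 2 ^ (N * O.k + n * O.k + m * O.k)) :
    target D O .eqA (p * D + d) (p * D + d + p * D - D) = -1 := by
  have h1 : D ≤ p * D := by nlinarith
  rw [target_node hd hp hT, eqInd, eqInd, eqInd, if_neg (by omega), if_pos rfl, if_neg (by omega)]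
  norm_num

theorem target_node_right {p d : ℕ} (hd : d < D) (hp : 0 < p)
    (hT : p < 2 ^ (N * O.k + n * O.k + m * O.k)) :
    target D O .eqA (p * D + d) (p * D + d + p * D) = -1 := by
  have h1 : D ≤ p * D := by nlinarith
  rw [target_node hd hp hT, eqInd, eqInd, eqInd, if_neg (by omega), if_neg (by omega), if_pos rfl]
  norm_num

/-- Column 2pD + d belongs to the odd node 2p + 1, one level below p. So the digit forms can be
written while visiting the inner nodes. -/
theorem digitCoeff_child {l p d : ℕ} (hd : d < D) (h1 : 2 ^ l ≤ p) (h2 : p < 2 ^ (l + 1)) :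
    digitCoeff D (l + 1) d (2 * p * D + d) = 1 := by
  rw [digitCoeff, if_pos]
  rw [mul_add_div_of_lt hd, mul_add_mod_of_lt hd]
  have h3 : 2 ^ (l + 1) = 2 * 2 ^ l := pow_succ' 2 l
  have h4 : 2 ^ (l + 1 + 1) = 2 * 2 ^ (l + 1) := pow_succ' 2 (l + 1)
  exact ⟨rfl, by omega, by omega, by omega⟩

theorem target_digit (S : Stage) {l p d : ℕ} (hd : d < D)
    (hl : l < S.len (N * O.k) (n * O.k) (m * O.k))
    (h1 : 2 ^ (S.start (N * O.k) (n * O.k) + l) ≤ p)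
    (h2 : p < 2 ^ (S.start (N * O.k) (n * O.k) + l + 1)) :
    target D O S.table (S.len (N * O.k) (n * O.k) (m * O.k) - (l + 1) +
      d * S.stride (n * O.k) (m * O.k)) (2 * p * D + S.colShift d) = 1 := by
  cases S <;> simp only [Stage.len, Stage.start, Stage.stride, Stage.colShift, Stage.table, target]
    at *
  · rw [if_pos (by omega)]
    rw [← digitCoeff_child (D := D) (d := 0) (by omega) h1 h2]
    congr 1; omega
  · have h3 : n * O.k - (l + 1) < n * O.k := by omega
    rw [add_comm (n * O.k - (l + 1)), mul_add_div_of_lt h3, mul_add_mod_of_lt h3,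
      if_pos (mul_add_lt_mul h3 hd), ← digitCoeff_child hd h1 h2]
    congr 1; omega
  · have h3 : m * O.k - (l + 1) < m * O.k := by omega
    rw [add_comm (m * O.k - (l + 1)), mul_add_div_of_lt h3, mul_add_mod_of_lt h3,
      if_pos (mul_add_lt_mul h3 hd), ← digitCoeff_child hd h1 h2]
    congr 1; omega

end target

variable (O D) in
/-- The state before step `i` of the loop of node `p`, which has level `S.start + l`. -/
def NodeInv (S : Stage) (l p i : ℕ) (R : ℕ → ℕ) (M : ℕ → ℝ) : Prop :=
  Base D (N * O.k) (n * O.k) (m * O.k) R M ∧ R 13 = p * D + i ∧ R 15 = p * D ∧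
    R 14 = 2 ^ (S.start (N * O.k) (n * O.k) + l) ∧
    R 19 = S.len (N * O.k) (n * O.k) (m * O.k) - (l + 1) + i * S.stride (n * O.k) (m * O.k) ∧
    R 20 = S.len (N * O.k) (n * O.k) (m * O.k) - (l + 1) ∧ R 21 = p * D + p * D

variable (O D) in
/-- The positions that are written for node `p` and data point `i`. -/
def nodeItems (S : Stage) (l p i : ℕ) (t : Table) (x y : ℕ) : Prop :=
  (t = .eqA ∧ x = p * D + i ∧
    (y = p * D + i - D ∨ y = p * D + i + p * D - D ∨ y = p * D + i + p * D)) ∨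
  (t = S.table ∧ x = S.len (N * O.k) (n * O.k) (m * O.k) - (l + 1) +
    i * S.stride (n * O.k) (m * O.k) ∧ y = 2 * p * D + S.colShift i)

theorem nodeBody_spec (S : Stage) {l p i : ℕ}
    (hl : l < S.len (N * O.k) (n * O.k) (m * O.k))
    (hp₁ : 2 ^ (S.start (N * O.k) (n * O.k) + l) ≤ p)
    (hp₂ : p < 2 ^ (S.start (N * O.k) (n * O.k) + l + 1)) (hi : i < D) :
    Spec O (target D O) (nodeBody S) (NodeInv D O S l p i) (NodeInv D O S l p (i + 1))
      (nodeItems D O S l p i) 10 0 := by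
  rintro s ⟨hB, h13, h15, h14, h19, h20, h21⟩
  have hp : 0 < p := lt_of_lt_of_le (by positivity) hp₁
  have hT : p < 2 ^ (N * O.k + n * O.k + m * O.k) := by
    refine hp₂.trans_le (Nat.pow_le_pow_right (by norm_num) ?_)
    cases S <;> simp only [Stage.len, Stage.start] at * <;> omega
  have e1 := target_node_self (O := O) hi hp hT
  have e2 := target_node_left (O := O) hi hp hT
  have e3 := target_node_right (O := O) hi hp hT
  have e4 := target_digit (O := O) S hi hl hp₁ hp₂
  have hreg : ((nodeBody S).run O s).reg = Function.update (Function.update (Function.update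
      (Function.update (Function.update (Function.update s.reg 16 (p * D + i - D))
        17 (p * D + i + p * D)) 18 (p * D + i + p * D - D)) 19
          (S.len (N * O.k) (n * O.k) (m * O.k) - (l + 1) +
            (i + 1) * S.stride (n * O.k) (m * O.k))) 13 (p * D + (i + 1))) 34 0 := by
    cases S <;> simp [nodeBody, block, Cmd.run, Instr.exec, Config.tick, h13, h15, h19, hB.r3,
      hB.r6, hB.r7, hB.r8, hB.r9, Stage.strideReg, Stage.stride, Stage.len, add_assoc, add_mul]
  have hmem : ((nodeBody S).run O s).mem = s.mem := rfl
  -- The last write is tested first; it remains to compare each written value with `target`.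
  have hout : ((nodeBody S).run O s).out = fun t x y =>
      if t = S.table ∧ x = S.len (N * O.k) (n * O.k) (m * O.k) - (l + 1) +
          i * S.stride (n * O.k) (m * O.k) ∧ y = 2 * p * D + S.colShift i then 1 else
      if t = .eqA ∧ x = p * D + i ∧ y = p * D + i + p * D then -1 else
      if t = .eqA ∧ x = p * D + i ∧ y = p * D + i + p * D - D then -1 else
      if t = .eqA ∧ x = p * D + i ∧ y = p * D + i - D then 1 else s.out t x y := by
    have e : p * D + i + p * D = 2 * p * D + i := by ring
    have e' : p * D + p * D = 2 * p * D := by ring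
    cases S <;> simp [nodeBody, block, Cmd.run, Instr.exec, Config.tick, h13, h15, h19, h21, hB.r3,
      hB.r8, hB.r9, hB.m0, hB.m1, Stage.stride, Stage.len, Stage.table, Stage.colReg,
      Stage.colShift, e, e']
  refine ⟨?_, ?_⟩
  · rw [hreg, hmem]
    refine ⟨?_, by simp, by simp [h15], by simp [h14], by simp, by simp [h20], by simp [h21]⟩
    refine Base.update (Base.update (Base.update (Base.update (Base.update (Base.update hB _ ?_)
      _ ?_) _ ?_) _ ?_) _ ?_) _ ?_ <;> simp
  · refine ⟨fun t x y h => ?_, fun t x y h => ?_, le_of_eq rfl, le_of_eq rfl⟩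
    · rw [hout]; dsimp only
      split_ifs with c1 c2 c3 c4
      · obtain ⟨rfl, rfl, rfl⟩ := c1; exact e4.symm
      · obtain ⟨rfl, rfl, rfl⟩ := c2; exact e3.symm
      · obtain ⟨rfl, rfl, rfl⟩ := c3; exact e2.symm
      · obtain ⟨rfl, rfl, rfl⟩ := c4; exact e1.symm
      · exact h
    · rw [hout]; dsimp only
      split_ifs with c1 c2 c3 c4
      · obtain ⟨rfl, rfl, rfl⟩ := c1; exact e4.symm
      · obtain ⟨rfl, rfl, rfl⟩ := c2; exact e3.symm
      · obtain ⟨rfl, rfl, rfl⟩ := c3; exact e2.symm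
      · obtain ⟨rfl, rfl, rfl⟩ := c4; exact e1.symm
      · simp only [nodeItems] at h; grind

variable (O D) in
/-- The state before the loop of node `p`, which has level `S.start + l`. -/
def LevelInv (S : Stage) (l p : ℕ) (R : ℕ → ℕ) (M : ℕ → ℝ) : Prop :=
  Base D (N * O.k) (n * O.k) (m * O.k) R M ∧ R 13 = p * D ∧ R 15 = p * D ∧
    R 14 = 2 ^ (S.start (N * O.k) (n * O.k) + l) ∧
    R 20 = S.len (N * O.k) (n * O.k) (m * O.k) - (l + 1)

variable (O D) in
/-- The state before the level `S.start + l`. -/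
def StageInv (S : Stage) (l : ℕ) (R : ℕ → ℕ) (M : ℕ → ℝ) : Prop :=
  Base D (N * O.k) (n * O.k) (m * O.k) R M ∧ R 13 = 2 ^ (S.start (N * O.k) (n * O.k) + l) * D ∧
    R 15 = 2 ^ (S.start (N * O.k) (n * O.k) + l) * D ∧
    R 14 = 2 ^ (S.start (N * O.k) (n * O.k) + l) ∧
    R 20 = S.len (N * O.k) (n * O.k) (m * O.k) - l

theorem nodesBody_spec (S : Stage) (hD : 0 < D) {l p : ℕ}
    (hl : l < S.len (N * O.k) (n * O.k) (m * O.k))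
    (hp₁ : 2 ^ (S.start (N * O.k) (n * O.k) + l) ≤ p)
    (hp₂ : p < 2 ^ (S.start (N * O.k) (n * O.k) + l + 1)) :
    Spec O (target D O) (nodesBody S) (LevelInv D O S l p) (LevelInv D O S l (p + 1))
      (fun t x y => ∃ i < D, nodeItems D O S l p i t x y) (17 * D) 0 := by
  have h1 : Spec O (target D O) (block [.add 19 20 9, .add 21 15 15]) (LevelInv D O S l p)
      (NodeInv D O S l p 0) (fun _ _ _ => False) 3 0 := by
    rintro s ⟨hB, h13, h15, h14, h20⟩
    refine ⟨⟨?_, ?_⟩, fun _ _ _ h => h, nofun, le_of_eq rfl, le_of_eq rfl⟩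
    · refine Base.update (Base.update (Base.update hB _ ?_) _ ?_) _ ?_ <;> simp
    · simp [block, Cmd.run, Instr.exec, Config.tick, h13, h15, h14, h20, hB.r9]
  have h2 := Spec.loop (O := O) (G := target D O) (c := nodeBody S) (r := 3) (cnt := D)
    (NodeInv D O S l p) (fun R M h => h.1.r3) (fun i hi => nodeBody_spec S hl hp₁ hp₂ hi)
  have h3 : Spec O (target D O) (block [.add 15 15 3]) (NodeInv D O S l p D)
      (LevelInv D O S l (p + 1)) (fun _ _ _ => False) 2 0 := by
    rintro s ⟨hB, h13, h15, h14, h19, h20, h21⟩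
    refine ⟨⟨?_, ?_⟩, fun _ _ _ h => h, nofun, le_of_eq rfl, le_of_eq rfl⟩
    · refine Base.update (Base.update hB _ ?_) _ ?_ <;> simp
    · simp [block, Cmd.run, Instr.exec, Config.tick, h13, h15, h14, h20, hB.r3, add_mul]
  refine (h1.seq (h2.seq h3)).weaken (fun _ _ h => h) (fun _ _ h => h) (fun t x y h => ?_) ?_ ?_
  · exact Or.inr (Or.inl h)
  · simp; omega
  · simp

/-- The `- 1` in the cost makes room for the tick of the surrounding loop, so that the levels cost
an exact geometric series. -/
theorem levelBody_spec (S : Stage) (hD : 0 < D) {l : ℕ}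
    (hl : l < S.len (N * O.k) (n * O.k) (m * O.k)) :
    Spec O (target D O) (levelBody S) (StageInv D O S l) (StageInv D O S (l + 1))
      (fun t x y => ∃ p, 2 ^ (S.start (N * O.k) (n * O.k) + l) ≤ p ∧
        p < 2 ^ (S.start (N * O.k) (n * O.k) + l + 1) ∧ ∃ i < D, nodeItems D O S l p i t x y)
      (25 * 2 ^ (S.start (N * O.k) (n * O.k) + l) * D - 1) 0 := by
  have h1 : Spec O (target D O) (block [.sub 20 20 8]) (StageInv D O S l)
      (LevelInv D O S l (2 ^ (S.start (N * O.k) (n * O.k) + l))) (fun _ _ _ => False) 2 0 := by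
    rintro s ⟨hB, h13, h15, h14, h20⟩
    refine ⟨⟨?_, ?_⟩, fun _ _ _ h => h, nofun, le_of_eq rfl, le_of_eq rfl⟩
    · refine Base.update (Base.update hB _ ?_) _ ?_ <;> simp
    · simp [block, Cmd.run, Instr.exec, Config.tick, h13, h15, h14, h20, hB.r8]
      omega
  have hpow : 2 ^ (S.start (N * O.k) (n * O.k) + l + 1) =
    2 ^ (S.start (N * O.k) (n * O.k) + l) + 2 ^ (S.start (N * O.k) (n * O.k) + l) := by ring
  have h2 := Spec.loop (O := O) (G := target D O) (c := nodesBody S) (r := 14)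
    (cnt := 2 ^ (S.start (N * O.k) (n * O.k) + l))
    (fun u => LevelInv D O S l (2 ^ (S.start (N * O.k) (n * O.k) + l) + u))
    (fun R M h => h.2.2.2.1)
    (fun u hu => nodesBody_spec S hD hl (p := 2 ^ (S.start (N * O.k) (n * O.k) + l) + u)
      (by omega) (by omega))
  have h3 : Spec O (target D O) (block [.add 14 14 14])
      (LevelInv D O S l (2 ^ (S.start (N * O.k) (n * O.k) + l) +
        2 ^ (S.start (N * O.k) (n * O.k) + l)))
      (StageInv D O S (l + 1)) (fun _ _ _ => False) 2 0 := by
    rintro s ⟨hB, h13, h15, h14, h20⟩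
    refine ⟨⟨?_, ?_⟩, fun _ _ _ h => h, nofun, le_of_eq rfl, le_of_eq rfl⟩
    · refine Base.update (Base.update hB _ ?_) _ ?_ <;> simp
    · simp [block, Cmd.run, Instr.exec, Config.tick, h13, h15, h14, h20, ← add_assoc, hpow]
  refine (h1.seq (h2.seq h3)).weaken (fun _ _ h => h) (fun _ _ h => h) (fun t x y h => ?_) ?_ ?_
  · obtain ⟨p, hp₁, hp₂, i, hi, h⟩ := h
    refine Or.inr (Or.inl ⟨p - 2 ^ (S.start (N * O.k) (n * O.k) + l), by omega, i, hi, ?_⟩)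
    rwa [Nat.add_sub_cancel' hp₁]
  · have := Nat.one_le_two_pow (n := S.start (N * O.k) (n * O.k) + l)
    generalize 2 ^ (S.start (N * O.k) (n * O.k) + l) = x at *
    have h4 : 1 ≤ x * D := Nat.mul_pos this hD
    have h5 : x ≤ x * D := Nat.le_mul_of_pos_right _ hD
    simp only [Finset.sum_const, Finset.card_range, smul_eq_mul]
    have e1 : x * (17 * D + 1) = 17 * (x * D) + x := by ring
    have e2 : 25 * x * D = 25 * (x * D) := by ring
    omega
  · simp

/-- Costs double from level to level, so a whole stage is bounded by one level, without a factor for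
the number of levels. -/
theorem sum_two_pow_le (c q a D : ℕ) :
    ∑ l ∈ Finset.range q, c * 2 ^ (a + l) * D ≤ c * 2 ^ (a + q) * D := by
  induction q with
  | zero => simp
  | succ q ih =>
    rw [Finset.sum_range_succ]
    refine (Nat.add_le_add_right ih _).trans (le_of_eq ?_)
    rw [← add_assoc a, pow_succ]; ring

variable (O D) in
/-- The state between stages, when all nodes before `2 ^ l` have been treated. -/
def MidInv (l : ℕ) (R : ℕ → ℕ) (M : ℕ → ℝ) : Prop :=
  Base D (N * O.k) (n * O.k) (m * O.k) R M ∧ R 13 = 2 ^ l * D ∧ R 15 = 2 ^ l * D ∧ R 14 = 2 ^ l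

theorem stageCmd_spec (S : Stage) (hD : 0 < D) :
    Spec O (target D O) (stageCmd S) (MidInv D O (S.start (N * O.k) (n * O.k)))
      (MidInv D O (S.start (N * O.k) (n * O.k) + S.len (N * O.k) (n * O.k) (m * O.k)))
      (fun t x y => ∃ l < S.len (N * O.k) (n * O.k) (m * O.k),
        ∃ p, 2 ^ (S.start (N * O.k) (n * O.k) + l) ≤ p ∧
        p < 2 ^ (S.start (N * O.k) (n * O.k) + l + 1) ∧ ∃ i < D, nodeItems D O S l p i t x y)
      (3 + 25 * 2 ^ (S.start (N * O.k) (n * O.k) + S.len (N * O.k) (n * O.k) (m * O.k)) * D)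
      0 := by
  have h1 : Spec O (target D O) (block [.add 20 S.lenReg 9])
      (MidInv D O (S.start (N * O.k) (n * O.k))) (StageInv D O S 0) (fun _ _ _ => False) 2 0 := by
    rintro s ⟨hB, h13, h15, h14⟩
    refine ⟨⟨?_, ?_⟩, fun _ _ _ h => h, nofun, le_of_eq rfl, le_of_eq rfl⟩
    · refine Base.update (Base.update hB _ ?_) _ ?_ <;> simp
    · cases S <;> simp [block, Cmd.run, Instr.exec, Config.tick, h13, h15, h14, hB.r9, hB.r5, hB.r6,
        hB.r7, Stage.lenReg, Stage.len]
  have h2 := Spec.loop (O := O) (G := target D O) (c := levelBody S) (r := S.lenReg)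
    (cnt := S.len (N * O.k) (n * O.k) (m * O.k)) (StageInv D O S)
    (fun R M h => by cases S <;> simp [Stage.lenReg, Stage.len, h.1.r5, h.1.r6, h.1.r7])
    (fun l hl => levelBody_spec S hD hl)
  refine (h1.seq h2).weaken (fun _ _ h => h) (fun R M h => ⟨h.1, h.2.1, h.2.2.1, h.2.2.2.1⟩)
    (fun t x y h => Or.inr h) ?_ ?_
  · rw [← add_assoc]
    refine Nat.add_le_add_left (le_trans (le_of_eq (Finset.sum_congr rfl fun l _ => ?_))
      (sum_two_pow_le ..)) _
    refine Nat.sub_add_cancel ?_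
    have := Nat.one_le_two_pow (n := S.start (N * O.k) (n * O.k) + l)
    exact Nat.mul_pos (by omega) hD
  · simp

end specs

theorem testBit_mul_two_pow_add {M c z i : ℕ} (hi : i < M) :
    (c * 2 ^ M + z).testBit i = z.testBit i := by
  have e : (c * 2 ^ M + z) % 2 ^ M = z % 2 ^ M := by
    rw [add_comm, Nat.add_mul_mod_self_right]
  have := congrArg (fun w => w.testBit i) e
  simpa only [Nat.testBit_mod_two_pow, hi, decide_true, Bool.true_and] using this

/-- Only the lowest qk bits are read. A field of a code word is thus selected by a division alone,
and no remainder is needed. -/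
theorem wordPoint_mul_two_pow_add (q k c x : ℕ) :
    wordPoint q k (c * 2 ^ (q * k) + x) = wordPoint q k x := by
  unfold wordPoint
  congr 1
  funext i h
  exact testBit_mul_two_pow_add (mul_add_lt_mul h.2 i.2)

/-! ### Leaves: sign constraints and losses -/

section specs

variable {n m N D : ℕ} {O : Oracles n m N}

variable (O) in
/-- The code word with parts `u`, `x`, `y`. -/
def joinWord (u x y : ℕ) : ℕ := (u * 2 ^ (n * O.k) + x) * 2 ^ (m * O.k) + y

theorem leafLoss_joinWord {u x y : ℕ} (hx : x < 2 ^ (n * O.k)) (hy : y < 2 ^ (m * O.k)) :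
    leafLoss O (joinWord O u x y) =
      O.ℓ (O.f (wordPoint n O.k x) (wordPoint N O.k u)) (wordPoint m O.k y) := by
  rw [leafLoss, joinWord, wordPoint_mul_two_pow_add, add_comm (n * O.k), pow_add,
    ← Nat.div_div_eq_div_mul, mul_add_div_of_lt hy, mul_add_div_of_lt hx, wordPoint_mul_two_pow_add]

theorem joinWord_lt {u x y : ℕ} (hu : u < 2 ^ (N * O.k)) (hx : x < 2 ^ (n * O.k))
    (hy : y < 2 ^ (m * O.k)) : joinWord O u x y < 2 ^ (N * O.k + n * O.k + m * O.k) := by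
  rw [joinWord, pow_add, pow_add]
  exact mul_add_lt_mul hy (mul_add_lt_mul hx hu)

variable (O D) in
/-- The registers during the treatment of the leaves. -/
structure LeafRegs (u x y i : ℕ) (R : ℕ → ℕ) : Prop where
  r13 : R 13 = 2 ^ (N * O.k + n * O.k + m * O.k) * D
  r25 : R 25 = 2 ^ (N * O.k + n * O.k + m * O.k) * D - D + (joinWord O u x y * D + i)
  r26 : R 26 = joinWord O u x y * D + i
  r27 : R 27 = u

variable (O D) in
-- `ParamInv`, `InputInv`, `LabelInv`, `LeafInv` are the invariants of four nested loops. Leaving a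
-- loop agrees with the next step of the surrounding one because `joinWord` carries over, for
-- example from x = 2^(nk) to u + 1.
def ParamInv (u : ℕ) (R : ℕ → ℕ) (M : ℕ → ℝ) : Prop :=
  Base D (N * O.k) (n * O.k) (m * O.k) R M ∧ LeafRegs D O u 0 0 0 R

variable (O D) in
def InputInv (u x : ℕ) (R : ℕ → ℕ) (M : ℕ → ℝ) : Prop :=
  Base D (N * O.k) (n * O.k) (m * O.k) R M ∧ LeafRegs D O u x 0 0 R ∧ R 28 = x

variable (O D) in
def LabelInv (u x y : ℕ) (R : ℕ → ℕ) (M : ℕ → ℝ) : Prop :=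
  Base D (N * O.k) (n * O.k) (m * O.k) R M ∧ LeafRegs D O u x y 0 R ∧ R 28 = x ∧ R 29 = y ∧
    ∀ i : Fin m, M (4 + i) = O.f (wordPoint n O.k x) (wordPoint N O.k u) i

variable (O D) in
def LeafInv (u x y i : ℕ) (R : ℕ → ℕ) (M : ℕ → ℝ) : Prop :=
  Base D (N * O.k) (n * O.k) (m * O.k) R M ∧ LeafRegs D O u x y i R ∧ R 28 = x ∧ R 29 = y ∧
    R 30 = i ∧ M 3 = leafLoss O (joinWord O u x y) ∧
    ∀ i : Fin m, M (4 + i) = O.f (wordPoint n O.k x) (wordPoint N O.k u) i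

variable (O D) in
def leafItems (w i : ℕ) (t : Table) (r j : ℕ) : Prop :=
  j = 2 ^ (N * O.k + n * O.k + m * O.k) * D - D + (w * D + i) ∧
    (t = .leA ∧ r = w * D + i ∨ t = .loss ∧ r = i)

theorem leafBody_spec {u x y i : ℕ} (hu : u < 2 ^ (N * O.k)) (hx : x < 2 ^ (n * O.k))
    (hy : y < 2 ^ (m * O.k)) (hi : i < D) :
    Spec O (target D O) leafBody (LeafInv D O u x y i) (LeafInv D O u x y (i + 1))
      (leafItems D O (joinWord O u x y) i) 6 0 := by
  rintro s ⟨hB, ⟨h13, h25, h26, h27⟩, h28, h29, h30, h3, hf⟩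
  have hw := joinWord_lt hu hx hy
  generalize hw' : joinWord O u x y = w at *
  have e1 : target D O .leA (w * D + i)
      (2 ^ (N * O.k + n * O.k + m * O.k) * D - D + (w * D + i)) = -1 := by
    rw [target, if_pos (mul_add_lt_mul hi hw), eqInd, if_pos rfl]
  have e2 : target D O .loss i
      (2 ^ (N * O.k + n * O.k + m * O.k) * D - D + (w * D + i)) = leafLoss O w := by
    have : 2 ^ (N * O.k + n * O.k + m * O.k) * D - D + (w * D + i) =
        (2 ^ (N * O.k + n * O.k + m * O.k) - 1 + w) * D + i := by
      rw [add_mul, Nat.sub_mul, one_mul]; omega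
    rw [target, this, mul_add_div_of_lt hi, mul_add_mod_of_lt hi, pow_succ]
    have := Nat.one_le_two_pow (n := N * O.k + n * O.k + m * O.k)
    rw [if_pos ⟨rfl, by omega, by omega⟩]
    congr 1; omega
  have hout : (leafBody.run O s).out = fun t r j =>
      if t = .loss ∧ r = i ∧ j = 2 ^ (N * O.k + n * O.k + m * O.k) * D - D + (w * D + i) then
        leafLoss O w else
      if t = .leA ∧ r = w * D + i ∧
        j = 2 ^ (N * O.k + n * O.k + m * O.k) * D - D + (w * D + i) then -1 else s.out t r j := by
    simp [leafBody, block, Cmd.run, Instr.exec, Config.tick, h25, h26, h30, hB.r8, hB.r11, hB.m1,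
      h3]
  refine ⟨⟨?_, ⟨?_, ?_, ?_, ?_⟩, ?_⟩, fun t r j h => ?_, fun t r j h => ?_, le_of_eq rfl,
    le_of_eq rfl⟩
  · refine Base.update (Base.update (Base.update (Base.update hB _ ?_) _ ?_) _ ?_) _ ?_ <;> simp
  · simp [leafBody, block, Cmd.run, Instr.exec, Config.tick, h13]
  · simp [leafBody, block, Cmd.run, Instr.exec, Config.tick, h25, hB.r8, hw', add_assoc]
  · simp [leafBody, block, Cmd.run, Instr.exec, Config.tick, h26, hB.r8, hw', add_assoc]
  · simp [leafBody, block, Cmd.run, Instr.exec, Config.tick, h27]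
  · simp [leafBody, block, Cmd.run, Instr.exec, Config.tick, h28, h29, h30, hB.r8, h3, hw', hf]
  · rw [hout]; dsimp only
    split_ifs with c1 c2
    · obtain ⟨rfl, rfl, rfl⟩ := c1; exact e2.symm
    · obtain ⟨rfl, rfl, rfl⟩ := c2; exact e1.symm
    · exact h
  · rw [hout]; dsimp only
    obtain ⟨rfl, ⟨rfl, rfl⟩ | ⟨rfl, rfl⟩⟩ := h
    · simp [e1]
    · simp [e2]

theorem labelBody_spec (hD : 0 < D) {u x y : ℕ} (hu : u < 2 ^ (N * O.k)) (hx : x < 2 ^ (n * O.k))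
    (hy : y < 2 ^ (m * O.k)) :
    Spec O (target D O) labelBody (LabelInv D O u x y) (LabelInv D O u x (y + 1))
      (fun t r j => ∃ i < D, leafItems D O (joinWord O u x y) i t r j) (13 * D) 1 := by
  have h1 : Spec O (target D O) (block [.evalL 12 29 11, .const 30 0]) (LabelInv D O u x y)
      (LeafInv D O u x y 0) (fun _ _ _ => False) 3 1 := by
    rintro s ⟨hB, ⟨h13, h25, h26, h27⟩, h28, h29, hf⟩
    refine ⟨⟨?_, ⟨?_, ?_, ?_, ?_⟩, ?_⟩, fun _ _ _ h => h, nofun, le_of_eq rfl, ?_⟩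
    · refine Base.of_mem (Base.update (Base.update hB _ ?_) _ ?_) ?_ ?_
      all_goals simp [block, Cmd.run, Instr.exec, Config.tick, hB.r11]
    · simpa [block, Cmd.run, Instr.exec, Config.tick] using h13
    · simpa [block, Cmd.run, Instr.exec, Config.tick] using h25
    · simpa [block, Cmd.run, Instr.exec, Config.tick] using h26
    · simpa [block, Cmd.run, Instr.exec, Config.tick] using h27
    · have e : ∀ i : ℕ, 4 + i ≠ 3 := by omega
      simp [block, Cmd.run, Instr.exec, Config.tick, h28, h29, hB.r11, hB.r12, hf,
        leafLoss_joinWord hx hy, e]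
    · simp [block, Cmd.run, Instr.exec, Config.tick]; omega
  have h2 := Spec.loop (O := O) (G := target D O) (c := leafBody) (r := 3) (cnt := D)
    (LeafInv D O u x y) (fun R M h => h.1.r3) (fun i hi => leafBody_spec hu hx hy hi)
  have h3 : Spec O (target D O) (block [.add 29 29 8]) (LeafInv D O u x y D)
      (LabelInv D O u x (y + 1)) (fun _ _ _ => False) 2 0 := by
    rintro s ⟨hB, ⟨h13, h25, h26, h27⟩, h28, h29, h30, h3, hf⟩
    have e : joinWord O u x (y + 1) * D + 0 = joinWord O u x y * D + D := by
      simp only [joinWord]; ring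
    refine ⟨⟨?_, ⟨?_, ?_, ?_, ?_⟩, ?_⟩, fun _ _ _ h => h, nofun, le_of_eq rfl, le_of_eq rfl⟩
    · refine Base.update (Base.update hB _ ?_) _ ?_ <;> simp
    · simpa [block, Cmd.run, Instr.exec, Config.tick] using h13
    · rw [e]; simpa [block, Cmd.run, Instr.exec, Config.tick] using h25
    · rw [e]; simpa [block, Cmd.run, Instr.exec, Config.tick] using h26
    · simpa [block, Cmd.run, Instr.exec, Config.tick] using h27
    · simp [block, Cmd.run, Instr.exec, Config.tick, h28, h29, hB.r8, hf]
  refine (h1.seq (h2.seq h3)).weaken (fun _ _ h => h) (fun _ _ h => h)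
    (fun t x y h => Or.inr (Or.inl h)) ?_ ?_
  · simp; omega
  · simp

theorem inputBody_spec (hD : 0 < D) {u x : ℕ} (hu : u < 2 ^ (N * O.k)) (hx : x < 2 ^ (n * O.k)) :
    Spec O (target D O) inputBody (InputInv D O u x) (InputInv D O u (x + 1))
      (fun t r j => ∃ y < 2 ^ (m * O.k), ∃ i < D, leafItems D O (joinWord O u x y) i t r j)
      (20 * 2 ^ (m * O.k) * D) (2 * 2 ^ (m * O.k)) := by
  have h1 : Spec O (target D O) (block [.evalF 28 27 12, .const 29 0]) (InputInv D O u x)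
      (LabelInv D O u x 0) (fun _ _ _ => False) 3 1 := by
    rintro s ⟨hB, ⟨h13, h25, h26, h27⟩, h28⟩
    refine ⟨⟨?_, ⟨?_, ?_, ?_, ?_⟩, ?_⟩, fun _ _ _ h => h, nofun, le_of_eq rfl, ?_⟩
    · refine Base.of_mem (Base.update (Base.update hB _ ?_) _ ?_) ?_ ?_
      all_goals simp [block, Cmd.run, Instr.exec, Config.tick, hB.r12]
    · simpa [block, Cmd.run, Instr.exec, Config.tick] using h13
    · simpa [block, Cmd.run, Instr.exec, Config.tick] using h25
    · simpa [block, Cmd.run, Instr.exec, Config.tick] using h26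
    · simpa [block, Cmd.run, Instr.exec, Config.tick] using h27
    · simp [block, Cmd.run, Instr.exec, Config.tick, h28, h27, hB.r12]
    · simp [block, Cmd.run, Instr.exec, Config.tick]; omega
  have h2 := Spec.loop (O := O) (G := target D O) (c := labelBody) (r := 24)
    (cnt := 2 ^ (m * O.k))
    (LabelInv D O u x) (fun R M h => h.1.r24) (fun y hy => labelBody_spec hD hu hx hy)
  have h3 : Spec O (target D O) (block [.add 28 28 8]) (LabelInv D O u x (2 ^ (m * O.k)))
      (InputInv D O u (x + 1)) (fun _ _ _ => False) 2 0 := by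
    rintro s ⟨hB, ⟨h13, h25, h26, h27⟩, h28, h29, hf⟩
    have e : joinWord O u (x + 1) 0 = joinWord O u x (2 ^ (m * O.k)) := by
      simp only [joinWord]; ring
    refine ⟨⟨?_, ⟨?_, ?_, ?_, ?_⟩, ?_⟩, fun _ _ _ h => h, nofun, le_of_eq rfl, le_of_eq rfl⟩
    · refine Base.update (Base.update hB _ ?_) _ ?_ <;> simp
    · simpa [block, Cmd.run, Instr.exec, Config.tick] using h13
    · rw [e]; simpa [block, Cmd.run, Instr.exec, Config.tick] using h25
    · rw [e]; simpa [block, Cmd.run, Instr.exec, Config.tick] using h26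
    · simpa [block, Cmd.run, Instr.exec, Config.tick] using h27
    · simp [block, Cmd.run, Instr.exec, Config.tick, h28, hB.r8]
  refine (h1.seq (h2.seq h3)).weaken (fun _ _ h => h) (fun _ _ h => h)
    (fun t x y h => Or.inr (Or.inl h)) ?_ ?_
  · have := Nat.one_le_two_pow (n := m * O.k)
    generalize 2 ^ (m * O.k) = z at *
    simp only [Finset.sum_const, Finset.card_range, smul_eq_mul]
    nlinarith [Nat.mul_pos this hD, Nat.mul_le_mul this (le_refl D), Nat.le_mul_of_pos_right z hD]
  -- One call of f and 2^(mk) calls of ℓ.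
  · have := Nat.one_le_two_pow (n := m * O.k)
    simp; omega

theorem paramBody_spec (hD : 0 < D) {u : ℕ} (hu : u < 2 ^ (N * O.k)) :
    Spec O (target D O) paramBody (ParamInv D O u) (ParamInv D O (u + 1))
      (fun t r j => ∃ x < 2 ^ (n * O.k), ∃ y < 2 ^ (m * O.k), ∃ i < D,
        leafItems D O (joinWord O u x y) i t r j)
      (26 * 2 ^ (n * O.k + m * O.k) * D) (2 * 2 ^ (n * O.k + m * O.k)) := by
  have h1 : Spec O (target D O) (block [.const 28 0]) (ParamInv D O u)
      (InputInv D O u 0) (fun _ _ _ => False) 2 0 := by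
    rintro s ⟨hB, ⟨h13, h25, h26, h27⟩⟩
    refine ⟨⟨?_, ⟨?_, ?_, ?_, ?_⟩, ?_⟩, fun _ _ _ h => h, nofun, le_of_eq rfl, le_of_eq rfl⟩
    · refine Base.update (Base.update hB _ ?_) _ ?_ <;> simp
    · simpa [block, Cmd.run, Instr.exec, Config.tick] using h13
    · simpa [block, Cmd.run, Instr.exec, Config.tick] using h25
    · simpa [block, Cmd.run, Instr.exec, Config.tick] using h26
    · simpa [block, Cmd.run, Instr.exec, Config.tick] using h27
    · simp [block, Cmd.run, Instr.exec, Config.tick]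
  have h2 := Spec.loop (O := O) (G := target D O) (c := inputBody) (r := 23)
    (cnt := 2 ^ (n * O.k))
    (InputInv D O u) (fun R M h => h.1.r23) (fun x hx => inputBody_spec hD hu hx)
  have h3 : Spec O (target D O) (block [.add 27 27 8]) (InputInv D O u (2 ^ (n * O.k)))
      (ParamInv D O (u + 1)) (fun _ _ _ => False) 2 0 := by
    rintro s ⟨hB, ⟨h13, h25, h26, h27⟩, h28⟩
    have e : joinWord O (u + 1) 0 0 = joinWord O u (2 ^ (n * O.k)) 0 := by
      simp only [joinWord]; ring
    refine ⟨⟨?_, ⟨?_, ?_, ?_, ?_⟩⟩, fun _ _ _ h => h, nofun, le_of_eq rfl, le_of_eq rfl⟩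
    · refine Base.update (Base.update hB _ ?_) _ ?_ <;> simp
    · simpa [block, Cmd.run, Instr.exec, Config.tick] using h13
    · rw [e]; simpa [block, Cmd.run, Instr.exec, Config.tick] using h25
    · rw [e]; simpa [block, Cmd.run, Instr.exec, Config.tick] using h26
    · simp [block, Cmd.run, Instr.exec, Config.tick, h27, hB.r8]
  refine (h1.seq (h2.seq h3)).weaken (fun _ _ h => h) (fun _ _ h => h)
    (fun t x y h => Or.inr (Or.inl h)) ?_ ?_
  · have h4 := Nat.one_le_two_pow (n := m * O.k)
    have h5 := Nat.one_le_two_pow (n := n * O.k)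
    rw [pow_add]
    generalize 2 ^ (m * O.k) = z at *
    generalize 2 ^ (n * O.k) = z' at *
    simp only [Finset.sum_const, Finset.card_range, smul_eq_mul]
    have h6 : 1 ≤ z * D := Nat.mul_pos h4 hD
    have h7 : 1 ≤ z' * (z * D) := Nat.mul_pos h5 h6
    have h8 : z' ≤ z' * (z * D) := Nat.le_mul_of_pos_right _ h6
    have e1 : z' * (20 * z * D + 1) = 20 * (z' * (z * D)) + z' := by ring
    have e2 : 26 * (z' * z) * D = 26 * (z' * (z * D)) := by ring
    omega
  · simp only [Finset.sum_const, Finset.card_range, smul_eq_mul]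
    rw [pow_add]
    apply le_of_eq; ring

theorem leavesCmd_spec (hD : 0 < D) :
    Spec O (target D O) leavesCmd (MidInv D O (N * O.k + n * O.k + m * O.k))
      (ParamInv D O (2 ^ (N * O.k)))
      (fun t r j => ∃ u < 2 ^ (N * O.k), ∃ x < 2 ^ (n * O.k), ∃ y < 2 ^ (m * O.k), ∃ i < D,
        leafItems D O (joinWord O u x y) i t r j)
      (32 * 2 ^ (N * O.k + n * O.k + m * O.k) * D)
      (2 * 2 ^ (N * O.k + n * O.k + m * O.k)) := by
  have h1 : Spec O (target D O) (block [.sub 25 13 3, .const 26 0, .const 27 0])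
      (MidInv D O (N * O.k + n * O.k + m * O.k))
      (ParamInv D O 0) (fun _ _ _ => False) 4 0 := by
    rintro s ⟨hB, h13, h15, h14⟩
    refine ⟨⟨?_, ⟨?_, ?_, ?_, ?_⟩⟩, fun _ _ _ h => h, nofun, le_of_eq rfl, le_of_eq rfl⟩
    · refine Base.update (Base.update (Base.update (Base.update hB _ ?_) _ ?_) _ ?_) _ ?_ <;> simp
    · simpa [block, Cmd.run, Instr.exec, Config.tick] using h13
    · simp [block, Cmd.run, Instr.exec, Config.tick, joinWord, h13, hB.r3]
    · simp [block, Cmd.run, Instr.exec, Config.tick, joinWord]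
    · simp [block, Cmd.run, Instr.exec, Config.tick]
  have h2 := Spec.loop (O := O) (G := target D O) (c := paramBody) (r := 22)
    (cnt := 2 ^ (N * O.k))
    (ParamInv D O) (fun R M h => h.1.r22) (fun x hx => paramBody_spec hD hx)
  refine (h1.seq h2).weaken (fun _ _ h => h) (fun _ _ h => h) (fun t x y h => Or.inr h) ?_ ?_
  · have h4 := Nat.one_le_two_pow (n := n * O.k + m * O.k)
    have h5 := Nat.one_le_two_pow (n := N * O.k)
    rw [add_assoc (N * O.k), pow_add _ (N * O.k)]
    generalize 2 ^ (n * O.k + m * O.k) = z at *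
    generalize 2 ^ (N * O.k) = z' at *
    simp only [Finset.sum_const, Finset.card_range, smul_eq_mul]
    have h6 : 1 ≤ z * D := Nat.mul_pos h4 hD
    have h7 : 1 ≤ z' * (z * D) := Nat.mul_pos h5 h6
    have h8 : z' ≤ z' * (z * D) := Nat.le_mul_of_pos_right _ h6
    have e1 : z' * (26 * z * D + 1) = 26 * (z' * (z * D)) + z' := by ring
    have e2 : 32 * (z' * z) * D = 32 * (z' * (z * D)) := by ring
    omega
  · simp only [Finset.sum_const, Finset.card_range, smul_eq_mul]
    rw [add_assoc (N * O.k), pow_add _ (N * O.k)]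
    apply le_of_eq; ring

end specs

theorem run_seq {n m N : ℕ} (O : Oracles n m N) (c₁ c₂ : Cmd) (s : Config) :
    (Cmd.seq c₁ c₂).run O s = c₂.run O (c₁.run O s) := rfl

theorem run_instr {n m N : ℕ} (O : Oracles n m N) (i : Instr) (s : Config) :
    (Cmd.instr i).run O s = (i.exec O s).tick := rfl

/-! ### Links, bounds from Φ, setup and roots -/

section specs

variable {n m N D : ℕ} {O : Oracles n m N}

variable (O D) in
/-- The state before the links of the parameter word `u` are written. -/
def LinksInv (u : ℕ) (R : ℕ → ℕ) (M : ℕ → ℝ) : Prop :=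
  Base D (N * O.k) (n * O.k) (m * O.k) R M ∧
    R 13 = (2 ^ (N * O.k + n * O.k + m * O.k) + u) * D ∧ R 31 = (2 ^ (N * O.k) + u - 1) * D ∧
    R 26 = 2 ^ (N * O.k + n * O.k + m * O.k) * D + u ∧ R 27 = u ∧
    R 25 = 2 ^ (N * O.k + n * O.k + m * O.k) * D - D + 2 ^ (N * O.k + n * O.k + m * O.k) * D

variable (O D) in
def LinkInv (u i : ℕ) (R : ℕ → ℕ) (M : ℕ → ℝ) : Prop :=
  Base D (N * O.k) (n * O.k) (m * O.k) R M ∧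
    R 13 = (2 ^ (N * O.k + n * O.k + m * O.k) + u) * D + (i + 1) ∧
    R 31 = (2 ^ (N * O.k) + u - 1) * D + (i + 1) ∧ R 32 = (2 ^ (N * O.k) + u - 1) * D ∧
    R 26 = 2 ^ (N * O.k + n * O.k + m * O.k) * D + (u + 1) ∧ R 27 = u + 1 ∧
    R 25 = 2 ^ (N * O.k + n * O.k + m * O.k) * D - D + 2 ^ (N * O.k + n * O.k + m * O.k) * D

variable (O D) in
def linkItems (u i : ℕ) (t : Table) (r j : ℕ) : Prop :=
  t = .eqA ∧ r = (2 ^ (N * O.k + n * O.k + m * O.k) + u) * D + (i + 1) ∧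
    (j = (2 ^ (N * O.k) + u - 1) * D + (i + 1) ∨ j = (2 ^ (N * O.k) + u - 1) * D)

variable (O D) in
def boundItems (u : ℕ) (t : Table) (r j : ℕ) : Prop :=
  r = 2 ^ (N * O.k + n * O.k + m * O.k) * D + u ∧
    (t = .leA ∧ j = (2 ^ (N * O.k) + u - 1) * D ∨ t = .leb ∧ j = 0)

theorem target_link {u d : ℕ} (hu : u < 2 ^ (N * O.k)) (hd : d < D) (j : ℕ) :
    target D O .eqA ((2 ^ (N * O.k + n * O.k + m * O.k) + u) * D + d) j =
      eqInd j ((2 ^ (N * O.k) + u - 1) * D + d) - eqInd j ((2 ^ (N * O.k) + u - 1) * D) := by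
  have h := Nat.one_le_two_pow (n := N * O.k + n * O.k + m * O.k)
  have h1 : ¬ (2 ^ (N * O.k + n * O.k + m * O.k) + u) * D + d < D := by nlinarith
  have h2 : ¬ (2 ^ (N * O.k + n * O.k + m * O.k) + u) * D + d <
      2 ^ (N * O.k + n * O.k + m * O.k) * D := by nlinarith
  rw [target, if_neg h1, if_neg h2, mul_add_div_of_lt hd, mul_add_mod_of_lt hd, if_pos (by omega),
    Nat.add_sub_cancel_left]

theorem linkBody_spec {u i : ℕ} (hu : u < 2 ^ (N * O.k)) (hi : i < D - 1) :
    Spec O (target D O) linkBody (LinkInv D O u i) (LinkInv D O u (i + 1))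
      (linkItems D O u i) 5 0 := by
  rintro s ⟨hB, h13, h31, h32, h26, h27, h25⟩
  have hi' : i + 1 < D := by omega
  have e1 : target D O .eqA ((2 ^ (N * O.k + n * O.k + m * O.k) + u) * D + (i + 1))
      ((2 ^ (N * O.k) + u - 1) * D + (i + 1)) = 1 := by
    rw [target_link hu hi', eqInd, eqInd, if_pos rfl, if_neg (by omega), sub_zero]
  have e2 : target D O .eqA ((2 ^ (N * O.k + n * O.k + m * O.k) + u) * D + (i + 1))
      ((2 ^ (N * O.k) + u - 1) * D) = -1 := by
    rw [target_link hu hi', eqInd, eqInd, if_neg (by omega), if_pos rfl, zero_sub]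
  have hout : (linkBody.run O s).out = fun t r j =>
      if t = .eqA ∧ r = (2 ^ (N * O.k + n * O.k + m * O.k) + u) * D + (i + 1) ∧
        j = (2 ^ (N * O.k) + u - 1) * D then -1 else
      if t = .eqA ∧ r = (2 ^ (N * O.k + n * O.k + m * O.k) + u) * D + (i + 1) ∧
        j = (2 ^ (N * O.k) + u - 1) * D + (i + 1) then 1 else s.out t r j := by
    simp [linkBody, block, Cmd.run, Instr.exec, Config.tick, h13, h31, h32, hB.r8, hB.r9, hB.m0,
      hB.m1]
  refine ⟨⟨?_, ?_⟩, fun t r j h => ?_, fun t r j h => ?_, le_of_eq rfl, le_of_eq rfl⟩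
  · refine Base.update (Base.update (Base.update hB _ ?_) _ ?_) _ ?_ <;> simp
  · simp [linkBody, block, Cmd.run, Instr.exec, Config.tick, h13, h31, h32, h26, h27, h25, hB.r8,
      add_assoc]
  · rw [hout]; dsimp only
    split_ifs with c1 c2
    · obtain ⟨rfl, rfl, rfl⟩ := c1; exact e2.symm
    · obtain ⟨rfl, rfl, rfl⟩ := c2; exact e1.symm
    · exact h
  · rw [hout]; dsimp only
    obtain ⟨rfl, rfl, rfl | rfl⟩ := h
    · simp [e1]
    · simp [e2]

theorem linksBody_spec (hD : 0 < D) {u : ℕ} (hu : u < 2 ^ (N * O.k)) :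
    Spec O (target D O) linksBody (LinksInv D O u) (LinksInv D O (u + 1))
      (fun t r j => boundItems D O u t r j ∨ ∃ i < D - 1, linkItems D O u i t r j)
      (10 * D) 1 := by
  classical
  have h1 : Spec O (target D O) (block [.testPhi 27 10, .emit .leA 26 31 9, .emit .leb 26 9 10,
      .add 26 26 8, .add 27 27 8, .add 32 31 9, .add 13 13 8, .add 31 31 8]) (LinksInv D O u)
      (LinkInv D O u 0) (boundItems D O u) 9 1 := by
    rintro s ⟨hB, h13, h31, h26, h27, h25⟩
    have e1 : target D O .leA (2 ^ (N * O.k + n * O.k + m * O.k) * D + u)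
        ((2 ^ (N * O.k) + u - 1) * D) = 1 := by
      rw [target, if_neg (by omega), if_pos (by omega), Nat.add_sub_cancel_left, eqInd, if_pos rfl]
    have e2 : target D O .leb (2 ^ (N * O.k + n * O.k + m * O.k) * D + u) 0 =
        if wordPoint N O.k u ∈ O.Φ then 1 else 0 := by
      rw [target, Nat.add_sub_cancel_left]
      by_cases h : wordPoint N O.k u ∈ O.Φ <;> simp [h, hu]
    have hout : ((block [.testPhi 27 10, .emit .leA 26 31 9, .emit .leb 26 9 10,
      .add 26 26 8, .add 27 27 8, .add 32 31 9, .add 13 13 8, .add 31 31 8]).run O s).out =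
      fun t r j =>
        if t = .leb ∧ r = 2 ^ (N * O.k + n * O.k + m * O.k) * D + u ∧ j = 0 then
          if wordPoint N O.k u ∈ O.Φ then 1 else 0 else
        if t = .leA ∧ r = 2 ^ (N * O.k + n * O.k + m * O.k) * D + u ∧
          j = (2 ^ (N * O.k) + u - 1) * D then 1 else s.out t r j := by
      simp [block, Cmd.run, Instr.exec, Config.tick, h31, h26, h27, hB.r9, hB.r10, hB.m0]
    refine ⟨⟨?_, ?_⟩, fun t r j h => ?_, fun t r j h => ?_, le_of_eq rfl, le_of_eq rfl⟩
    · refine Base.of_mem (Base.update (Base.update (Base.update (Base.update (Base.update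
        (Base.update hB _ ?_) _ ?_) _ ?_) _ ?_) _ ?_) _ ?_) ?_ ?_
      all_goals simp [block, Cmd.run, Instr.exec, Config.tick, hB.r10]
    · simp [block, Cmd.run, Instr.exec, Config.tick, h13, h31, h26, h27, h25, hB.r8, hB.r9,
        add_assoc]
    · rw [hout]; dsimp only
      split_ifs with c1 c2 c3
      · obtain ⟨rfl, rfl, rfl⟩ := c1; rw [e2, if_pos c2]
      · obtain ⟨rfl, rfl, rfl⟩ := c1; rw [e2, if_neg c2]
      · obtain ⟨rfl, rfl, rfl⟩ := c3; exact e1.symm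
      · exact h
    · rw [hout]; dsimp only
      obtain ⟨rfl, ⟨rfl, rfl⟩ | ⟨rfl, rfl⟩⟩ := h
      · simp [e1]
      · simp [e2]
  have h2 := Spec.loop (O := O) (G := target D O) (c := linkBody) (r := 33) (cnt := D - 1)
    (LinkInv D O u) (fun R M h => h.1.r33) (fun i hi => linkBody_spec hu hi)
  refine (h1.seq h2).weaken (fun _ _ h => h) ?_ (fun t x y h => h) ?_ ?_
  · rintro R M ⟨hB, h13, h31, h32, h26, h27, h25⟩
    refine ⟨hB, ?_, ?_, h26, h27, h25⟩
    · rw [h13, Nat.sub_add_cancel hD]; ring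
    · rw [h31, Nat.sub_add_cancel hD, ← Nat.succ_mul]
      have := Nat.one_le_two_pow (n := N * O.k)
      congr 1; omega
  · simp; omega
  · simp

theorem linksCmd_spec (hD : 0 < D) :
    Spec O (target D O) linksCmd (ParamInv D O (2 ^ (N * O.k))) (LinksInv D O (2 ^ (N * O.k)))
      (fun t r j => ∃ u < 2 ^ (N * O.k),
        (boundItems D O u t r j ∨ ∃ i < D - 1, linkItems D O u i t r j))
      (20 * 2 ^ (N * O.k) * D) (2 ^ (N * O.k)) := by
  have h1 : Spec O (target D O) (.seq (block [.const 31 0, .const 27 0])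
      (.seq (.loop 3 (.instr (.add 31 31 22))) (block [.sub 31 31 3])))
      (ParamInv D O (2 ^ (N * O.k))) (LinksInv D O 0) (fun _ _ _ => False) (6 + 2 * D) 0 := by
    rintro s ⟨hB, ⟨h13, h25, h26, h27⟩⟩
    -- After the last leaf the counters point just behind the largest code word.
    have e : joinWord O (2 ^ (N * O.k)) 0 0 = 2 ^ (N * O.k + n * O.k + m * O.k) := by
      simp [joinWord, pow_add]
    simp only [run_seq, run_instr, run_loop_add O 3 31 22 (by norm_num), block, Instr.exec,
      Config.tick]
    refine ⟨⟨?_, ?_⟩, fun _ _ _ h => h, nofun, ?_, le_of_eq rfl⟩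
    · refine Base.update (Base.update (Base.update (Base.update (Base.update (Base.update hB _ ?_)
        _ ?_) _ ?_) _ ?_) _ ?_) _ ?_ <;> simp
    · simp [h13, h25, h26, e, hB.r3, hB.r22, Nat.sub_mul, mul_comm D]
    · simp [hB.r3]; omega
  have h2 := Spec.loop (O := O) (G := target D O) (c := linksBody) (r := 22)
    (cnt := 2 ^ (N * O.k)) (LinksInv D O) (fun R M h => h.1.r22)
    (fun i hi => linksBody_spec hD hi)
  have h3 := (h1.seq h2).weaken (fun _ _ h => h) (fun _ _ h => h) (fun t x y h => Or.inr h)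
    (B' := 20 * 2 ^ (N * O.k) * D) (Q' := 2 ^ (N * O.k)) (by
      have h4 := Nat.one_le_two_pow (n := N * O.k)
      generalize 2 ^ (N * O.k) = z at *
      simp only [Finset.sum_const, Finset.card_range, smul_eq_mul]
      have h6 : 1 ≤ z * D := Nat.mul_pos h4 hD
      have h7 : z ≤ z * D := Nat.le_mul_of_pos_right _ hD
      have h8 : D ≤ z * D := Nat.le_mul_of_pos_left _ h4
      have e1 : z * (10 * D + 1) = 10 * (z * D) + z := by ring
      have e2 : 20 * z * D = 20 * (z * D) := by ring
      omega) (by simp)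
  -- The bracketing of the sequence differs from that of `linksCmd`, but both run identically by
  -- definition.
  exact h3

/-- The registers and the memory at the start. -/
def StartInv (n m N D k : ℕ) (R : ℕ → ℕ) (M : ℕ → ℝ) : Prop :=
  R = (fun r => [n, m, N, D, k].getD r 0) ∧ M = fun _ => 0

variable (O D) in
def RootInv (i : ℕ) (R : ℕ → ℕ) (M : ℕ → ℝ) : Prop :=
  Base D (N * O.k) (n * O.k) (m * O.k) R M ∧ R 13 = i ∧ R 15 = D ∧ R 14 = 1

/-- The registers and memory cells during the setup. -/
structure SetupInv (n m N D k a b e x y z : ℕ) (R : ℕ → ℕ) (M : ℕ → ℝ) : Prop where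
  r0 : R 0 = n
  r1 : R 1 = m
  r2 : R 2 = N
  r3 : R 3 = D
  r4 : R 4 = k
  r5 : R 5 = a
  r6 : R 6 = b
  r7 : R 7 = e
  r8 : R 8 = 1
  r9 : R 9 = 0
  r10 : R 10 = 2
  r11 : R 11 = 3
  r12 : R 12 = 4
  r13 : R 13 = 0
  r22 : R 22 = x
  r23 : R 23 = y
  r24 : R 24 = z
  m0 : M 0 = 1
  m1 : M 1 = -1

theorem Spec.addLoop {G : Table → ℕ → ℕ → ℝ} {p q : (ℕ → ℕ) → (ℕ → ℝ) → Prop} {r x y cnt : ℕ}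
    (hxy : x ≠ y)
    (h : ∀ R M, p R M → R r = cnt ∧ q (Function.update R x (R x + R r * R y)) M) :
    Spec O G (.loop r (.instr (.add x x y))) p q (fun _ _ _ => False) (1 + 2 * cnt) 0 := by
  intro s hs
  rw [run_loop_add O r x y hxy]
  refine ⟨(h _ _ hs).2, fun _ _ _ h => h, nofun, ?_, le_of_eq rfl⟩
  simp [(h _ _ hs).1, add_assoc]

theorem Spec.doubleLoop {G : Table → ℕ → ℕ → ℝ} {p q : (ℕ → ℕ) → (ℕ → ℝ) → Prop} {r x cnt : ℕ}
    (h : ∀ R M, p R M → R r = cnt ∧ q (Function.update R x (R x * 2 ^ R r)) M) :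
    Spec O G (.loop r (.instr (.add x x x))) p q (fun _ _ _ => False) (1 + 2 * cnt) 0 := by
  intro s hs
  rw [run_loop_double O r x]
  refine ⟨(h _ _ hs).2, fun _ _ _ h => h, nofun, ?_, le_of_eq rfl⟩
  simp [(h _ _ hs).1, add_assoc]

theorem setupCmd_spec :
    Spec O (target D O) setupCmd (StartInv n m N D O.k) (RootInv D O 0) (fun _ _ _ => False)
      (21 + 2 * (N + n + m) + 2 * (N * O.k + n * O.k + m * O.k)) 0 := by
  have h1 : Spec O (target D O)
      (block [.const 8 1, .const 10 2, .const 11 3, .const 12 4, .one 9, .rsub 8 10 9])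
      (StartInv n m N D O.k) (SetupInv n m N D O.k 0 0 0 0 0 0) (fun _ _ _ => False) 7 0 := by
    rintro s ⟨hR, hM⟩
    refine ⟨?_, fun _ _ _ h => h, nofun, le_of_eq rfl, le_of_eq rfl⟩
    constructor <;> simp [block, Cmd.run, Instr.exec, Config.tick, hR, hM]
  have h2 : Spec O (target D O) (.loop 2 (.instr (.add 5 5 4)))
      (SetupInv n m N D O.k 0 0 0 0 0 0) (SetupInv n m N D O.k (N * O.k) 0 0 0 0 0) _ _ _ :=
    Spec.addLoop (by norm_num) (fun R M h => ⟨h.r2, by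
      obtain ⟨⟩ := h; constructor <;> simp [*]⟩)
  have h3 : Spec O (target D O) (.loop 0 (.instr (.add 6 6 4)))
      (SetupInv n m N D O.k (N * O.k) 0 0 0 0 0)
      (SetupInv n m N D O.k (N * O.k) (n * O.k) 0 0 0 0) _ _ _ :=
    Spec.addLoop (by norm_num) (fun R M h => ⟨h.r0, by
      obtain ⟨⟩ := h; constructor <;> simp [*]⟩)
  have h4 : Spec O (target D O) (.loop 1 (.instr (.add 7 7 4)))
      (SetupInv n m N D O.k (N * O.k) (n * O.k) 0 0 0 0)
      (SetupInv n m N D O.k (N * O.k) (n * O.k) (m * O.k) 0 0 0) _ _ _ :=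
    Spec.addLoop (by norm_num) (fun R M h => ⟨h.r1, by
      obtain ⟨⟩ := h; constructor <;> simp [*]⟩)
  have h5 : Spec O (target D O) (block [.const 22 1, .const 23 1, .const 24 1])
      (SetupInv n m N D O.k (N * O.k) (n * O.k) (m * O.k) 0 0 0)
      (SetupInv n m N D O.k (N * O.k) (n * O.k) (m * O.k) 1 1 1) (fun _ _ _ => False) 4 0 := by
    intro s h
    refine ⟨?_, fun _ _ _ h => h, nofun, le_of_eq rfl, le_of_eq rfl⟩
    obtain ⟨⟩ := h
    constructor <;> simp [block, Cmd.run, Instr.exec, Config.tick, *]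
  have h6 : Spec O (target D O) (.loop 5 (.instr (.add 22 22 22)))
      (SetupInv n m N D O.k (N * O.k) (n * O.k) (m * O.k) 1 1 1)
      (SetupInv n m N D O.k (N * O.k) (n * O.k) (m * O.k) (2 ^ (N * O.k)) 1 1) _ _ _ :=
    Spec.doubleLoop (fun R M h => ⟨h.r5, by
      obtain ⟨⟩ := h; constructor <;> simp [*]⟩)
  have h7 : Spec O (target D O) (.loop 6 (.instr (.add 23 23 23)))
      (SetupInv n m N D O.k (N * O.k) (n * O.k) (m * O.k) (2 ^ (N * O.k)) 1 1)
      (SetupInv n m N D O.k (N * O.k) (n * O.k) (m * O.k) (2 ^ (N * O.k)) (2 ^ (n * O.k)) 1)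
      _ _ _ :=
    Spec.doubleLoop (fun R M h => ⟨h.r6, by
      obtain ⟨⟩ := h; constructor <;> simp [*]⟩)
  have h8 : Spec O (target D O) (.loop 7 (.instr (.add 24 24 24)))
      (SetupInv n m N D O.k (N * O.k) (n * O.k) (m * O.k) (2 ^ (N * O.k)) (2 ^ (n * O.k)) 1)
      (SetupInv n m N D O.k (N * O.k) (n * O.k) (m * O.k) (2 ^ (N * O.k)) (2 ^ (n * O.k))
        (2 ^ (m * O.k))) _ _ _ :=
    Spec.doubleLoop (fun R M h => ⟨h.r7, by
      obtain ⟨⟩ := h; constructor <;> simp [*]⟩)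
  have h9 : Spec O (target D O) (block [.sub 33 3 8, .const 14 1, .add 15 3 9])
      (SetupInv n m N D O.k (N * O.k) (n * O.k) (m * O.k) (2 ^ (N * O.k)) (2 ^ (n * O.k))
        (2 ^ (m * O.k))) (RootInv D O 0) (fun _ _ _ => False) 4 0 := by
    intro s h
    refine ⟨⟨?_, ?_⟩, fun _ _ _ h => h, nofun, le_of_eq rfl, le_of_eq rfl⟩
    · obtain ⟨⟩ := h
      constructor <;> simp [block, Cmd.run, Instr.exec, Config.tick, *]
    · simp [block, Cmd.run, Instr.exec, Config.tick, h.r3, h.r9, h.r13]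
  refine (h1.seq <| h2.seq <| h3.seq <| h4.seq <| h5.seq <| h6.seq <| h7.seq <| h8.seq h9).weaken
    (fun _ _ h => h) (fun _ _ h => h) (fun _ _ _ h => h.elim) ?_ ?_
  · omega
  · simp

theorem roots_spec (hD : 0 < D) :
    Spec O (target D O) (.loop 3 rootBody) (RootInv D O 0) (MidInv D O 0)
      (fun t r j => r < D ∧ (t = .eqA ∧ j = r ∨ t = .eqb ∧ j = 0)) (6 * D) 0 := by
  have h1 : ∀ i < D, Spec O (target D O) rootBody (RootInv D O i) (RootInv D O (i + 1))
      (fun t r j => r = i ∧ (t = .eqA ∧ j = r ∨ t = .eqb ∧ j = 0)) 4 0 := by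
    rintro i hi s ⟨hB, h13, h15, h14⟩
    have e1 : target D O .eqA i i = 1 := by simp [target, eqInd, hi]
    have e2 : target D O .eqb i 0 = 1 := by simp [target, hi]
    have hout : (rootBody.run O s).out = fun t r j =>
        if t = .eqb ∧ r = i ∧ j = 0 then 1 else
        if t = .eqA ∧ r = i ∧ j = i then 1 else s.out t r j := by
      simp [rootBody, block, Cmd.run, Instr.exec, Config.tick, h13, hB.r9, hB.m0]
    refine ⟨⟨?_, ?_⟩, fun t r j h => ?_, fun t r j h => ?_, le_of_eq rfl, le_of_eq rfl⟩
    · refine Base.update (Base.update hB _ ?_) _ ?_ <;> simp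
    · simp [rootBody, block, Cmd.run, Instr.exec, Config.tick, h13, h15, h14, hB.r8]
    · rw [hout]; dsimp only
      split_ifs with c1 c2
      · obtain ⟨rfl, rfl, rfl⟩ := c1; exact e2.symm
      · obtain ⟨rfl, rfl, rfl⟩ := c2; exact e1.symm
      · exact h
    · rw [hout]; dsimp only
      obtain ⟨rfl, ⟨rfl, rfl⟩ | ⟨rfl, rfl⟩⟩ := h
      · simp [e1]
      · simp [e2]
  refine (Spec.loop (RootInv D O) (fun R M h => h.1.r3) h1).weaken (fun _ _ h => h) ?_
    (fun t r j h => ⟨r, h.1, rfl, h.2⟩) ?_ ?_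
  · rintro R M ⟨hB, h13, h15, h14⟩
    exact ⟨hB, by simpa using h13, by simpa using h15, by simpa using h14⟩
  · simp; omega
  · simp

end specs

/-! ### Every nonzero entry is written -/

section specs

variable {n m N D : ℕ} {O : Oracles n m N}

/-- The level of node p is its binary logarithm, and the three groups of digits partition the
levels. -/
theorem exists_stage {a b e p : ℕ} (hp : 0 < p) (hT : p < 2 ^ (a + b + e)) :
    ∃ (S : Stage) (l : ℕ), l < S.len a b e ∧ 2 ^ (S.start a b + l) ≤ p ∧
      p < 2 ^ (S.start a b + l + 1) := by
  have h1 := Nat.pow_log_le_self 2 hp.ne'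
  have h2 := Nat.lt_pow_succ_log_self (b := 2) (by norm_num) p
  have h3 : Nat.log 2 p < a + b + e := Nat.log_lt_of_lt_pow hp.ne' hT
  rcases lt_or_ge (Nat.log 2 p) a with h | h
  · refine ⟨.param, Nat.log 2 p, h, ?_⟩
    simpa only [Stage.start, Nat.zero_add] using ⟨h1, h2⟩
  rcases lt_or_ge (Nat.log 2 p) (a + b) with h' | h'
  · refine ⟨.input, Nat.log 2 p - a, ?_, ?_⟩
    · simp only [Stage.len]; omega
    · simp only [Stage.start]
      rw [Nat.add_sub_cancel' h]; exact ⟨h1, h2⟩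
  · refine ⟨.label, Nat.log 2 p - (a + b), ?_, ?_⟩
    · simp only [Stage.len]; omega
    · simp only [Stage.start]
      rw [Nat.add_sub_cancel' h']; exact ⟨h1, h2⟩

variable (O D) in
def stageItems (S : Stage) (t : Table) (x y : ℕ) : Prop :=
  ∃ l < S.len (N * O.k) (n * O.k) (m * O.k),
    ∃ p, 2 ^ (S.start (N * O.k) (n * O.k) + l) ≤ p ∧
    p < 2 ^ (S.start (N * O.k) (n * O.k) + l + 1) ∧ ∃ i < D, nodeItems D O S l p i t x y

variable (O D) in
def leavesItems (t : Table) (r j : ℕ) : Prop :=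
  ∃ u < 2 ^ (N * O.k), ∃ x < 2 ^ (n * O.k), ∃ y < 2 ^ (m * O.k), ∃ i < D,
    leafItems D O (joinWord O u x y) i t r j

theorem leavesItems_of_lt {w i : ℕ} (hw : w < 2 ^ (N * O.k + n * O.k + m * O.k)) (hi : i < D)
    {t : Table} {r j : ℕ} (h : leafItems D O w i t r j) : leavesItems D O t r j := by
  refine ⟨w / 2 ^ (m * O.k) / 2 ^ (n * O.k), ?_, w / 2 ^ (m * O.k) % 2 ^ (n * O.k),
    Nat.mod_lt _ (by positivity), w % 2 ^ (m * O.k), Nat.mod_lt _ (by positivity), i, hi, ?_⟩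
  · rw [Nat.div_div_eq_div_mul, ← pow_add]
    refine Nat.div_lt_of_lt_mul ?_
    rw [← pow_add]
    exact hw.trans_eq (by congr 1; ring)
  · rwa [joinWord, mul_comm (_ / _), Nat.div_add_mod, mul_comm, Nat.div_add_mod]

theorem div_bounds_of_digitCoeff_ne_zero {level d j : ℕ} (h : digitCoeff D (level + 1) d j ≠ 0) :
    ∃ p, 2 ^ level ≤ p ∧ p < 2 ^ (level + 1) ∧ j = 2 * p * D + d ∧ j % D = d := by
  rw [digitCoeff] at h
  split_ifs at h with h1
  · obtain ⟨h1, h2, h3, h4⟩ := h1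
    have h5 : 2 ^ (level + 1) = 2 * 2 ^ level := pow_succ' 2 level
    have h6 : 2 ^ (level + 1 + 1) = 2 * 2 ^ (level + 1) := pow_succ' 2 (level + 1)
    -- Column j belongs to the odd node j / D + 1, whose parent is j / D / 2.
    refine ⟨j / D / 2, by omega, by omega, ?_, h1⟩
    rw [Nat.mul_div_cancel' (by omega), mul_comm, ← h1, Nat.div_add_mod]
  · exact absurd rfl h

/-- Outside the written positions the table is zero, as is the initial output; this turns agreement
on the written positions into equality of tables. -/
theorem mem_items_of_target_ne_zero (hD : 0 < D) (t : Table) (r j : ℕ) (h : target D O t r j ≠ 0) :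
    (r < D ∧ (t = .eqA ∧ j = r ∨ t = .eqb ∧ j = 0)) ∨ (∃ S, stageItems D O S t r j) ∨
      leavesItems D O t r j ∨
      ∃ u < 2 ^ (N * O.k), (boundItems D O u t r j ∨ ∃ i < D - 1, linkItems D O u i t r j) := by
  cases t with
  | eqA =>
    rcases lt_or_ge r D with h1 | h1
    · rw [target, if_pos h1, eqInd, ne_eq, ite_eq_right_iff, Classical.not_imp] at h
      exact Or.inl ⟨h1, Or.inl ⟨rfl, h.1⟩⟩
    have hr : r / D * D + r % D = r := by rw [mul_comm, Nat.div_add_mod]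
    have hm : r % D < D := Nat.mod_lt _ hD
    generalize r / D = p at hr
    generalize r % D = d at hr hm
    subst hr
    rcases lt_or_ge p (2 ^ (N * O.k + n * O.k + m * O.k)) with h2 | h2
    · have hp : 0 < p := by
        rcases Nat.eq_zero_or_pos p with rfl | hp
        · omega
        · exact hp
      obtain ⟨S, l, hl, h3, h4⟩ := exists_stage hp h2
      refine Or.inr (Or.inl ⟨S, l, hl, p, h3, h4, d, hm, Or.inl ⟨rfl, rfl, ?_⟩⟩)
      rw [target_node hm hp h2] at h
      by_contra! hc
      simp [eqInd, hc] at h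
    · obtain ⟨u, rfl⟩ := Nat.exists_eq_add_of_le h2
      have hu : u < 2 ^ (N * O.k) := by
        by_contra hc
        have h3 : ¬ (2 ^ (N * O.k + n * O.k + m * O.k) + u) * D + d <
          2 ^ (N * O.k + n * O.k + m * O.k) * D := by nlinarith
        rw [target, if_neg (by omega), if_neg h3, mul_add_div_of_lt hm, if_neg (by omega)] at h
        exact h rfl
      rw [target_link hu hm] at h
      -- For d = 0 the two terms of the link cancel.
      rcases Nat.eq_zero_or_pos d with rfl | hd
      · simp at h
      · refine Or.inr (Or.inr (Or.inr ⟨u, hu, Or.inr ⟨d - 1, by omega, rfl, ?_, ?_⟩⟩))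
        · rw [Nat.sub_add_cancel hd]
        · rw [Nat.sub_add_cancel hd]
          by_contra! hc
          simp [eqInd, hc] at h
  | eqb =>
    rw [target, ne_eq, ite_eq_right_iff, Classical.not_imp] at h
    exact Or.inl ⟨h.1.1, Or.inr ⟨rfl, h.1.2⟩⟩
  | leA =>
    rw [target] at h
    split_ifs at h with h1 h2
    · refine Or.inr (Or.inr (Or.inl (leavesItems_of_lt (w := r / D) (i := r % D)
        (Nat.div_lt_of_lt_mul (by rwa [mul_comm])) (Nat.mod_lt _ hD) ⟨?_, ?_⟩)))
      · rw [mul_comm (r / D), Nat.div_add_mod]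
        by_contra hc
        simp [eqInd, hc] at h
      · rw [mul_comm (r / D), Nat.div_add_mod]
        exact Or.inl ⟨rfl, rfl⟩
    · refine Or.inr (Or.inr (Or.inr
        ⟨r - 2 ^ (N * O.k + n * O.k + m * O.k) * D, by omega, Or.inl ⟨by omega, Or.inl ⟨rfl, ?_⟩⟩⟩))
      by_contra hc
      simp [eqInd, hc] at h
    · exact absurd rfl h
  | leb =>
    rw [target] at h
    split_ifs at h with hc
    · obtain ⟨h1, h2, h3, -⟩ := hc
      exact Or.inr (Or.inr (Or.inr ⟨r - 2 ^ (N * O.k + n * O.k + m * O.k) * D, by omega,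
        Or.inl ⟨by omega, Or.inr ⟨rfl, h1⟩⟩⟩))
    · exact absurd rfl h
  | loss =>
    rw [target] at h
    split_ifs at h with h1
    · obtain ⟨h1, h2, h3⟩ := h1
      rw [pow_succ] at h3
      refine Or.inr (Or.inr (Or.inl (leavesItems_of_lt
        (w := j / D + 1 - 2 ^ (N * O.k + n * O.k + m * O.k)) (i := r)
        (by omega) (h1 ▸ Nat.mod_lt _ hD) ⟨?_, Or.inr ⟨rfl, rfl⟩⟩)))
      have : 2 ^ (N * O.k + n * O.k + m * O.k) - 1 +
        (j / D + 1 - 2 ^ (N * O.k + n * O.k + m * O.k)) = j / D := by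
        have := Nat.one_le_two_pow (n := N * O.k + n * O.k + m * O.k)
        omega
      have e : 2 ^ (N * O.k + n * O.k + m * O.k) * D - D =
        (2 ^ (N * O.k + n * O.k + m * O.k) - 1) * D := by rw [Nat.sub_mul, one_mul]
      rw [e, ← Nat.add_assoc, ← Nat.add_mul, this, ← h1, mul_comm, Nat.div_add_mod]
    · exact absurd rfl h
  | zphi =>
    rw [target] at h
    split_ifs at h with h1
    · have e : N * O.k - r = (N * O.k - (r + 1)) + 1 := by omega
      rw [e] at h
      obtain ⟨p, h2, h3, h4, -⟩ := div_bounds_of_digitCoeff_ne_zero h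
      refine Or.inr (Or.inl ⟨.param, N * O.k - (r + 1), ?_, p, ?_, ?_, 0, hD,
        Or.inr ⟨rfl, ?_, h4⟩⟩)
      · simp only [Stage.len]; omega
      · simpa only [Stage.start, Nat.zero_add] using h2
      · simpa only [Stage.start, Nat.zero_add] using h3
      · simp only [Stage.len, Stage.stride]; omega
    · exact absurd rfl h
  | zx =>
    rw [target] at h
    split_ifs at h with h1
    · have hb : 0 < n * O.k := by
        rcases Nat.eq_zero_or_pos (n * O.k) with h2 | h2
        · rw [h2] at h1; omega
        · exact h2
      have hs : r % (n * O.k) < n * O.k := Nat.mod_lt _ hb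
      have e : N * O.k + n * O.k - r % (n * O.k) =
        N * O.k + (n * O.k - (r % (n * O.k) + 1)) + 1 := by omega
      rw [e] at h
      obtain ⟨p, h2, h3, h4, h5⟩ := div_bounds_of_digitCoeff_ne_zero h
      refine Or.inr (Or.inl ⟨.input, n * O.k - (r % (n * O.k) + 1), ?_, p, h2, h3,
        r / (n * O.k), h5 ▸ Nat.mod_lt _ hD, Or.inr ⟨rfl, ?_, h4⟩⟩)
      · simp only [Stage.len]; omega
      · simp only [Stage.len, Stage.stride]
        have := Nat.div_add_mod r (n * O.k)
        rw [mul_comm] at this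
        omega
    · exact absurd rfl h
  | zy =>
    rw [target] at h
    split_ifs at h with h1
    · have hb : 0 < m * O.k := by
        rcases Nat.eq_zero_or_pos (m * O.k) with h2 | h2
        · rw [h2] at h1; omega
        · exact h2
      have hs : r % (m * O.k) < m * O.k := Nat.mod_lt _ hb
      have e : N * O.k + n * O.k + m * O.k - r % (m * O.k) =
        N * O.k + n * O.k + (m * O.k - (r % (m * O.k) + 1)) + 1 := by omega
      rw [e] at h
      obtain ⟨p, h2, h3, h4, h5⟩ := div_bounds_of_digitCoeff_ne_zero h
      refine Or.inr (Or.inl ⟨.label, m * O.k - (r % (m * O.k) + 1), ?_, p, h2, h3,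
        r / (m * O.k), h5 ▸ Nat.mod_lt _ hD, Or.inr ⟨rfl, ?_, h4⟩⟩)
      · simp only [Stage.len]; omega
      · simp only [Stage.len, Stage.stride]
        have := Nat.div_add_mod r (m * O.k)
        rw [mul_comm] at this
        omega
    · exact absurd rfl h

/-- What the program does. -/
theorem lpProgram_run (hD : 0 < D) (hk : 0 < O.k) :
    let s := lpProgram.run O (startConfig n m N D O.k)
    s.reg 0 = (2 ^ (N * O.k + n * O.k + m * O.k + 1) - 1) * D ∧
    s.reg 1 = (2 ^ (N * O.k + n * O.k + m * O.k) + 2 ^ (N * O.k)) * D ∧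
    s.reg 2 = 2 ^ (N * O.k + n * O.k + m * O.k) * D + 2 ^ (N * O.k) ∧
    s.out = target D O ∧ s.time ≤ 200 * (2 ^ (N * O.k + n * O.k + m * O.k) * D) ∧
    s.callsF + s.callsL + s.callsPhi ≤ 200 * 2 ^ (N * O.k + n * O.k + m * O.k) := by
  intro s
  have hp := stageCmd_spec (n := n) (m := m) (N := N) (O := O) .param hD
  have hi := stageCmd_spec (n := n) (m := m) (N := N) (O := O) .input hD
  have hl := stageCmd_spec (n := n) (m := m) (N := N) (O := O) .label hD
  simp only [Stage.start, Stage.len, Nat.zero_add] at hp hi hl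
  have hfin : Spec O (target D O) (block [.add 0 25 9, .add 1 13 9, .add 2 26 9])
      (LinksInv D O (2 ^ (N * O.k)))
      (fun R _ => R 0 = (2 ^ (N * O.k + n * O.k + m * O.k + 1) - 1) * D ∧
        R 1 = (2 ^ (N * O.k + n * O.k + m * O.k) + 2 ^ (N * O.k)) * D ∧
        R 2 = 2 ^ (N * O.k + n * O.k + m * O.k) * D + 2 ^ (N * O.k)) (fun _ _ _ => False) 4 0 := by
    rintro s ⟨hB, h13, h31, h26, h27, h25⟩
    refine ⟨?_, fun _ _ _ h => h, nofun, le_of_eq rfl, le_of_eq rfl⟩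
    simp [block, Cmd.run, Instr.exec, Config.tick, h13, h25, h26, hB.r9]
    rw [pow_succ, Nat.sub_mul, mul_two, Nat.add_mul]
    have := Nat.mul_le_mul_right D (Nat.one_le_two_pow (n := N * O.k + n * O.k + m * O.k))
    omega
  obtain ⟨⟨h0, h1, h2⟩, P⟩ := (setupCmd_spec.seq <| (roots_spec hD).seq <| hp.seq <| hi.seq <|
    hl.seq <| (leavesCmd_spec hD).seq <| (linksCmd_spec hD).seq hfin)
      (startConfig n m N D O.k) ⟨rfl, rfl⟩
  have hX := Nat.one_le_two_pow (n := N * O.k + n * O.k + m * O.k)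
  have hT : N * O.k + n * O.k + m * O.k < 2 ^ (N * O.k + n * O.k + m * O.k) := Nat.lt_two_pow_self
  have ha : 2 ^ (N * O.k) ≤ 2 ^ (N * O.k + n * O.k + m * O.k) :=
    Nat.pow_le_pow_right (by norm_num) (by omega)
  have hb : 2 ^ (N * O.k + n * O.k) ≤ 2 ^ (N * O.k + n * O.k + m * O.k) :=
    Nat.pow_le_pow_right (by norm_num) (by omega)
  refine ⟨h0, h1, h2, ?_, P.time_le.trans ?_, P.calls_le.trans ?_⟩
  · funext t r j
    by_cases h : target D O t r j = 0
    · exact P.mono _ _ _ h.symm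
    · refine P.covers _ _ _ ?_
      rcases mem_items_of_target_ne_zero hD t r j h with h | ⟨S, h⟩ | h | h
      · exact Or.inr (Or.inl h)
      · cases S <;> simp only [stageItems, Stage.start, Stage.len, Nat.zero_add] at h
        · exact Or.inr (Or.inr (Or.inl h))
        · exact Or.inr (Or.inr (Or.inr (Or.inl h)))
        · exact Or.inr (Or.inr (Or.inr (Or.inr (Or.inl h))))
      · exact Or.inr (Or.inr (Or.inr (Or.inr (Or.inr (Or.inl h)))))
      · exact Or.inr (Or.inr (Or.inr (Or.inr (Or.inr (Or.inr (Or.inl h))))))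
  -- Positivity of k is needed here: the setup takes time proportional to N + n + m, which is then
  -- at most T < 2^T. All contributions together stay below 200.
  · have e1 := Nat.le_mul_of_pos_right N hk
    have e2 := Nat.le_mul_of_pos_right n hk
    have e3 := Nat.le_mul_of_pos_right m hk
    have e4 := Nat.mul_le_mul_right D ha
    have e5 := Nat.mul_le_mul_right D hb
    have e6 := Nat.le_mul_of_pos_left D hX
    have e7 := Nat.le_mul_of_pos_right (2 ^ (N * O.k + n * O.k + m * O.k)) hD
    simp only [mul_assoc 25, mul_assoc 32, mul_assoc 20, startConfig]
    omega
  · simp only [startConfig]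
    omega

end specs

/-! ### Convex hulls of junction trees -/

/-- A family of measures `lam d` on pairs with a common marginal `μ` yields a convex combination of
the points that arise by choosing the second components independently. -/
theorem mem_convexHull_of_marginals {α β ι E F : Type*} [Fintype ι] [AddCommGroup E] [Module ℝ E]
    [AddCommGroup F] [Module ℝ F] (s : Finset α) (t : Finset β) (A : Set α) (B : ι → Set β)
    (G : α → E) (H : α → β → F) (μ : α → ℝ) (lam : ι → α → β → ℝ)
    (hμ : ∀ a ∈ s, 0 ≤ μ a) (hμ1 : ∑ a ∈ s, μ a = 1) (hA : ∀ a ∈ s, a ∉ A → μ a = 0)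
    (hlam : ∀ d, ∀ a ∈ s, ∀ b ∈ t, 0 ≤ lam d a b)
    (hB : ∀ d, ∀ a ∈ s, ∀ b ∈ t, b ∉ B d → lam d a b = 0)
    (hm : ∀ d, ∀ a ∈ s, ∑ b ∈ t, lam d a b = μ a) :
    (∑ a ∈ s, μ a • G a, fun d => ∑ a ∈ s, ∑ b ∈ t, lam d a b • H a b) ∈
      convexHull ℝ {q : E × (ι → F) | ∃ a ∈ s, a ∈ A ∧ ∃ b : ι → β,
        (∀ d, b d ∈ t ∧ b d ∈ B d) ∧ q = (G a, fun d => H a (b d))} := by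
  classical
  set S := {q : E × (ι → F) | ∃ a ∈ s, a ∈ A ∧ ∃ b : ι → β,
        (∀ d, b d ∈ t ∧ b d ∈ B d) ∧ q = (G a, fun d => H a (b d))} with hS
  -- A point of marginal weight zero carries no weight at all, so it may be dropped before dividing
  -- by `μ a`.
  have hz : ∀ d, ∀ a ∈ s, μ a = 0 → ∀ b ∈ t, lam d a b = 0 := by
    intro d a ha h0
    rw [← hm d a ha] at h0
    exact (Finset.sum_eq_zero_iff_of_nonneg (hlam d a ha)).1 h0
  have key : ∀ a ∈ s.filter (fun a => μ a ≠ 0),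
      (G a, fun d => ∑ b ∈ t, (lam d a b / μ a) • H a b) ∈ convexHull ℝ S := by
    intro a ha
    obtain ⟨ha, h0⟩ := Finset.mem_filter.1 ha
    have hpos : 0 < μ a := lt_of_le_of_ne (hμ a ha) (Ne.symm h0)
    -- For fixed `a` the second components vary independently of each other, so `S` contains a full
    -- product, and membership in its hull can be tested factor by factor.
    have hsub : ({G a} : Set E) ×ˢ
        Set.pi Set.univ (fun d => (fun b => H a b) '' {b | b ∈ t ∧ b ∈ B d}) ⊆ S := by
      rintro ⟨x, y⟩ ⟨hx, hy⟩
      choose b hb hb' using fun d => hy d (Set.mem_univ d)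
      refine ⟨a, ha, by_contra fun h => h0 (hA a ha h), b, hb, ?_⟩
      exact Prod.ext hx (funext fun d => (hb' d).symm)
    refine convexHull_mono hsub ?_
    rw [convexHull_prod, convexHull_pi]
    refine ⟨subset_convexHull _ _ rfl, fun d _ => ?_⟩
    have e : ∑ b ∈ t, (lam d a b / μ a) • H a b =
        ∑ b ∈ t.filter (fun b => b ∈ B d), (lam d a b / μ a) • H a b := by
      rw [Finset.sum_filter_of_ne]
      intro b hb hne
      by_contra h
      rw [hB d a ha b hb h] at hne
      simp at hne
    -- The conditional weights given `a` sum to one, by the marginal condition.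
    have e1 : ∑ b ∈ t.filter (fun b => b ∈ B d), lam d a b / μ a = 1 := by
      rw [Finset.sum_filter_of_ne, ← Finset.sum_div, hm d a ha, div_self h0]
      intro b hb hne
      by_contra h
      rw [hB d a ha b hb h] at hne
      simp at hne
    dsimp only
    rw [e]
    refine (convex_convexHull ℝ _).sum_mem (fun b hb => ?_) e1 (fun b hb => ?_)
    · exact div_nonneg (hlam d a ha b (Finset.mem_filter.1 hb).1) hpos.le
    · exact subset_convexHull _ _ ⟨b, Finset.mem_filter.1 hb, rfl⟩
  have hsum : (∑ a ∈ s, μ a • G a, fun d => ∑ a ∈ s, ∑ b ∈ t, lam d a b • H a b) =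
      ∑ a ∈ s.filter (fun a => μ a ≠ 0),
        μ a • (G a, fun d => ∑ b ∈ t, (lam d a b / μ a) • H a b) := by
    rw [Finset.sum_filter_of_ne (fun a _ h => by rintro h0; exact h (by rw [h0, zero_smul]))]
    ext d
    · simp [Prod.fst_sum]
    · simp only [Prod.snd_sum, Prod.smul_snd, Finset.sum_apply, Pi.smul_apply, Finset.smul_sum,
        smul_smul]
      refine Finset.sum_congr rfl fun a ha => Finset.sum_congr rfl fun b hb => ?_
      by_cases h0 : μ a = 0
      · rw [hz d a ha h0 b hb]; simp
      · rw [mul_div_cancel₀ _ h0]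
  rw [hsum]
  refine (convex_convexHull ℝ S).sum_mem (fun a ha => hμ a (Finset.mem_filter.1 ha).1) ?_ key
  rwa [Finset.sum_filter_ne_zero]

/-! ### Sums over trees -/

theorem sum_range_mul_eq {M : Type*} [AddCommMonoid M] (p D : ℕ) (F : ℕ → M) :
    ∑ j ∈ Finset.range (p * D), F j =
      ∑ q ∈ Finset.range p, ∑ d ∈ Finset.range D, F (q * D + d) := by
  induction p with
  | zero => simp
  | succ p ih => rw [Nat.succ_mul, Finset.sum_range_add, ih, Finset.sum_range_succ]

/-- In a binary tree whose inner nodes carry the sum of their children, a node carries the sum of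
its descendants in any generation. -/
theorem node_eq_sum {T : ℕ} (F : ℕ → ℝ)
    (hF : ∀ p, 0 < p → p < 2 ^ T → F p = F (2 * p) + F (2 * p + 1)) (e l p : ℕ) (hp : 0 < p)
    (hl : l + e = T) (h : p < 2 ^ (l + 1)) :
    F p = ∑ i ∈ Finset.range (2 ^ e), F (p * 2 ^ e + i) := by
  induction e generalizing p l with
  | zero => simp
  | succ e ih =>
    have h1 : p * 2 ^ (e + 1) = 2 * p * 2 ^ e := by ring
    have h2 : (2 * p + 1) * 2 ^ e = 2 * p * 2 ^ e + 2 ^ e := by ring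
    have h3 : 2 ^ (l + 1 + 1) = 2 * 2 ^ (l + 1) := pow_succ' 2 (l + 1)
    have hpT : p < 2 ^ T := h.trans_le (Nat.pow_le_pow_right (by norm_num) (by omega))
    rw [hF p hp hpT, ih (l + 1) (2 * p) (by omega) (by omega) (by omega),
      ih (l + 1) (2 * p + 1) (by omega) (by omega) (by omega), h1, pow_succ, mul_two,
      Finset.sum_range_add]
    simp only [h2, add_assoc]

/-- The digit of the leaves at position `e` is the sum of the odd nodes on one level. -/
theorem sum_odd_nodes {T : ℕ} (F : ℕ → ℝ)
    (hF : ∀ p, 0 < p → p < 2 ^ T → F p = F (2 * p) + F (2 * p + 1)) (e l : ℕ) (hl : 0 < l)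
    (hle : l + e = T) :
    ∑ p ∈ Finset.range (2 ^ (T + 1) - 1),
      (if (p + 1) % 2 = 1 ∧ 2 ^ l ≤ p + 1 ∧ p + 1 < 2 ^ (l + 1) then F (p + 1) else 0) =
      ∑ w ∈ Finset.range (2 ^ T), bit (w.testBit e) * F (2 ^ T + w) := by
  have h1 : ∑ p ∈ Finset.range (2 ^ (T + 1) - 1),
      (if (p + 1) % 2 = 1 ∧ 2 ^ l ≤ p + 1 ∧ p + 1 < 2 ^ (l + 1) then F (p + 1) else 0) =
      ∑ q ∈ Finset.range (2 ^ l), if (2 ^ l + q) % 2 = 1 then F (2 ^ l + q) else 0 := by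
    have h2 : 2 ^ (l + 1) = 2 ^ l + 2 ^ l := by ring
    have h3 : 2 ^ (l + 1) ≤ 2 ^ (T + 1) := Nat.pow_le_pow_right (by norm_num) (by omega)
    have h4 := Nat.one_le_two_pow (n := l)
    -- The nodes are split into those above level l, level l itself, and those below it; only the
    -- middle part contributes.
    rw [show 2 ^ (T + 1) - 1 = (2 ^ l - 1) + (2 ^ l + (2 ^ (T + 1) - 2 ^ (l + 1))) by omega,
      Finset.sum_range_add, Finset.sum_range_add, Finset.sum_eq_zero, zero_add,
      Finset.sum_eq_zero (s := Finset.range (2 ^ (T + 1) - 2 ^ (l + 1))), add_zero]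
    · refine Finset.sum_congr rfl fun q hq => ?_
      have hq := Finset.mem_range.1 hq
      rw [show 2 ^ l - 1 + q + 1 = 2 ^ l + q by omega]
      congr 1
      simp only [eq_iff_iff, and_iff_left_iff_imp]
      omega
    · intro q hq
      rw [if_neg (by omega)]
    · intro q hq
      have hq := Finset.mem_range.1 hq
      rw [if_neg (by omega)]
  rw [h1, ← hle, pow_add, sum_range_mul_eq]
  refine Finset.sum_congr rfl fun q hq => ?_
  have hq := Finset.mem_range.1 hq
  have hb : ∀ i ∈ Finset.range (2 ^ e), bit ((q * 2 ^ e + i).testBit e) *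
      F (2 ^ l * 2 ^ e + (q * 2 ^ e + i)) =
      if (2 ^ l + q) % 2 = 1 then F ((2 ^ l + q) * 2 ^ e + i) else 0 := by
    intro i hi
    have hi := Finset.mem_range.1 hi
    -- For l > 0 the leading one of the node number does not affect its parity. At the root it
    -- would: node 1 is odd without encoding a digit.
    have h3 : 2 ^ l = 2 * 2 ^ (l - 1) := by rw [← pow_succ', Nat.sub_add_cancel hl]
    have h4 : (2 ^ l + q) % 2 = q % 2 := by omega
    rw [Nat.testBit_eq_decide_div_mod_eq, mul_add_div_of_lt hi, h4, add_mul, ← add_assoc, bit]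
    by_cases h5 : q % 2 = 1 <;> simp [h5]
  rw [Finset.sum_congr rfl hb]
  split_ifs with h3
  · exact node_eq_sum F hF e l _ (by positivity) hle (by rw [pow_succ]; omega)
  · simp

/-! ### The formulation -/

/-- `decode` is affine, hence compatible with weights of total one. -/
theorem decode_sum {ι : Type*} {k : ℕ} (s : Finset ι) (c : ι → ℝ) (z : ι → Fin k → ℝ)
    (hc : ∑ i ∈ s, c i = 1) :
    decode (fun h => ∑ i ∈ s, z i h * c i) = ∑ i ∈ s, c i * decode (z i) := by
  simp only [decode, mul_add, Finset.sum_add_distrib, mul_neg, mul_one, Finset.sum_neg_distrib, hc,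
    Finset.mul_sum]
  rw [Finset.sum_comm]
  congr 1
  exact Finset.sum_congr rfl fun i _ => Finset.sum_congr rfl fun h _ => by ring

/-- The linear program that is written by the program. -/
def lpFormulation {n m N : ℕ} (D : ℕ) (O : Oracles n m N) : Formulation n m N D O.k where
  nv := (2 ^ (N * O.k + n * O.k + m * O.k + 1) - 1) * D
  neq := (2 ^ (N * O.k + n * O.k + m * O.k) + 2 ^ (N * O.k)) * D
  nle := 2 ^ (N * O.k + n * O.k + m * O.k) * D + 2 ^ (N * O.k)
  eqA := Matrix.of fun r j => target D O .eqA r j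
  eqb := fun r => target D O .eqb r 0
  leA := Matrix.of fun r j => target D O .leA r j
  leb := fun r => target D O .leb r 0
  zx := fun d i h j => target D O .zx (((d : ℕ) * n + (i : ℕ)) * O.k + (h : ℕ)) j
  zy := fun d i h j => target D O .zy (((d : ℕ) * m + (i : ℕ)) * O.k + (h : ℕ)) j
  zφ := fun i h j => target D O .zphi ((i : ℕ) * O.k + (h : ℕ)) j
  L := fun d j => target D O .loss d j

theorem lpProgram_formulation {n m N D : ℕ} (O : Oracles n m N) (hD : 0 < D) (hk : 0 < O.k) :
    (lpProgram.run O (startConfig n m N D O.k)).formulation n m N D O.k = lpFormulation D O := by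
  obtain ⟨h0, h1, h2, hout, -⟩ := lpProgram_run (O := O) hD hk
  rw [Config.formulation, hout]
  -- The registers are dimensions in the types of the tables, so they are turned into variables
  -- before their values are substituted.
  generalize (lpProgram.run O (startConfig n m N D O.k)).reg 0 = x at *
  generalize (lpProgram.run O (startConfig n m N D O.k)).reg 1 = y at *
  generalize (lpProgram.run O (startConfig n m N D O.k)).reg 2 = z at *
  subst h0 h1 h2
  rfl

/-- The extension of a vector by zero. -/
def extend {nv : ℕ} (v : Fin nv → ℝ) (j : ℕ) : ℝ := if h : j < nv then v ⟨j, h⟩ else 0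

theorem extend_val {nv : ℕ} (v : Fin nv → ℝ) (j : Fin nv) : extend v j = v j := by
  simp [extend]

theorem dotProduct_eq_sum_range {nv : ℕ} (c : ℕ → ℝ) (v : Fin nv → ℝ) :
    (fun j : Fin nv => c j) ⬝ᵥ v = ∑ j ∈ Finset.range nv, c j * extend v j := by
  rw [← Fin.sum_univ_eq_sum_range (fun j => c j * extend v j)]
  simp only [extend_val, dotProduct]

theorem sum_eqInd_mul_extend {nv : ℕ} (v : Fin nv → ℝ) (i : ℕ) :
    ∑ j ∈ Finset.range nv, eqInd j i * extend v j = extend v i := by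
  simp only [eqInd, ite_mul, one_mul, zero_mul, Finset.sum_ite_eq', Finset.mem_range]
  split_ifs with h
  · rfl
  · rw [extend, dif_neg h]

/-- The value of node `p` of the tree of `d`. -/
def node (D : ℕ) {nv : ℕ} (v : Fin nv → ℝ) (d p : ℕ) : ℝ := extend v ((p - 1) * D + d)

section

variable {n m N D : ℕ} {O : Oracles n m N}

open Classical in
-- This removes the arithmetic of rows and columns; afterwards only node weights matter.
theorem mem_polytope_iff (hD : 0 < D) (v : Fin (lpFormulation D O).nv → ℝ) :
    v ∈ (lpFormulation D O).polytope ↔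
      (∀ d < D, node D v d 1 = 1) ∧
      (∀ d < D, ∀ p, 0 < p → p < 2 ^ (N * O.k + n * O.k + m * O.k) →
        node D v d p = node D v d (2 * p) + node D v d (2 * p + 1)) ∧
      (∀ d < D, ∀ u < 2 ^ (N * O.k),
        node D v d (2 ^ (N * O.k) + u) = node D v 0 (2 ^ (N * O.k) + u)) ∧
      (∀ d < D, ∀ w < 2 ^ (N * O.k + n * O.k + m * O.k),
        0 ≤ node D v d (2 ^ (N * O.k + n * O.k + m * O.k) + w)) ∧
      (∀ u < 2 ^ (N * O.k), node D v 0 (2 ^ (N * O.k) + u) ≤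
        if wordPoint N O.k u ∈ O.Φ then 1 else 0) := by
  have hdot : ∀ (t : Table) (r : ℕ),
      (fun j : Fin (lpFormulation D O).nv => target D O t r j) ⬝ᵥ v =
      ∑ j ∈ Finset.range (lpFormulation D O).nv, target D O t r j * extend v j :=
    fun t r => dotProduct_eq_sum_range _ v
  have hroot : ∀ d < D, (fun j : Fin (lpFormulation D O).nv => target D O .eqA d j) ⬝ᵥ v =
      node D v d 1 := by
    intro d hd
    rw [hdot]
    simp only [target, hd, if_true, sum_eqInd_mul_extend]
    simp [node]
  have hroot' : ∀ d < D, target D O .eqb d 0 = 1 := fun d hd => by simp [target, hd]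
  have hb : ∀ r, D ≤ r → target D O .eqb r 0 = 0 := fun r hr => by simp [target, hr]
  have hnode : ∀ d < D, ∀ p, 0 < p → p < 2 ^ (N * O.k + n * O.k + m * O.k) →
      (fun j : Fin (lpFormulation D O).nv => target D O .eqA (p * D + d) j) ⬝ᵥ v =
      node D v d p - node D v d (2 * p) - node D v d (2 * p + 1) := by
    intro d hd p hp hT
    rw [hdot]
    simp only [target_node hd hp hT, sub_mul, Finset.sum_sub_distrib, sum_eqInd_mul_extend, node]
    have : D ≤ p * D := Nat.le_mul_of_pos_left _ hp
    rw [Nat.sub_mul, Nat.sub_mul, Nat.add_sub_cancel, mul_assoc]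
    refine congrArg₂ _ (congrArg₂ _ (congrArg _ ?_) (congrArg _ ?_)) (congrArg _ ?_) <;> omega
  have hlink : ∀ d < D, ∀ u < 2 ^ (N * O.k),
      (fun j : Fin (lpFormulation D O).nv =>
        target D O .eqA ((2 ^ (N * O.k + n * O.k + m * O.k) + u) * D + d) j) ⬝ᵥ v =
      node D v d (2 ^ (N * O.k) + u) - node D v 0 (2 ^ (N * O.k) + u) := by
    intro d hd u hu
    rw [hdot]
    simp only [target_link hu hd, sub_mul, Finset.sum_sub_distrib, sum_eqInd_mul_extend, node,
      add_zero]
  have hleaf : ∀ d < D, ∀ w < 2 ^ (N * O.k + n * O.k + m * O.k),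
      (fun j : Fin (lpFormulation D O).nv => target D O .leA (w * D + d) j) ⬝ᵥ v =
      -node D v d (2 ^ (N * O.k + n * O.k + m * O.k) + w) := by
    intro d hd w hw
    rw [hdot]
    simp only [target, if_pos (mul_add_lt_mul hd hw), neg_mul, Finset.sum_neg_distrib,
      sum_eqInd_mul_extend, node]
    have := Nat.mul_le_mul_right D (Nat.one_le_two_pow (n := N * O.k + n * O.k + m * O.k))
    rw [Nat.sub_mul, add_mul]
    congr 2; omega
  have hleaf' : ∀ r, r < 2 ^ (N * O.k + n * O.k + m * O.k) * D → target D O .leb r 0 = 0 := by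
    intro r hr
    rw [target, if_neg (by omega)]
  have hbound : ∀ u < 2 ^ (N * O.k), (fun j : Fin (lpFormulation D O).nv =>
      target D O .leA (2 ^ (N * O.k + n * O.k + m * O.k) * D + u) j) ⬝ᵥ v =
      node D v 0 (2 ^ (N * O.k) + u) := by
    intro u hu
    rw [hdot]
    simp only [target, add_lt_iff_neg_left, not_lt_zero, if_false, Nat.add_lt_add_iff_left, hu,
      if_true, Nat.add_sub_cancel_left, sum_eqInd_mul_extend, node, add_zero]
  have hbound' : ∀ u < 2 ^ (N * O.k),
      target D O .leb (2 ^ (N * O.k + n * O.k + m * O.k) * D + u) 0 =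
      if wordPoint N O.k u ∈ O.Φ then 1 else 0 := by
    intro u hu
    simp [target, hu]
  have hmem : v ∈ (lpFormulation D O).polytope ↔
      (∀ r < (lpFormulation D O).neq, (fun j : Fin (lpFormulation D O).nv =>
        target D O .eqA r j) ⬝ᵥ v = target D O .eqb r 0) ∧
      (∀ r < (lpFormulation D O).nle, (fun j : Fin (lpFormulation D O).nv =>
        target D O .leA r j) ⬝ᵥ v ≤ target D O .leb r 0) := by
    constructor
    · rintro ⟨h1, h2⟩
      exact ⟨fun r hr => congrFun h1 ⟨r, hr⟩, fun r hr => h2 ⟨r, hr⟩⟩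
    · rintro ⟨h1, h2⟩
      exact ⟨funext fun r => h1 r r.2, fun r => h2 r r.2⟩
  rw [hmem]
  have hY := Nat.one_le_two_pow (n := N * O.k)
  have hX := Nat.one_le_two_pow (n := N * O.k + n * O.k + m * O.k)
  constructor
  · rintro ⟨h1, h2⟩
    refine ⟨fun d hd => ?_, fun d hd p hp hT => ?_, fun d hd u hu => ?_, fun d hd w hw => ?_,
      fun u hu => ?_⟩
    · rw [← hroot d hd, h1 d ?_, hroot' d hd]
      exact hd.trans_le (Nat.le_mul_of_pos_left _ (by omega))
    · have := h1 (p * D + d) (mul_add_lt_mul hd (by omega))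
      rw [hnode d hd p hp hT, hb _ (by nlinarith)] at this
      linarith
    · have := h1 ((2 ^ (N * O.k + n * O.k + m * O.k) + u) * D + d) (mul_add_lt_mul hd (by omega))
      rw [hlink d hd u hu, hb _ (by nlinarith)] at this
      linarith
    · have := h2 (w * D + d) ((mul_add_lt_mul hd hw).trans_le (Nat.le_add_right _ _))
      rw [hleaf d hd w hw, hleaf' _ (mul_add_lt_mul hd hw)] at this
      linarith
    · have := h2 (2 ^ (N * O.k + n * O.k + m * O.k) * D + u) (Nat.add_lt_add_left hu _)
      rwa [hbound u hu, hbound' u hu] at this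
  · rintro ⟨h1, h2, h3, h4, h5⟩
    refine ⟨fun r hr => ?_, fun r hr => ?_⟩
    · have hr' : r / D * D + r % D = r := by rw [mul_comm, Nat.div_add_mod]
      have hm : r % D < D := Nat.mod_lt _ hD
      generalize r / D = p at hr'
      generalize r % D = d at hr' hm
      subst hr'
      rcases Nat.eq_zero_or_pos p with rfl | hp
      · rw [zero_mul, zero_add, hroot d hm, hroot' d hm, h1 d hm]
      rw [hb _ (by nlinarith)]
      rcases lt_or_ge p (2 ^ (N * O.k + n * O.k + m * O.k)) with hT | hT
      · rw [hnode d hm p hp hT, h2 d hm p hp hT]; ring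
      · obtain ⟨u, rfl⟩ := Nat.exists_eq_add_of_le hT
        have hu : u < 2 ^ (N * O.k) := by
          by_contra hc
          simp only [lpFormulation] at hr
          nlinarith
        rw [hlink d hm u hu, h3 d hm u hu, sub_self]
    · rcases lt_or_ge r (2 ^ (N * O.k + n * O.k + m * O.k) * D) with hT | hT
      · have hr' : r / D * D + r % D = r := by rw [mul_comm, Nat.div_add_mod]
        have hm : r % D < D := Nat.mod_lt _ hD
        have hw : r / D < 2 ^ (N * O.k + n * O.k + m * O.k) :=
          Nat.div_lt_of_lt_mul (by rwa [mul_comm])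
        rw [hleaf' r hT, ← hr', hleaf _ hm _ hw]
        linarith [h4 _ hm _ hw]
      · obtain ⟨u, rfl⟩ := Nat.exists_eq_add_of_le hT
        have hu : u < 2 ^ (N * O.k) := Nat.add_lt_add_iff_left.1 hr
        rw [hbound u hu, hbound' u hu]
        exact h5 u hu

end

/-! ### Feasible vectors as measures with a common marginal -/

section

variable {n m N D : ℕ} {O : Oracles n m N}

/-- The program constrains the signs of leaves only; all other nodes are sums of leaves. -/
theorem node_nonneg {T : ℕ} {F : ℕ → ℝ}
    (hF : ∀ p, 0 < p → p < 2 ^ T → F p = F (2 * p) + F (2 * p + 1))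
    (h0 : ∀ w < 2 ^ T, 0 ≤ F (2 ^ T + w)) {p : ℕ} (hp : 0 < p) (h : p < 2 ^ (T + 1)) :
    0 ≤ F p := by
  have h1 := Nat.pow_log_le_self 2 hp.ne'
  have h2 := Nat.lt_pow_succ_log_self (b := 2) (by norm_num) p
  have h3 : Nat.log 2 p < T + 1 := Nat.log_lt_of_lt_pow hp.ne' h
  obtain ⟨e, he⟩ := Nat.exists_eq_add_of_le (Nat.lt_succ_iff.1 h3)
  rw [node_eq_sum F hF e _ p hp he.symm h2]
  refine Finset.sum_nonneg fun i hi => ?_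
  have hi := Finset.mem_range.1 hi
  obtain ⟨q, hq⟩ := Nat.exists_eq_add_of_le h1
  have h4 : 2 ^ T = 2 ^ Nat.log 2 p * 2 ^ e := by rw [he, pow_add]
  have h5 : p * 2 ^ e + i = 2 ^ T + (q * 2 ^ e + i) := by
    rw [h4]
    calc p * 2 ^ e + i = (2 ^ Nat.log 2 p + q) * 2 ^ e + i := by rw [← hq]
      _ = _ := by ring
  rw [h5]
  refine h0 _ ?_
  rw [h4]
  refine mul_add_lt_mul hi ?_
  rw [pow_succ] at h2; omega

/-- A node is at most its parent because its sibling is nonnegative. -/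
theorem node_le_one {T : ℕ} {F : ℕ → ℝ}
    (hF : ∀ p, 0 < p → p < 2 ^ T → F p = F (2 * p) + F (2 * p + 1))
    (h0 : ∀ w < 2 ^ T, 0 ≤ F (2 ^ T + w)) (hroot : F 1 = 1) (p : ℕ) (hp : 0 < p)
    (h : p < 2 ^ (T + 1)) : F p ≤ 1 := by
  induction p using Nat.strong_induction_on with
  | _ p ih =>
    rcases Nat.lt_or_ge 1 p with h1 | h1
    · have h2 : 2 ^ (T + 1) = 2 * 2 ^ T := pow_succ' 2 T
      have h3 := ih (p / 2) (by omega) (by omega) (by omega)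
      rw [hF (p / 2) (by omega) (by omega)] at h3
      have h4 := node_nonneg hF h0 (p := 2 * (p / 2)) (by omega) (by omega)
      have h5 := node_nonneg hF h0 (p := 2 * (p / 2) + 1) (by omega) (by omega)
      rcases Nat.even_or_odd' p with ⟨c, rfl | rfl⟩
      · rw [Nat.mul_div_cancel_left _ (by norm_num)] at *; linarith
      · have : (2 * c + 1) / 2 = c := by omega
        rw [this] at h3 h4 h5; linarith
    · rw [show p = 1 by omega, hroot]

/-- The leaf weights of `d`. -/
def leaf (D : ℕ) (O : Oracles n m N) (v : Fin (lpFormulation D O).nv → ℝ) (d w : ℕ) : ℝ :=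
  node D v d (2 ^ (N * O.k + n * O.k + m * O.k) + w)

/-- What membership in the polytope says about the leaf weights. -/
structure IsCoupling (D : ℕ) (O : Oracles n m N) (v : Fin (lpFormulation D O).nv → ℝ) : Prop where
  nonneg : ∀ d < D, ∀ w < 2 ^ (N * O.k + n * O.k + m * O.k), 0 ≤ leaf D O v d w
  sum_eq_one : ∀ d < D,
    ∑ w ∈ Finset.range (2 ^ (N * O.k + n * O.k + m * O.k)), leaf D O v d w = 1
  marginal : ∀ d < D, ∀ u < 2 ^ (N * O.k),
    ∑ z ∈ Finset.range (2 ^ (n * O.k + m * O.k)), leaf D O v d (u * 2 ^ (n * O.k + m * O.k) + z) =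
      node D v 0 (2 ^ (N * O.k) + u)
  support : ∀ u < 2 ^ (N * O.k), wordPoint N O.k u ∉ O.Φ → node D v 0 (2 ^ (N * O.k) + u) = 0
  marginal_nonneg : ∀ u < 2 ^ (N * O.k), 0 ≤ node D v 0 (2 ^ (N * O.k) + u)
  marginal_sum : ∑ u ∈ Finset.range (2 ^ (N * O.k)), node D v 0 (2 ^ (N * O.k) + u) = 1

theorem two_pow_depth : 2 ^ (N * O.k + n * O.k + m * O.k) =
    2 ^ (N * O.k) * 2 ^ (n * O.k + m * O.k) := by
  rw [← pow_add, add_assoc]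

theorem isCoupling_of_mem (hD : 0 < D) {v : Fin (lpFormulation D O).nv → ℝ}
    (hv : v ∈ (lpFormulation D O).polytope) : IsCoupling D O v := by
  obtain ⟨h1, h2, h3, h4, h5⟩ := (mem_polytope_iff hD v).1 hv
  have hmarg : ∀ d < D, ∀ u < 2 ^ (N * O.k),
    ∑ z ∈ Finset.range (2 ^ (n * O.k + m * O.k)), leaf D O v d (u * 2 ^ (n * O.k + m * O.k) + z) =
      node D v 0 (2 ^ (N * O.k) + u) := by
    intro d hd u hu
    rw [← h3 d hd u hu, node_eq_sum (node D v d) (h2 d hd) (n * O.k + m * O.k) (N * O.k) _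
      (by positivity) (by ring) (by rw [pow_succ]; omega)]
    refine Finset.sum_congr rfl fun z _ => ?_
    rw [leaf, two_pow_depth, add_mul, add_assoc]
  have hnn : ∀ u < 2 ^ (N * O.k), 0 ≤ node D v 0 (2 ^ (N * O.k) + u) := fun u hu =>
    node_nonneg (h2 0 hD) (h4 0 hD) (by positivity) (by
      have : 2 ^ (N * O.k + 1) ≤ 2 ^ (N * O.k + n * O.k + m * O.k + 1) :=
        Nat.pow_le_pow_right (by norm_num) (by omega)
      rw [pow_succ] at this
      omega)
  have hone : ∀ d < D,
      ∑ w ∈ Finset.range (2 ^ (N * O.k + n * O.k + m * O.k)), leaf D O v d w = 1 := by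
    intro d hd
    rw [← h1 d hd, node_eq_sum (node D v d) (h2 d hd) (N * O.k + n * O.k + m * O.k) 0 1
      (by norm_num) (by ring) (by norm_num)]
    simp only [one_mul, leaf]
  refine ⟨h4, hone, hmarg, fun u hu h => le_antisymm ?_ (hnn u hu), hnn, ?_⟩
  · simpa [h] using h5 u hu
  · rw [← hone 0 hD, two_pow_depth, sum_range_mul_eq]
    exact Finset.sum_congr rfl fun u hu => (hmarg 0 hD u (Finset.mem_range.1 hu)).symm

theorem extend_nonneg_of_mem (hD : 0 < D) {v : Fin (lpFormulation D O).nv → ℝ}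
    (hv : v ∈ (lpFormulation D O).polytope) (j : Fin (lpFormulation D O).nv) :
    0 ≤ v j ∧ v j ≤ 1 := by
  obtain ⟨h1, h2, h3, h4, h5⟩ := (mem_polytope_iff hD v).1 hv
  have hm : (j : ℕ) % D < D := Nat.mod_lt _ hD
  have hj : (j : ℕ) / D + 1 < 2 ^ (N * O.k + n * O.k + m * O.k + 1) := by
    have : (j : ℕ) / D < 2 ^ (N * O.k + n * O.k + m * O.k + 1) - 1 :=
      Nat.div_lt_of_lt_mul (by rw [mul_comm]; exact j.2)
    have := Nat.one_le_two_pow (n := N * O.k + n * O.k + m * O.k + 1)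
    omega
  have e : v j = node D v ((j : ℕ) % D) ((j : ℕ) / D + 1) := by
    rw [node, Nat.add_sub_cancel, mul_comm, Nat.div_add_mod, extend_val]
  rw [e]
  exact ⟨node_nonneg (h2 _ hm) (h4 _ hm) (by positivity) hj,
    node_le_one (h2 _ hm) (h4 _ hm) (h1 _ hm) _ (by positivity) hj⟩

theorem isBounded_polytope (hD : 0 < D) : Bornology.IsBounded (lpFormulation D O).polytope :=
  (Metric.isBounded_Icc (0 : Fin (lpFormulation D O).nv → ℝ) 1).subset fun _ hv =>
    ⟨fun j => (extend_nonneg_of_mem hD hv j).1, fun j => (extend_nonneg_of_mem hD hv j).2⟩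

/-! ### The linear forms on the polytope -/

theorem sum_columns {d : ℕ} (hd : d < D) (v : Fin (lpFormulation D O).nv → ℝ) (c : ℕ → ℝ)
    {g : ℕ → ℝ} (hg : ∀ j, g j = if j % D = d then c (j / D + 1) else 0) :
    ∑ j ∈ Finset.range (lpFormulation D O).nv, g j * extend v j =
    ∑ p ∈ Finset.range (2 ^ (N * O.k + n * O.k + m * O.k + 1) - 1), c (p + 1) * node D v d (p + 1)
      := by
  simp only [hg]
  refine (sum_range_mul_eq (2 ^ (N * O.k + n * O.k + m * O.k + 1) - 1) D _).trans ?_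
  refine Finset.sum_congr rfl fun p _ => ?_
  rw [Finset.sum_eq_single d]
  · rw [mul_add_mod_of_lt hd, mul_add_div_of_lt hd, if_pos rfl, node, Nat.add_sub_cancel]
  · intro i hi hne
    rw [mul_add_mod_of_lt (Finset.mem_range.1 hi), if_neg hne, zero_mul]
  · intro h; exact absurd (Finset.mem_range.2 hd) h

theorem sum_digitCoeff (hD : 0 < D) {v : Fin (lpFormulation D O).nv → ℝ}
    (hv : v ∈ (lpFormulation D O).polytope) {d level e : ℕ} (hd : d < D) (hl : 0 < level)
    (hle : level + e = N * O.k + n * O.k + m * O.k) :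
    ∑ j ∈ Finset.range (lpFormulation D O).nv, digitCoeff D level d j * extend v j =
      ∑ w ∈ Finset.range (2 ^ (N * O.k + n * O.k + m * O.k)),
        bit (w.testBit e) * leaf D O v d w := by
  have h2 := ((mem_polytope_iff hD v).1 hv).2.1 d hd
  have e1 : ∀ j, digitCoeff D level d j = if j % D = d then (fun p => if p % 2 = 1 ∧ 2 ^ level ≤ p ∧
      p < 2 ^ (level + 1) then (1 : ℝ) else 0) (j / D + 1) else 0 := by
    intro j
    rw [digitCoeff, ite_and]
  rw [sum_columns hd v (fun p => if p % 2 = 1 ∧ 2 ^ level ≤ p ∧ p < 2 ^ (level + 1) then (1 : ℝ)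
    else 0) e1]
  simp only [ite_mul, one_mul, zero_mul]
  exact sum_odd_nodes (node D v d) h2 e level hl hle

theorem zphi_dotProduct (hD : 0 < D) {v : Fin (lpFormulation D O).nv → ℝ}
    (hv : v ∈ (lpFormulation D O).polytope) (i : Fin N) (h : Fin O.k) :
    (lpFormulation D O).zφ i h ⬝ᵥ v = ∑ w ∈ Finset.range (2 ^ (N * O.k + n * O.k + m * O.k)),
      bit ((w / 2 ^ (n * O.k + m * O.k)).testBit (i * O.k + h)) * leaf D O v 0 w := by
  have hs : (i : ℕ) * O.k + h < N * O.k := mul_add_lt_mul h.2 i.2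
  have e1 : (lpFormulation D O).zφ i h ⬝ᵥ v = _ :=
    dotProduct_eq_sum_range (fun j => target D O .zphi ((i : ℕ) * O.k + h) j) v
  rw [e1]
  simp only [target, hs, if_true]
  rw [sum_digitCoeff hD hv hD (e := n * O.k + m * O.k + (i * O.k + h)) (by omega) (by omega)]
  simp only [Nat.testBit_div_two_pow]
  refine Finset.sum_congr rfl fun w _ => ?_
  rw [add_comm (n * O.k + m * O.k)]

theorem zx_dotProduct (hD : 0 < D) {v : Fin (lpFormulation D O).nv → ℝ}
    (hv : v ∈ (lpFormulation D O).polytope) (d : Fin D) (i : Fin n) (h : Fin O.k) :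
    (lpFormulation D O).zx d i h ⬝ᵥ v = ∑ w ∈ Finset.range (2 ^ (N * O.k + n * O.k + m * O.k)),
      bit ((w / 2 ^ (m * O.k)).testBit (i * O.k + h)) * leaf D O v d w := by
  have hs : (i : ℕ) * O.k + h < n * O.k := mul_add_lt_mul h.2 i.2
  have e1 : (lpFormulation D O).zx d i h ⬝ᵥ v = _ :=
    dotProduct_eq_sum_range (fun j => target D O .zx (((d : ℕ) * n + (i : ℕ)) * O.k + h) j) v
  rw [e1]
  have e2 : ((d : ℕ) * n + (i : ℕ)) * O.k + h = d * (n * O.k) + (i * O.k + h) := by ring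
  simp only [target, e2, mul_add_lt_mul hs d.2, mul_add_div_of_lt hs, mul_add_mod_of_lt hs,
    if_true]
  rw [sum_digitCoeff hD hv d.2 (e := m * O.k + (i * O.k + h)) (by omega) (by omega)]
  simp only [Nat.testBit_div_two_pow]
  refine Finset.sum_congr rfl fun w _ => ?_
  rw [add_comm (m * O.k)]

theorem zy_dotProduct (hD : 0 < D) {v : Fin (lpFormulation D O).nv → ℝ}
    (hv : v ∈ (lpFormulation D O).polytope) (d : Fin D) (i : Fin m) (h : Fin O.k) :
    (lpFormulation D O).zy d i h ⬝ᵥ v = ∑ w ∈ Finset.range (2 ^ (N * O.k + n * O.k + m * O.k)),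
      bit (w.testBit (i * O.k + h)) * leaf D O v d w := by
  have hs : (i : ℕ) * O.k + h < m * O.k := mul_add_lt_mul h.2 i.2
  have e1 : (lpFormulation D O).zy d i h ⬝ᵥ v = _ :=
    dotProduct_eq_sum_range (fun j => target D O .zy (((d : ℕ) * m + (i : ℕ)) * O.k + h) j) v
  rw [e1]
  have e2 : ((d : ℕ) * m + (i : ℕ)) * O.k + h = d * (m * O.k) + (i * O.k + h) := by ring
  simp only [target, e2, mul_add_lt_mul hs d.2, mul_add_div_of_lt hs, mul_add_mod_of_lt hs,
    if_true]
  rw [sum_digitCoeff hD hv d.2 (e := i * O.k + h) (by omega) (by omega)]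

theorem loss_dotProduct (v : Fin (lpFormulation D O).nv → ℝ) (d : Fin D) :
    (lpFormulation D O).L d ⬝ᵥ v = ∑ w ∈ Finset.range (2 ^ (N * O.k + n * O.k + m * O.k)),
      leafLoss O w * leaf D O v d w := by
  have e1 : (lpFormulation D O).L d ⬝ᵥ v = _ :=
    dotProduct_eq_sum_range (fun j => target D O .loss d j) v
  have e2 : ∀ j, target D O .loss d j = if j % D = d then (fun p =>
      if 2 ^ (N * O.k + n * O.k + m * O.k) ≤ p ∧ p < 2 ^ (N * O.k + n * O.k + m * O.k + 1) then
      leafLoss O (p - 2 ^ (N * O.k + n * O.k + m * O.k)) else 0) (j / D + 1) else 0 := by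
    intro j
    rw [target, ite_and]
  rw [e1]
  rw [sum_columns d.2 v (fun p => if 2 ^ (N * O.k + n * O.k + m * O.k) ≤ p ∧
    p < 2 ^ (N * O.k + n * O.k + m * O.k + 1) then
      leafLoss O (p - 2 ^ (N * O.k + n * O.k + m * O.k)) else 0) e2]
  have h1 := Nat.one_le_two_pow (n := N * O.k + n * O.k + m * O.k)
  simp only [leaf]
  rw [pow_succ]
  generalize 2 ^ (N * O.k + n * O.k + m * O.k) = X at *
  rw [show X * 2 - 1 = (X - 1) + X by omega, Finset.sum_range_add, Finset.sum_eq_zero, zero_add]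
  · refine Finset.sum_congr rfl fun w hw => ?_
    have hw := Finset.mem_range.1 hw
    rw [if_pos (by omega), show X - 1 + w + 1 = X + w by omega, Nat.add_sub_cancel_left]
  · intro p hp
    have hp := Finset.mem_range.1 hp
    rw [if_neg (by omega), zero_mul]

end

/-! ### The projection of the polytope -/

section

variable {n m N D : ℕ} {O : Oracles n m N}

/-- The grid points and the loss coded by a leaf. -/
def leafPoint (O : Oracles n m N) (w : ℕ) : (Fin n → ℝ) × (Fin m → ℝ) × ℝ :=
  (wordPoint n O.k (w / 2 ^ (m * O.k)), wordPoint m O.k w, leafLoss O w)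

theorem extend_add {nv : ℕ} (v w : Fin nv → ℝ) (j : ℕ) :
    extend (v + w) j = extend v j + extend w j := by
  unfold extend; split_ifs <;> simp

theorem extend_smul {nv : ℕ} (c : ℝ) (v : Fin nv → ℝ) (j : ℕ) :
    extend (c • v) j = c * extend v j := by
  unfold extend; split_ifs <;> simp

/-- The combination of the coded points with the weights of the tree. -/
def treeMap (D : ℕ) (O : Oracles n m N) : (Fin (lpFormulation D O).nv → ℝ) →ₗ[ℝ]
    (Fin N → ℝ) × (Fin D → (Fin n → ℝ) × (Fin m → ℝ) × ℝ) where
  toFun v := (∑ u ∈ Finset.range (2 ^ (N * O.k)),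
      node D v 0 (2 ^ (N * O.k) + u) • wordPoint N O.k u,
    fun d => ∑ u ∈ Finset.range (2 ^ (N * O.k)), ∑ z ∈ Finset.range (2 ^ (n * O.k + m * O.k)),
      leaf D O v d (u * 2 ^ (n * O.k + m * O.k) + z) •
        leafPoint O (u * 2 ^ (n * O.k + m * O.k) + z))
  map_add' v w := by
    simp only [leaf, node, extend_add, add_smul, Finset.sum_add_distrib]; rfl
  map_smul' c v := by
    simp only [leaf, node, extend_smul, mul_smul, ← Finset.smul_sum]; rfl

/-- The rearrangement of coordinates. -/
def arrange (n m N D : ℕ) : ((Fin N → ℝ) × (Fin D → (Fin n → ℝ) × (Fin m → ℝ) × ℝ)) →ₗ[ℝ]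
    Point n m N D where
  toFun q := (fun d => (q.2 d).1, fun d => (q.2 d).2.1, q.1, fun d => (q.2 d).2.2)
  map_add' _ _ := rfl
  map_smul' _ _ := rfl

/-- Each tree has total weight one, so on the polytope the affine map `point` agrees with a linear
map, whose images of convex hulls are hulls of images. For φ the weights of tree 0 are grouped by
parameter word. -/
theorem point_eq_arrange (hD : 0 < D) {v : Fin (lpFormulation D O).nv → ℝ}
    (hv : v ∈ (lpFormulation D O).polytope) :
    (lpFormulation D O).point v = arrange n m N D (treeMap D O v) := by
  have hc := isCoupling_of_mem hD hv
  have hsplit : ∀ F : ℕ → ℝ, ∑ w ∈ Finset.range (2 ^ (N * O.k + n * O.k + m * O.k)), F w =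
      ∑ u ∈ Finset.range (2 ^ (N * O.k)), ∑ z ∈ Finset.range (2 ^ (n * O.k + m * O.k)),
        F (u * 2 ^ (n * O.k + m * O.k) + z) := by
    intro F
    rw [two_pow_depth, sum_range_mul_eq]
  refine Prod.ext ?_ (Prod.ext ?_ (Prod.ext ?_ ?_))
  · funext d i
    simp only [Formulation.point, arrange, treeMap, LinearMap.coe_mk, AddHom.coe_mk,
      zx_dotProduct hD hv]
    rw [decode_sum _ (leaf D O v d) _ (hc.sum_eq_one d d.2), hsplit]
    simp only [Prod.fst_sum, Finset.sum_apply, Prod.smul_fst, Pi.smul_apply, smul_eq_mul, leafPoint]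
    rfl
  · funext d i
    simp only [Formulation.point, arrange, treeMap, LinearMap.coe_mk, AddHom.coe_mk,
      zy_dotProduct hD hv]
    rw [decode_sum _ (leaf D O v d) _ (hc.sum_eq_one d d.2), hsplit]
    simp only [Prod.fst_sum, Prod.snd_sum, Finset.sum_apply, Prod.smul_fst, Prod.smul_snd,
      Pi.smul_apply, smul_eq_mul, leafPoint]
    rfl
  · funext i
    simp only [Formulation.point, Formulation.phi, arrange, treeMap, LinearMap.coe_mk,
      AddHom.coe_mk, zphi_dotProduct hD hv]
    rw [decode_sum _ (leaf D O v 0) _ (hc.sum_eq_one 0 hD), hsplit]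
    simp only [Finset.sum_apply, Pi.smul_apply, smul_eq_mul]
    refine Finset.sum_congr rfl fun u hu => ?_
    rw [← hc.marginal 0 hD u (Finset.mem_range.1 hu), Finset.sum_mul]
    refine Finset.sum_congr rfl fun z hz => ?_
    rw [mul_add_div_of_lt (Finset.mem_range.1 hz)]
    rfl
  · funext d
    simp only [Formulation.point, Formulation.loss, arrange, treeMap, LinearMap.coe_mk,
      AddHom.coe_mk, loss_dotProduct]
    rw [hsplit]
    simp only [Prod.snd_sum, Prod.smul_snd, smul_eq_mul, leafPoint, mul_comm (leafLoss O _)]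

/-- The part of the polytope where the data word of `d` lies in `B d`. -/
def wordFace (D : ℕ) (O : Oracles n m N) (B : Fin D → Set ℕ) :
    Set (Fin (lpFormulation D O).nv → ℝ) :=
  {v ∈ (lpFormulation D O).polytope | ∀ d : Fin D, ∀ u < 2 ^ (N * O.k),
    ∀ z < 2 ^ (n * O.k + m * O.k), z ∉ B d →
      leaf D O v d (u * 2 ^ (n * O.k + m * O.k) + z) = 0}

/-- The points coded by a parameter word and data words in `B d`. -/
def wordPoints (D : ℕ) (O : Oracles n m N) (B : Fin D → Set ℕ) :
    Set ((Fin N → ℝ) × (Fin D → (Fin n → ℝ) × (Fin m → ℝ) × ℝ)) :=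
  {q | ∃ u ∈ Finset.range (2 ^ (N * O.k)), u ∈ {u | wordPoint N O.k u ∈ O.Φ} ∧ ∃ b : Fin D → ℕ,
    (∀ d, b d ∈ Finset.range (2 ^ (n * O.k + m * O.k)) ∧ b d ∈ B d) ∧
    q = (wordPoint N O.k u, fun d => leafPoint O (u * 2 ^ (n * O.k + m * O.k) + b d))}

theorem convex_wordFace (B : Fin D → Set ℕ) : Convex ℝ (wordFace D O B) := by
  intro v hv w hw a b ha hb hab
  refine ⟨⟨?_, ?_⟩, fun d u hu z hz h => ?_⟩
  · rw [Matrix.mulVec_add, Matrix.mulVec_smul, Matrix.mulVec_smul, hv.1.1, hw.1.1, ← add_smul, hab,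
      one_smul]
  · rw [Matrix.mulVec_add, Matrix.mulVec_smul, Matrix.mulVec_smul]
    calc _ ≤ a • (lpFormulation D O).leb + b • (lpFormulation D O).leb :=
          add_le_add (smul_le_smul_of_nonneg_left hv.1.2 ha)
            (smul_le_smul_of_nonneg_left hw.1.2 hb)
      _ = _ := by rw [← add_smul, hab, one_smul]
  · have h1 := hv.2 d u hu z hz h
    have h2 := hw.2 d u hu z hz h
    simp only [leaf, node, extend_add, extend_smul] at *
    rw [h1, h2]; ring

/-- The vector with unit weight on the leaf `w d` of every tree. -/
def pathVector (D : ℕ) (O : Oracles n m N) (w : ℕ → ℕ) (j : Fin (lpFormulation D O).nv) : ℝ :=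
  if (2 ^ (N * O.k + n * O.k + m * O.k) + w (j % D)) /
    2 ^ (N * O.k + n * O.k + m * O.k - Nat.log 2 (j / D + 1)) = j / D + 1 then 1 else 0

/-- A shift of the leaf by T - log p bits gives its ancestor on the level of p, so the ones mark the
path from the root to the leaf. -/
theorem node_pathVector {w : ℕ → ℕ} {d p : ℕ} (hd : d < D) (hp : 0 < p)
    (h : p < 2 ^ (N * O.k + n * O.k + m * O.k + 1)) :
    node D (pathVector D O w) d p = if (2 ^ (N * O.k + n * O.k + m * O.k) + w d) /
      2 ^ (N * O.k + n * O.k + m * O.k - Nat.log 2 p) = p then 1 else 0 := by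
  have h1 : (p - 1) * D + d < (lpFormulation D O).nv := mul_add_lt_mul hd (by omega)
  rw [node, extend, dif_pos h1, pathVector]
  simp only [mul_add_mod_of_lt hd, mul_add_div_of_lt hd, Nat.sub_add_cancel hp]

theorem leaf_pathVector {w : ℕ → ℕ} {d i : ℕ} (hd : d < D)
    (hi : i < 2 ^ (N * O.k + n * O.k + m * O.k)) :
    leaf D O (pathVector D O w) d i = if w d = i then 1 else 0 := by
  have h1 : 2 ^ (N * O.k + n * O.k + m * O.k) + i < 2 ^ (N * O.k + n * O.k + m * O.k + 1) := by
    rw [pow_succ]; omega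
  have h2 : Nat.log 2 (2 ^ (N * O.k + n * O.k + m * O.k) + i) = N * O.k + n * O.k + m * O.k :=
    (Nat.log_eq_iff (Or.inr ⟨by norm_num, by positivity⟩)).2 ⟨by omega, h1⟩
  rw [leaf, node_pathVector hd (by positivity) h1, h2, Nat.sub_self, pow_zero, Nat.div_one]
  simp only [Nat.add_left_cancel_iff]

theorem node_param_pathVector {w : ℕ → ℕ} {d u u₀ : ℕ} (hd : d < D) (hu : u < 2 ^ (N * O.k))
    {z : ℕ} (hz : z < 2 ^ (n * O.k + m * O.k)) (hw : w d = u₀ * 2 ^ (n * O.k + m * O.k) + z) :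
    node D (pathVector D O w) d (2 ^ (N * O.k) + u) = if u₀ = u then 1 else 0 := by
  have h1 : 2 ^ (N * O.k) + u < 2 ^ (N * O.k + 1) := by rw [pow_succ]; omega
  have h2 : Nat.log 2 (2 ^ (N * O.k) + u) = N * O.k :=
    (Nat.log_eq_iff (Or.inr ⟨by norm_num, by positivity⟩)).2 ⟨by omega, h1⟩
  rw [node_pathVector hd (by positivity)
    (h1.trans_le (Nat.pow_le_pow_right (by norm_num) (by omega))), h2, hw, two_pow_depth,
    show N * O.k + n * O.k + m * O.k - N * O.k = n * O.k + m * O.k by omega, ← add_assoc,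
    ← add_mul, mul_add_div_of_lt hz]
  simp only [Nat.add_left_cancel_iff]

theorem pathVector_mem (hD : 0 < D) {u : ℕ} (hu : u < 2 ^ (N * O.k))
    (hΦ : wordPoint N O.k u ∈ O.Φ) {b : ℕ → ℕ} (hb : ∀ d < D, b d < 2 ^ (n * O.k + m * O.k)) :
    pathVector D O (fun d => u * 2 ^ (n * O.k + m * O.k) + b d) ∈ (lpFormulation D O).polytope := by
  classical
  have hw : ∀ d < D, u * 2 ^ (n * O.k + m * O.k) + b d < 2 ^ (N * O.k + n * O.k + m * O.k) := by
    intro d hd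
    rw [two_pow_depth]
    exact mul_add_lt_mul (hb d hd) hu
  refine (mem_polytope_iff hD _).2 ⟨fun d hd => ?_, fun d hd p hp hT => ?_, fun d hd u' hu' => ?_,
    fun d hd i hi => ?_, fun u' hu' => ?_⟩
  · rw [node_pathVector hd one_pos (Nat.one_lt_two_pow (by omega)), Nat.log_one_right, Nat.sub_zero,
      Nat.add_div_left _ (by positivity), Nat.div_eq_of_lt (hw d hd), zero_add, if_pos rfl]
  · have h2 : 2 ^ (N * O.k + n * O.k + m * O.k + 1) = 2 * 2 ^ (N * O.k + n * O.k + m * O.k) :=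
      pow_succ' _ _
    have hlog : Nat.log 2 p < N * O.k + n * O.k + m * O.k := Nat.log_lt_of_lt_pow hp.ne' hT
    have e1 : Nat.log 2 (2 * p) = Nat.log 2 p + 1 := by
      rw [mul_comm, Nat.log_mul_base (by norm_num) hp.ne']
    have e2 : Nat.log 2 (2 * p + 1) = Nat.log 2 p + 1 := by
      rw [Nat.log_of_one_lt_of_le (by norm_num) (by omega)]
      congr 2; omega
    rw [node_pathVector hd hp (by omega), node_pathVector hd (by omega) (by omega),
      node_pathVector hd (by omega) (by omega), e1, e2,
      show N * O.k + n * O.k + m * O.k - Nat.log 2 p =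
        (N * O.k + n * O.k + m * O.k - (Nat.log 2 p + 1)) + 1 by omega, pow_succ,
      ← Nat.div_div_eq_div_mul]
    -- `q` is the ancestor one level below p; q / 2 = p holds exactly if q is one of the two
    -- children of p.
    generalize (2 ^ (N * O.k + n * O.k + m * O.k) + (u * 2 ^ (n * O.k + m * O.k) + b d)) /
      2 ^ (N * O.k + n * O.k + m * O.k - (Nat.log 2 p + 1)) = q
    split_ifs <;> first | omega | simp
  · rw [node_param_pathVector hd hu' (hb d hd) rfl, node_param_pathVector hD hu' (hb 0 hD) rfl]
  · have := leaf_pathVector (O := O) (w := fun d => u * 2 ^ (n * O.k + m * O.k) + b d) hd hi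
    rw [leaf] at this
    rw [this]
    split_ifs <;> norm_num
  · rw [node_param_pathVector hD hu' (hb 0 hD) rfl]
    by_cases h : u = u'
    · subst h; simp [hΦ]
    · rw [if_neg h]; split_ifs <;> norm_num

theorem mul_add_inj {M u u' z z' : ℕ} (hz : z < M) (hz' : z' < M) :
    u * M + z = u' * M + z' ↔ u = u' ∧ z = z' := by
  constructor
  · intro h
    have h1 := congrArg (· / M) h
    have h2 := congrArg (· % M) h
    simp only [mul_add_div_of_lt hz, mul_add_div_of_lt hz', mul_add_mod_of_lt hz,
      mul_add_mod_of_lt hz'] at h1 h2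
    exact ⟨h1, h2⟩
  · rintro ⟨rfl, rfl⟩; rfl

/-- The general `B` covers both the whole polytope and the data faces. One inclusion is the gluing
of the D measures along the parameter marginal; for the other, convexity reduces to single points,
which are images of path vectors. -/
theorem treeMap_image_wordFace (hD : 0 < D) (B : Fin D → Set ℕ) :
    treeMap D O '' wordFace D O B = convexHull ℝ (wordPoints D O B) := by
  apply Set.Subset.antisymm
  · rintro _ ⟨v, ⟨hv, hB⟩, rfl⟩
    have hc := isCoupling_of_mem hD hv
    have hlt : ∀ u ∈ Finset.range (2 ^ (N * O.k)), ∀ z ∈ Finset.range (2 ^ (n * O.k + m * O.k)),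
        u * 2 ^ (n * O.k + m * O.k) + z < 2 ^ (N * O.k + n * O.k + m * O.k) := by
      intro u hu z hz
      rw [two_pow_depth]
      exact mul_add_lt_mul (Finset.mem_range.1 hz) (Finset.mem_range.1 hu)
    have h := mem_convexHull_of_marginals (Finset.range (2 ^ (N * O.k)))
      (Finset.range (2 ^ (n * O.k + m * O.k))) {u | wordPoint N O.k u ∈ O.Φ} B
      (fun u => wordPoint N O.k u) (fun u z => leafPoint O (u * 2 ^ (n * O.k + m * O.k) + z))
      (fun u => node D v 0 (2 ^ (N * O.k) + u))
      (fun d u z => leaf D O v d (u * 2 ^ (n * O.k + m * O.k) + z))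
      (fun u hu => hc.marginal_nonneg u (Finset.mem_range.1 hu)) hc.marginal_sum
      (fun u hu h => hc.support u (Finset.mem_range.1 hu) h)
      (fun d u hu z hz => hc.nonneg d d.2 _ (hlt u hu z hz))
      (fun d u hu z hz h => hB d u (Finset.mem_range.1 hu) z (Finset.mem_range.1 hz) h)
      (fun d u hu => hc.marginal d d.2 u (Finset.mem_range.1 hu))
    exact h
  · refine convexHull_min ?_ ((convex_wordFace B).linear_image _)
    rintro _ ⟨u, hu, hΦ, b, hb, rfl⟩
    have hu := Finset.mem_range.1 hu
    have hb1 : ∀ d : Fin D, b d < 2 ^ (n * O.k + m * O.k) := fun d => Finset.mem_range.1 (hb d).1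
    -- `pathVector` expects words for all naturals; the value 0 from D on is never read.
    let b' : ℕ → ℕ := fun d => if h : d < D then b ⟨d, h⟩ else 0
    have hb' : ∀ d : Fin D, b' d = b d := fun d => by simp [b']
    have hb'' : ∀ d < D, b' d < 2 ^ (n * O.k + m * O.k) := fun d hd => hb' ⟨d, hd⟩ ▸ hb1 ⟨d, hd⟩
    have hleaf : ∀ d : Fin D, ∀ u' < 2 ^ (N * O.k), ∀ z < 2 ^ (n * O.k + m * O.k),
        leaf D O (pathVector D O (fun d => u * 2 ^ (n * O.k + m * O.k) + b' d)) d
          (u' * 2 ^ (n * O.k + m * O.k) + z) = if u = u' ∧ b d = z then 1 else 0 := by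
      intro d u' hu' z hz
      rw [leaf_pathVector d.2 (by rw [two_pow_depth]; exact mul_add_lt_mul hz hu'), hb']
      simp only [mul_add_inj (hb1 d) hz]
    refine ⟨pathVector D O (fun d => u * 2 ^ (n * O.k + m * O.k) + b' d),
      ⟨pathVector_mem hD hu hΦ hb'', fun d u' hu' z hz h => ?_⟩, ?_⟩
    · rw [hleaf d u' hu' z hz, if_neg]
      rintro ⟨-, rfl⟩
      exact h (hb d).2
    · refine Prod.ext ?_ (funext fun d => ?_)
      · simp only [treeMap, LinearMap.coe_mk, AddHom.coe_mk]
        rw [Finset.sum_eq_single u]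
        · rw [node_param_pathVector hD hu (hb'' 0 hD) rfl, if_pos rfl, one_smul]
        · intro u' hu' hne
          rw [node_param_pathVector hD (Finset.mem_range.1 hu') (hb'' 0 hD) rfl, if_neg hne.symm,
            zero_smul]
        · intro h; exact absurd (Finset.mem_range.2 hu) h
      · simp only [treeMap, LinearMap.coe_mk, AddHom.coe_mk]
        rw [Finset.sum_eq_single u, Finset.sum_eq_single (b d)]
        · rw [hleaf d u hu _ (hb1 d), if_pos ⟨rfl, rfl⟩, one_smul]
        · intro z hz hne
          rw [hleaf d u hu z (Finset.mem_range.1 hz), if_neg (fun h => hne h.2.symm), zero_smul]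
        · intro h; exact absurd (Finset.mem_range.2 (hb1 d)) h
        · intro u' hu' hne
          refine Finset.sum_eq_zero fun z hz => ?_
          rw [hleaf d u' (Finset.mem_range.1 hu') z (Finset.mem_range.1 hz),
            if_neg (fun h => hne h.1.symm), zero_smul]
        · intro h; exact absurd (Finset.mem_range.2 hu) h

end

/-! ### Code words and grid points -/

/-- Every choice of digits has a code word. -/
theorem exists_word {q k : ℕ} (z : Fin q → Fin k → Bool) :
    ∃ w < 2 ^ (q * k), ∀ (i : Fin q) (h : Fin k), w.testBit (i * k + h) = z i h := by
  refine ⟨Nat.ofBits fun j : Fin (q * k) => z (finProdFinEquiv.symm j).1 (finProdFinEquiv.symm j).2,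
    Nat.ofBits_lt_two_pow _, fun i h => ?_⟩
  have hj : (i : ℕ) * k + h < q * k := mul_add_lt_mul h.2 i.2
  rw [Nat.testBit_ofBits_lt _ _ hj]
  have e : (⟨(i : ℕ) * k + h, hj⟩ : Fin (q * k)) = finProdFinEquiv (i, h) := by
    apply Fin.ext
    simp only [finProdFinEquiv_apply_val]
    ring
  rw [e, Equiv.symm_apply_apply]

theorem wordPoint_eq_gridPoint {q k w : ℕ} {z : Fin q → Fin k → Bool}
    
    (h : ∀ (i : Fin q) (h : Fin k), w.testBit (i * k + h) = z i h) : wordPoint q k w = gridPoint z := by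
  unfold wordPoint
  congr 1
  funext i j
  exact h i j

theorem sum_half_pow (k : ℕ) : ∑ h : Fin k, (1 / 2 : ℝ) ^ ((h : ℕ) + 1) = 1 - (1 / 2) ^ k := by
  induction k with
  | zero => simp
  | succ k ih =>
    rw [Fin.sum_univ_castSucc]
    simp only [Fin.val_castSucc, Fin.val_last, ih]
    ring

theorem bit_nonneg (b : Bool) : 0 ≤ bit b := by cases b <;> simp [bit]

theorem bit_le_one (b : Bool) : bit b ≤ 1 := by cases b <;> simp [bit]

theorem gridPoint_mem_box {q k : ℕ} (z : Fin q → Fin k → Bool) : gridPoint z ∈ box q := by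
  have h : ∀ i, 0 ≤ ∑ h : Fin k, (1 / 2 : ℝ) ^ ((h : ℕ) + 1) * bit (z i h) ∧
      ∑ h : Fin k, (1 / 2 : ℝ) ^ ((h : ℕ) + 1) * bit (z i h) ≤ 1 := by
    intro i
    refine ⟨Finset.sum_nonneg fun h _ => mul_nonneg (by positivity) (bit_nonneg _), ?_⟩
    calc _ ≤ ∑ h : Fin k, (1 / 2 : ℝ) ^ ((h : ℕ) + 1) :=
          Finset.sum_le_sum fun h _ => mul_le_of_le_one_right (by positivity) (bit_le_one _)
      _ ≤ 1 := by rw [sum_half_pow]; linarith [show (0 : ℝ) ≤ (1 / 2) ^ k by positivity]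
  constructor <;> intro i <;> have := h i <;> simp only [gridPoint, decode] <;> linarith

/-- The first digit has the weight 1/2 and is the top bit of c, hence the reversed index k - 1 - h.
The induction splits off the lowest bit. -/
theorem sum_digits_eq (k c : ℕ) (hc : c < 2 ^ k) :
    ∑ h : Fin k, (1 / 2 : ℝ) ^ ((h : ℕ) + 1) * bit (c.testBit (k - 1 - h)) = c / 2 ^ k := by
  induction k generalizing c with
  | zero =>
    have : c = 0 := by simpa using hc
    simp [this]
  | succ k ih =>
    rw [Fin.sum_univ_castSucc]
    have h1 : ∀ h : Fin k, c.testBit (k + 1 - 1 - (h : ℕ)) = (c / 2).testBit (k - 1 - h) := by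
      intro h
      rw [show k + 1 - 1 - (h : ℕ) = (k - 1 - h) + 1 by omega, Nat.testBit_succ]
    simp only [Fin.val_castSucc, Fin.val_last, h1]
    rw [ih (c / 2) (by rw [pow_succ] at hc; omega)]
    have h2 : bit (c.testBit (k + 1 - 1 - k)) = ((c % 2 : ℕ) : ℝ) := by
      rw [show k + 1 - 1 - k = 0 by omega, Nat.testBit_zero, bit]
      rcases Nat.mod_two_eq_zero_or_one c with h | h <;> simp [h]
    have h3 : (c : ℝ) = 2 * ((c / 2 : ℕ) : ℝ) + ((c % 2 : ℕ) : ℝ) := by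
      exact_mod_cast (Nat.div_add_mod c 2).symm
    rw [h2, h3, pow_succ, one_div_pow]
    field_simp
    ring

/-- Every point of the cube is approximated by a grid point. -/
theorem exists_approximates {q k : ℕ} {γ : ℝ} (hγ : 1 / 2 ^ k ≤ γ) {r : Fin q → ℝ}
    (hr : r ∈ box q) : ∃ z : Fin q → Fin k → Bool, Approximates γ z r := by
  have key : ∀ i, ∃ c : ℕ, c < 2 ^ k ∧ -1 + 2 * ((c : ℝ) / 2 ^ k) ≤ r i ∧
      r i ≤ -1 + 2 * ((c : ℝ) / 2 ^ k) + 2 * γ := by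
    intro i
    have h1 : -1 ≤ r i := hr.1 i
    have h2 : r i ≤ 1 := hr.2 i
    have hK : (0 : ℝ) < 2 ^ k := by positivity
    have hu : 0 ≤ (r i + 1) / 2 * 2 ^ k := by
      have : 0 ≤ (r i + 1) / 2 := by linarith
      positivity
    -- At the right end the floor would be 2^k, which has no digits; the top grid point misses 1 by
    -- 2/2^k ≤ 2γ.
    rcases lt_or_ge (r i) 1 with h | h
    · refine ⟨⌊(r i + 1) / 2 * 2 ^ k⌋₊, ?_, ?_, ?_⟩
      · rw [Nat.floor_lt hu]
        push_cast
        nlinarith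
      · have := Nat.floor_le hu
        have h3 : (⌊(r i + 1) / 2 * 2 ^ k⌋₊ : ℝ) / 2 ^ k ≤ (r i + 1) / 2 := by
          rwa [div_le_iff₀ hK]
        linarith
      · have h3 : (r i + 1) / 2 ≤ (⌊(r i + 1) / 2 * 2 ^ k⌋₊ : ℝ) / 2 ^ k + 1 / 2 ^ k := by
          rw [← add_div, le_div_iff₀ hK]; exact (Nat.lt_floor_add_one _).le
        linarith
    · have hc : ((2 ^ k - 1 : ℕ) : ℝ) / 2 ^ k = 1 - 1 / 2 ^ k := by
        rw [Nat.cast_sub Nat.one_le_two_pow]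
        push_cast
        field_simp
      refine ⟨2 ^ k - 1, Nat.sub_lt (by positivity) one_pos, ?_, ?_⟩ <;> rw [hc]
      · have : (0 : ℝ) ≤ 1 / 2 ^ k := by positivity
        linarith
      · linarith
  choose c hc h1 h2 using key
  refine ⟨fun i h => (c i).testBit (k - 1 - h), fun i => ?_⟩
  simp only [gridPoint, decode]
  rw [sum_digits_eq k (c i) (hc i)]
  exact ⟨h1 i, h2 i⟩

theorem Approximates.dist_le {q k : ℕ} {γ : ℝ} (hγ : 0 ≤ γ) {z : Fin q → Fin k → Bool}
    {r : Fin q → ℝ} (h : Approximates γ z r) : dist r (gridPoint z) ≤ 2 * γ := by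
  rw [dist_pi_le_iff (by linarith)]
  intro i
  rw [Real.dist_eq, abs_le]
  constructor <;> linarith [(h i).1, (h i).2]

/-! ### The hull of the discretized region -/

section

variable {n m N D : ℕ} {O : Oracles n m N}

theorem leafPoint_eq {u z : ℕ} (hz : z < 2 ^ (n * O.k + m * O.k)) :
    leafPoint O (u * 2 ^ (n * O.k + m * O.k) + z) =
      (wordPoint n O.k (z / 2 ^ (m * O.k)), wordPoint m O.k z,
        O.ℓ (O.f (wordPoint n O.k (z / 2 ^ (m * O.k))) (wordPoint N O.k u))
          (wordPoint m O.k z)) := by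
  have h1 : wordPoint n O.k ((u * 2 ^ (n * O.k + m * O.k) + z) / 2 ^ (m * O.k)) =
      wordPoint n O.k (z / 2 ^ (m * O.k)) := by
    refine wordPoint_eq_gridPoint fun i h => ?_
    have : (i : ℕ) * O.k + h < n * O.k := mul_add_lt_mul h.2 i.2
    simp only [Nat.testBit_div_two_pow]
    exact testBit_mul_two_pow_add (by omega)
  have h2 : wordPoint m O.k (u * 2 ^ (n * O.k + m * O.k) + z) = wordPoint m O.k z := by
    refine wordPoint_eq_gridPoint fun i h => ?_
    have : (i : ℕ) * O.k + h < m * O.k := mul_add_lt_mul h.2 i.2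
    exact testBit_mul_two_pow_add (by omega)
  rw [leafPoint, leafLoss, h1, h2, mul_add_div_of_lt hz]

/-- Digits of the data have a code word. -/
theorem exists_dataWord {k : ℕ} (a : Fin n → Fin k → Bool) (b : Fin m → Fin k → Bool) :
    ∃ z < 2 ^ (n * k + m * k),
      (∀ (i : Fin n) (h : Fin k), (z / 2 ^ (m * k)).testBit (i * k + h) = a i h) ∧
      (∀ (i : Fin m) (h : Fin k), z.testBit (i * k + h) = b i h) := by
  obtain ⟨x, hx, hx'⟩ := exists_word a
  obtain ⟨y, hy, hy'⟩ := exists_word b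
  refine ⟨x * 2 ^ (m * k) + y, ?_, ?_, ?_⟩
  · rw [pow_add]; exact mul_add_lt_mul hy hx
  · rwa [mul_add_div_of_lt hy]
  · intro i h
    rw [testBit_mul_two_pow_add (mul_add_lt_mul h.2 i.2), hy']

theorem arrange_image_wordPoints :
    arrange n m N D '' wordPoints D O (fun _ => Set.univ) =
      discreteRegion D O.k O.Φ O.ℓ O.f := by
  ext p
  constructor
  · rintro ⟨_, ⟨u, hu, hΦ, b, hb, rfl⟩, rfl⟩
    simp only [leafPoint_eq (Finset.mem_range.1 (hb _).1)]
    exact ⟨fun d => gridPoint_mem_box _, fun d => gridPoint_mem_box _, hΦ, fun d => rfl, _, _, _,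
      fun d => rfl, fun d => rfl, rfl⟩
  -- The cube conditions are automatic for grid points.
  · rintro ⟨-, -, hΦ, hL, zx, zy, zφ, hx, hy, hφ⟩
    obtain ⟨u, hu, hu'⟩ := exists_word zφ
    choose b hb hbx hby using fun d => exists_dataWord (zx d) (zy d)
    have e := wordPoint_eq_gridPoint hu'
    refine ⟨_, ⟨u, Finset.mem_range.2 hu, ?_, b, fun d => ⟨Finset.mem_range.2 (hb d), trivial⟩, rfl⟩,
      ?_⟩
    · simp only [Set.mem_ofPred_eq, e, ← hφ]; exact hΦ
    · simp only [leafPoint_eq (hb _), arrange, LinearMap.coe_mk, AddHom.coe_mk, e,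
        wordPoint_eq_gridPoint (hbx _), wordPoint_eq_gridPoint (hby _)]
      refine Prod.ext ?_ (Prod.ext ?_ (Prod.ext ?_ ?_))
      · exact funext fun d => (hx d).symm
      · exact funext fun d => (hy d).symm
      · exact hφ.symm
      · funext d
        simp only [hL d, hx d, hy d, hφ]

/-- The linear program is a formulation of the convex hull of the discretized region. -/
theorem point_image_polytope (hD : 0 < D) :
    (lpFormulation D O).point '' (lpFormulation D O).polytope =
      convexHull ℝ (discreteRegion D O.k O.Φ O.ℓ O.f) := by
  have h : wordFace D O (fun _ => Set.univ) = (lpFormulation D O).polytope := by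
    ext v
    exact ⟨fun h => h.1, fun h => ⟨h, fun d u hu z hz hn => absurd trivial hn⟩⟩
  rw [← arrange_image_wordPoints, ← LinearMap.image_convexHull, ← treeMap_image_wordFace hD, h,
    Set.image_image]
  exact Set.image_congr fun v hv => point_eq_arrange hD hv

/-! ### The faces of the data sets -/

/-- The data words with given digits. -/
def dataWords {k : ℕ} (ax : Fin D → Fin n → Fin k → Bool) (ay : Fin D → Fin m → Fin k → Bool)
    (d : Fin D) : Set ℕ :=
  {z | (∀ (i : Fin n) (h : Fin k), (z / 2 ^ (m * k)).testBit (i * k + h) = ax d i h) ∧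
    ∀ (i : Fin m) (h : Fin k), z.testBit (i * k + h) = ay d i h}

/-- A mean of bits is extreme only if no weight lies on the opposite bit: a sum of nonnegative terms
vanishes, after passing to complements for `true`. -/
theorem sum_bit_mul_eq_bit_iff {ι : Type*} (s : Finset ι) (c : ι → ℝ) (β : ι → Bool) (b : Bool)
    (hc : ∀ i ∈ s, 0 ≤ c i) (h1 : ∑ i ∈ s, c i = 1) :
    ∑ i ∈ s, bit (β i) * c i = bit b ↔ ∀ i ∈ s, β i ≠ b → c i = 0 := by
  cases b with
  | false =>
    rw [show bit false = 0 by simp [bit],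
      Finset.sum_eq_zero_iff_of_nonneg fun i hi => mul_nonneg (bit_nonneg _) (hc i hi)]
    refine forall₂_congr fun i hi => ?_
    cases β i <;> simp [bit]
  | true =>
    have e : ∑ i ∈ s, bit (β i) * c i = bit true ↔ ∑ i ∈ s, (1 - bit (β i)) * c i = 0 := by
      simp only [sub_mul, one_mul, Finset.sum_sub_distrib, h1]
      rw [show bit true = 1 by simp [bit], sub_eq_zero, eq_comm]
    rw [e, Finset.sum_eq_zero_iff_of_nonneg fun i hi =>
      mul_nonneg (sub_nonneg.2 (bit_le_one _)) (hc i hi)]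
    refine forall₂_congr fun i hi => ?_
    cases β i <;> simp [bit]

theorem dataFace_eq_wordFace (hD : 0 < D) (ax : Fin D → Fin n → Fin O.k → Bool)
    (ay : Fin D → Fin m → Fin O.k → Bool) :
    (lpFormulation D O).dataFace ax ay = wordFace D O (dataWords ax ay) := by
  ext v
  refine and_congr_right fun hv => ?_
  have hc := isCoupling_of_mem hD hv
  have hsum : ∀ (d : Fin D) (β : ℕ → Bool) (b : Bool),
      ∑ w ∈ Finset.range (2 ^ (N * O.k + n * O.k + m * O.k)), bit (β w) * leaf D O v d w = bit b ↔
      ∀ w ∈ Finset.range (2 ^ (N * O.k + n * O.k + m * O.k)), β w ≠ b → leaf D O v d w = 0 :=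
    fun d β b => sum_bit_mul_eq_bit_iff _ _ _ _
      (fun w hw => hc.nonneg d d.2 w (Finset.mem_range.1 hw)) (hc.sum_eq_one d d.2)
  have hx : ∀ (u z : ℕ) (i : Fin n) (h : Fin O.k),
      ((u * 2 ^ (n * O.k + m * O.k) + z) / 2 ^ (m * O.k)).testBit (i * O.k + h) =
      (z / 2 ^ (m * O.k)).testBit (i * O.k + h) := by
    intro u z i h
    have : (i : ℕ) * O.k + h < n * O.k := mul_add_lt_mul h.2 i.2
    simp only [Nat.testBit_div_two_pow]
    exact testBit_mul_two_pow_add (by omega)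
  have hy : ∀ (u z : ℕ) (i : Fin m) (h : Fin O.k),
      (u * 2 ^ (n * O.k + m * O.k) + z).testBit (i * O.k + h) = z.testBit (i * O.k + h) := by
    intro u z i h
    have : (i : ℕ) * O.k + h < m * O.k := mul_add_lt_mul h.2 i.2
    exact testBit_mul_two_pow_add (by omega)
  have hlt : ∀ u < 2 ^ (N * O.k), ∀ z < 2 ^ (n * O.k + m * O.k),
      u * 2 ^ (n * O.k + m * O.k) + z < 2 ^ (N * O.k + n * O.k + m * O.k) := by
    intro u hu z hz
    rw [two_pow_depth]; exact mul_add_lt_mul hz hu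
  have hsplit : ∀ w < 2 ^ (N * O.k + n * O.k + m * O.k), ∃ u < 2 ^ (N * O.k),
      ∃ z < 2 ^ (n * O.k + m * O.k), w = u * 2 ^ (n * O.k + m * O.k) + z := by
    intro w hw
    refine ⟨w / 2 ^ (n * O.k + m * O.k), Nat.div_lt_of_lt_mul ?_, w % 2 ^ (n * O.k + m * O.k),
      Nat.mod_lt _ (by positivity), ?_⟩
    · rwa [mul_comm, ← two_pow_depth]
    · rw [mul_comm, Nat.div_add_mod]
  simp only [zx_dotProduct hD hv, zy_dotProduct hD hv]
  constructor
  · rintro ⟨h1, h2⟩ d u hu z hz hn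
    by_contra hne
    refine hn ⟨fun i h => ?_, fun i h => ?_⟩
    · by_contra h3
      exact hne ((hsum d _ _).1 (h1 d i h) _ (Finset.mem_range.2 (hlt u hu z hz)) (by rwa [hx]))
    · by_contra h3
      exact hne ((hsum d _ _).1 (h2 d i h) _ (Finset.mem_range.2 (hlt u hu z hz)) (by rwa [hy]))
  · intro H
    refine ⟨fun d i h => (hsum d _ _).2 fun w hw hne => ?_,
      fun d i h => (hsum d _ _).2 fun w hw hne => ?_⟩
    · obtain ⟨u, hu, z, hz, rfl⟩ := hsplit w (Finset.mem_range.1 hw)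
      rw [hx] at hne
      exact H d u hu z hz fun hm => hne (hm.1 i h)
    · obtain ⟨u, hu, z, hz, rfl⟩ := hsplit w (Finset.mem_range.1 hw)
      rw [hy] at hne
      exact H d u hu z hz fun hm => hne (hm.2 i h)

/-- The variables to be fixed are the leaves of tree d with data word outside `B d`, for every
parameter word. -/
theorem exists_zero_set (B : Fin D → Set ℕ) :
    ∃ J : Finset (Fin (lpFormulation D O).nv), wordFace D O B =
      {v ∈ (lpFormulation D O).polytope | ∀ j ∈ J, v j = 0} := by
  classical
  refine ⟨Finset.univ.filter fun j => ∃ d : Fin D, ∃ u < 2 ^ (N * O.k),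
    ∃ z < 2 ^ (n * O.k + m * O.k), z ∉ B d ∧ (j : ℕ) = (2 ^ (N * O.k + n * O.k + m * O.k) +
      (u * 2 ^ (n * O.k + m * O.k) + z) - 1) * D + d, ?_⟩
  ext v
  refine and_congr_right fun hv => ?_
  have hl : ∀ (d : Fin D) (u z : ℕ) (j : Fin (lpFormulation D O).nv),
      (j : ℕ) = (2 ^ (N * O.k + n * O.k + m * O.k) +
        (u * 2 ^ (n * O.k + m * O.k) + z) - 1) * D + d →
      leaf D O v d (u * 2 ^ (n * O.k + m * O.k) + z) = v j := by
    intro d u z j hj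
    rw [leaf, node, ← hj, extend_val]
  constructor
  · rintro H j hj
    obtain ⟨-, d, u, hu, z, hz, hn, hj⟩ := Finset.mem_filter.1 hj
    rw [← hl d u z j hj]
    exact H d u hu z hz hn
  · intro H d u hu z hz hn
    have hlt : (2 ^ (N * O.k + n * O.k + m * O.k) +
        (u * 2 ^ (n * O.k + m * O.k) + z) - 1) * D + d < (lpFormulation D O).nv := by
      refine mul_add_lt_mul d.2 ?_
      have := mul_add_lt_mul hz hu
      rw [← two_pow_depth] at this
      rw [pow_succ]
      omega
    rw [hl d u z ⟨_, hlt⟩ rfl]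
    exact H _ (Finset.mem_filter.2 ⟨Finset.mem_univ _, d, u, hu, z, hz, hn, rfl⟩)

/-- On `P` the sum of the coordinates in `J` is nonnegative and vanishes exactly on `F`, so its
negative exposes `F`. An empty `F` is exposed by convention. -/
theorem isExposed_of_zero_set {ι : Type*} [Fintype ι] {P F : Set (ι → ℝ)} (J : Finset ι)
    (hP : ∀ v ∈ P, ∀ j, 0 ≤ v j) (hF : F = {v ∈ P | ∀ j ∈ J, v j = 0}) : IsExposed ℝ P F := by
  rintro ⟨v₀, hv₀⟩
  refine ⟨-∑ j ∈ J, ContinuousLinearMap.proj j, ?_⟩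
  have e : ∀ v : ι → ℝ, (-∑ j ∈ J, (ContinuousLinearMap.proj j : (ι → ℝ) →L[ℝ] ℝ)) v =
      -∑ j ∈ J, v j := by
    intro v
    simp
  simp only [e]
  subst hF
  ext v
  refine and_congr_right fun hv => ?_
  constructor
  · intro h y hy
    rw [Finset.sum_eq_zero h, neg_zero, neg_nonpos]
    exact Finset.sum_nonneg fun j _ => hP y hy j
  · intro h
    have := h v₀ hv₀.1
    rw [Finset.sum_eq_zero hv₀.2] at this
    exact (Finset.sum_eq_zero_iff_of_nonneg fun j _ => hP v hv j).1
      (le_antisymm (by linarith) (Finset.sum_nonneg fun j _ => hP v hv j))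

/-- The projection of the face of a data set. -/
theorem projFace_eq_convexHull (hD : 0 < D) (ax : Fin D → Fin n → Fin O.k → Bool)
    (ay : Fin D → Fin m → Fin O.k → Bool) :
    (lpFormulation D O).projFace ax ay =
      convexHull ℝ ((fun zφ : Fin N → Fin O.k → Bool => (gridPoint zφ, fun d =>
        O.ℓ (O.f (gridPoint (ax d)) (gridPoint zφ)) (gridPoint (ay d)))) ''
          {zφ | gridPoint zφ ∈ O.Φ}) := by
  let Λ : ((Fin N → ℝ) × (Fin D → (Fin n → ℝ) × (Fin m → ℝ) × ℝ)) →ₗ[ℝ]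
      (Fin N → ℝ) × (Fin D → ℝ) :=
    { toFun := fun q => (q.1, fun d => (q.2 d).2.2)
      map_add' := fun _ _ => rfl
      map_smul' := fun _ _ => rfl }
  have h1 : (lpFormulation D O).projFace ax ay =
      Λ '' (treeMap D O '' wordFace D O (dataWords ax ay)) := by
    rw [Formulation.projFace, dataFace_eq_wordFace hD, Set.image_image]
    refine Set.image_congr fun v hv => ?_
    have := point_eq_arrange hD hv.1
    exact Prod.ext (congrArg (fun p => p.2.2.1) this) (congrArg (fun p => p.2.2.2) this)
  rw [h1, treeMap_image_wordFace hD, LinearMap.image_convexHull]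
  congr 1
  ext q
  constructor
  · rintro ⟨_, ⟨u, hu, hΦ, b, hb, rfl⟩, rfl⟩
    have hx : ∀ d, wordPoint n O.k (b d / 2 ^ (m * O.k)) = gridPoint (ax d) :=
      fun d => wordPoint_eq_gridPoint (hb d).2.1
    have hy : ∀ d, wordPoint m O.k (b d) = gridPoint (ay d) :=
      fun d => wordPoint_eq_gridPoint (hb d).2.2
    refine ⟨_, hΦ, ?_⟩
    simp only [Λ, LinearMap.coe_mk, AddHom.coe_mk, leafPoint_eq (Finset.mem_range.1 (hb _).1),
      hx, hy]
    rfl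
  · rintro ⟨zφ, hΦ, rfl⟩
    obtain ⟨u, hu, hu'⟩ := exists_word zφ
    choose b hb hbx hby using fun d => exists_dataWord (ax d) (ay d)
    have e := wordPoint_eq_gridPoint hu'
    refine ⟨_, ⟨u, Finset.mem_range.2 hu, ?_, b,
      fun d => ⟨Finset.mem_range.2 (hb d), hbx d, hby d⟩, rfl⟩, ?_⟩
    · simp only [Set.mem_ofPred_eq, e]; exact hΦ
    · simp only [Λ, LinearMap.coe_mk, AddHom.coe_mk, leafPoint_eq (hb _), e,
        wordPoint_eq_gridPoint (hbx _), wordPoint_eq_gridPoint (hby _)]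

end

/-! ### The size of the grid -/

theorem digits_spec {Lc ε : ℝ} (hε : 0 < ε) (h : ε < 2 * Lc) :
    0 < digits Lc ε ∧ 2 * Lc / ε ≤ 2 ^ digits Lc ε ∧ (2 : ℝ) ^ digits Lc ε < 2 * (2 * Lc / ε) ∧
      ((∃ j : ℕ, 2 * Lc / ε = 2 ^ j) → (2 : ℝ) ^ digits Lc ε = 2 * Lc / ε) := by
  have h1 : 1 < 2 * Lc / ε := (one_lt_div hε).2 h
  have h0 : 0 < 2 * Lc / ε := by linarith
  have hlog : 0 < Real.logb 2 (2 * Lc / ε) := Real.logb_pos (by norm_num) h1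
  refine ⟨Nat.ceil_pos.2 hlog, ?_, ?_, ?_⟩
  · rw [← Real.rpow_natCast, ← Real.logb_le_iff_le_rpow (by norm_num) h0]
    exact Nat.le_ceil _
  · have h2 : (digits Lc ε : ℝ) < Real.logb 2 (2 * Lc / ε) + 1 := Nat.ceil_lt_add_one hlog.le
    have h3 : (2 : ℝ) ^ (digits Lc ε : ℝ) < 2 ^ (Real.logb 2 (2 * Lc / ε) + 1) :=
      Real.rpow_lt_rpow_of_exponent_lt (by norm_num) h2
    rw [Real.rpow_add (by norm_num), Real.rpow_logb (by norm_num) (by norm_num) h0,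
      Real.rpow_natCast, Real.rpow_one] at h3
    linarith
  · rintro ⟨j, hj⟩
    have : digits Lc ε = j := by
      rw [digits, hj, ← Real.rpow_natCast, Real.logb_rpow (by norm_num) (by norm_num),
        Nat.ceil_natCast]
    rw [this, hj]

/-! ### Risks -/

section

variable {n m N D : ℕ}

/-- In the maximum norm, simultaneous changes of x, φ and y by δ cost only one Lδ per term, and the
average inherits the bound. -/
theorem abs_risk_sub_risk_le (hD : 0 < D) {Φ : Set (Fin N → ℝ)} {ℓ : (Fin m → ℝ) → (Fin m → ℝ) → ℝ}
    {f : (Fin n → ℝ) → (Fin N → ℝ) → (Fin m → ℝ)} {Lc : ℝ≥0}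
    (hL : IsArchitectureLipschitz Lc Φ ℓ f) {δ : ℝ} {X X' : Fin D → Fin n → ℝ}
    {Y Y' : Fin D → Fin m → ℝ} {φ φ' : Fin N → ℝ} (hX : ∀ d, X d ∈ box n)
    (hX' : ∀ d, X' d ∈ box n) (hY : ∀ d, Y d ∈ box m) (hY' : ∀ d, Y' d ∈ box m) (hφ : φ ∈ Φ)
    (hφ' : φ' ∈ Φ) (dX : ∀ d, dist (X d) (X' d) ≤ δ) (dY : ∀ d, dist (Y d) (Y' d) ≤ δ)
    (dφ : dist φ φ' ≤ δ) : |risk ℓ f X Y φ - risk ℓ f X' Y' φ'| ≤ Lc * δ := by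
  have h : ∀ d, |ℓ (f (X d) φ) (Y d) - ℓ (f (X' d) φ') (Y' d)| ≤ Lc * δ := by
    intro d
    have h1 := hL.dist_le_mul (X d, φ, Y d) ⟨hX d, hφ, hY d⟩ (X' d, φ', Y' d) ⟨hX' d, hφ', hY' d⟩
    rw [Real.dist_eq] at h1
    refine h1.trans (mul_le_mul_of_nonneg_left ?_ Lc.2)
    rw [Prod.dist_eq, Prod.dist_eq]
    exact max_le (dX d) (max_le dφ (dY d))
  have hD' : (0 : ℝ) < D := by exact_mod_cast hD
  rw [risk, risk, ← mul_sub, ← Finset.sum_sub_distrib, abs_mul, abs_of_pos (by positivity)]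
  calc _ ≤ 1 / (D : ℝ) * ∑ _d : Fin D, (Lc * δ : ℝ) :=
        mul_le_mul_of_nonneg_left ((Finset.abs_sum_le_sum_abs _ _).trans
          (Finset.sum_le_sum fun d _ => h d)) (by positivity)
    _ = Lc * δ := by
        rw [Finset.sum_const, Finset.card_univ, Fintype.card_fin, nsmul_eq_mul]
        field_simp

theorem gridDense_box {k : ℕ} {γ : ℝ} (hγ : 1 / 2 ^ k ≤ γ) : GridDense k γ (box N) := by
  intro φ hφ
  obtain ⟨z, hz⟩ := exists_approximates hγ hφ
  exact ⟨z, gridPoint_mem_box z, hz.dist_le (le_trans (by positivity) hγ)⟩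

end

/-- A linear form attains its minimum over a polytope at an extreme point. -/
theorem exists_extremePoint_isMinOn {E : Type*} [AddCommGroup E] [Module ℝ E] [TopologicalSpace E]
    [IsTopologicalAddGroup E] [ContinuousSMul ℝ E] [T2Space E] [LocallyConvexSpace ℝ E] {S : Set E}
    (hS : S.Finite) (hne : S.Nonempty) (l : E →L[ℝ] ℝ) :
    ∃ q ∈ Set.extremePoints ℝ (convexHull ℝ S), IsMinOn l (convexHull ℝ S) q := by
  have hcomp : IsCompact (convexHull ℝ S) := hS.isCompact_convexHull ℝ
  -- The minimizers form a nonempty compact exposed face; it has an extreme point, and extreme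
  -- points of a face are extreme in the hull.
  have hexp : IsExposed ℝ (convexHull ℝ S)
      {x ∈ convexHull ℝ S | ∀ y ∈ convexHull ℝ S, (-l) y ≤ (-l) x} := fun _ => ⟨-l, rfl⟩
  obtain ⟨x, hx, hmin⟩ := hcomp.exists_isMinOn (hne.convexHull) l.continuous.continuousOn
  obtain ⟨q, hq⟩ := (hexp.isCompact hcomp).extremePoints_nonempty
    ⟨x, hx, fun y hy => neg_le_neg (hmin hy)⟩
  refine ⟨q, hexp.isExtreme.extremePoints_subset_extremePoints hq, fun y hy => ?_⟩
  exact neg_le_neg_iff.1 ((extremePoints_subset hq).2 y hy)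

end ERM

end

/-! ### The theorem -/

theorem mainTheorem1 :
    ∃ (prog : ERM.Cmd) (C : ℕ),
      ∀ (n m N D : ℕ) (_ : 0 < D) (Φ : Set (Fin N → ℝ)) (_ : Φ ⊆ ERM.box N)
        (ℓ : (Fin m → ℝ) → (Fin m → ℝ) → ℝ)
        (f : (Fin n → ℝ) → (Fin N → ℝ) → (Fin m → ℝ))
        (Lc : NNReal) (_ : ERM.IsArchitectureLipschitz Lc Φ ℓ f)
        (ε : ℝ) (_ : 0 < ε) (_ : ε < 2 * (Lc : ℝ)),
      let k : ℕ := ERM.digits Lc ε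
      let K : ℕ := 2 ^ k
      let γ : ℝ := ε / (2 * (Lc : ℝ))
      let final : ERM.Config := prog.run ⟨k, f, ℓ, Φ⟩ (ERM.startConfig n m N D k)
      let P : ERM.Formulation n m N D k := final.formulation n m N D k
      -- the grid size `K` is `2𝓛/ε`, rounded up to a power of two
      (2 * (Lc : ℝ) / ε ≤ K ∧ (K : ℝ) < 2 * (2 * (Lc : ℝ) / ε) ∧
        ((∃ j : ℕ, 2 * (Lc : ℝ) / ε = 2 ^ j) → (K : ℝ) = 2 * (Lc : ℝ) / ε)) ∧
      -- the linear program is a formulation of the convex hull, with a bounded feasible set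
      (P.point '' P.polytope = convexHull ℝ (ERM.discreteRegion D k Φ ℓ f) ∧
        Bornology.IsBounded P.polytope) ∧
      -- its size
      (P.nv ≤ 4 * D * K ^ (n + m + N) ∧
        P.neq + P.nle ≤ 2 * D * (2 * K ^ (n + m + N) + 1)) ∧
      -- the time of its construction
      (final.time ≤ C * (K ^ (n + m + N) * D) ∧
        final.callsF ≤ C * K ^ (n + m + N) ∧
        final.callsL ≤ C * K ^ (n + m + N) ∧
        final.callsPhi ≤ C * K ^ (n + m + N)) ∧
      -- the faces of the data sets
      ∀ (X : Fin D → Fin n → ℝ) (Y : Fin D → Fin m → ℝ)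
        (_ : ∀ d, X d ∈ ERM.box n) (_ : ∀ d, Y d ∈ ERM.box m),
        (∃ (ax : Fin D → Fin n → Fin k → Bool) (ay : Fin D → Fin m → Fin k → Bool),
          (∀ d, ERM.Approximates γ (ax d) (X d)) ∧ (∀ d, ERM.Approximates γ (ay d) (Y d))) ∧
        ∀ (ax : Fin D → Fin n → Fin k → Bool) (ay : Fin D → Fin m → Fin k → Bool)
          (_ : ∀ d, ERM.Approximates γ (ax d) (X d)) (_ : ∀ d, ERM.Approximates γ (ay d) (Y d)),
          IsExposed ℝ P.polytope (P.dataFace ax ay) ∧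
          (∃ J : Finset (Fin P.nv), P.dataFace ax ay = {v ∈ P.polytope | ∀ j ∈ J, v j = 0}) ∧
          ((Φ = ERM.box N ∨ ERM.GridDense k γ Φ) →
            let objective : (Fin N → ℝ) × (Fin D → ℝ) → ℝ :=
              fun q => (1 / (D : ℝ)) * ∑ d, q.2 d
            (Φ.Nonempty → ∃ q ∈ Set.extremePoints ℝ (P.projFace ax ay),
              IsMinOn objective (P.projFace ax ay) q) ∧
            ∀ q ∈ Set.extremePoints ℝ (P.projFace ax ay),
              IsMinOn objective (P.projFace ax ay) q →
              q.1 ∈ Φ ∧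
              ∀ φopt ∈ Φ, IsMinOn (ERM.risk ℓ f X Y) Φ φopt →
                |ERM.risk ℓ f X Y φopt - ERM.risk ℓ f X Y q.1| ≤ 2 * ε) := by
  refine ⟨ERM.lpProgram, 200, ?_⟩
  intro n m N D hD Φ hΦ ℓ f Lc hL ε hε hεL k K γ final P
  obtain ⟨hk, hK₁, hK₂, hK₃⟩ := ERM.digits_spec hε hεL
  have hP : P = ERM.lpFormulation D ⟨k, f, ℓ, Φ⟩ := ERM.lpProgram_formulation ⟨k, f, ℓ, Φ⟩ hD hk
  have hT : K ^ (n + m + N) = 2 ^ (N * k + n * k + m * k) := by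
    rw [← pow_mul]; congr 1; ring
  have ha : 2 ^ (N * k) ≤ 2 ^ (N * k + n * k + m * k) :=
    Nat.pow_le_pow_right (by norm_num) (by omega)
  obtain ⟨-, -, -, -, htime, hcalls⟩ :=
    ERM.lpProgram_run (n := n) (m := m) (N := N) (O := ⟨k, f, ℓ, Φ⟩) hD hk
  replace hcalls : final.callsF + final.callsL + final.callsPhi ≤
      200 * 2 ^ (N * k + n * k + m * k) := hcalls
  have hLc : (0 : ℝ) < 2 * Lc := by linarith
  have hγ : 1 / 2 ^ k ≤ γ := by
    rw [div_le_iff₀ (by positivity)]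
    have h1 : 2 * (Lc : ℝ) / ε ≤ 2 ^ k := hK₁
    rw [div_le_iff₀ hε] at h1
    simp only [γ]
    rw [div_mul_eq_mul_div, le_div_iff₀ hLc]
    linarith
  have hγ₀ : 0 ≤ γ := le_trans (by positivity) hγ
  -- The price of one rounding of data and parameter.
  have hLγ : (Lc : ℝ) * (2 * γ) = ε := by
    have : (Lc : ℝ) ≠ 0 := by intro h; rw [h] at hLc; simp at hLc
    simp only [γ]
    field_simp
  -- From here on the output of the machine is replaced by the explicit linear program.
  clear_value P
  subst hP
  refine ⟨⟨?_, ?_, ?_⟩, ⟨ERM.point_image_polytope hD, ERM.isBounded_polytope hD⟩, ⟨?_, ?_⟩,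
    ⟨?_, ?_, ?_, ?_⟩, ?_⟩
  · simpa [K] using hK₁
  · simpa [K] using hK₂
  · simpa [K] using hK₃
  · rw [hT]
    calc (2 ^ (N * k + n * k + m * k + 1) - 1) * D ≤ 2 ^ (N * k + n * k + m * k + 1) * D :=
          Nat.mul_le_mul_right _ (Nat.sub_le _ _)
      _ = 2 * (D * 2 ^ (N * k + n * k + m * k)) := by ring
      _ ≤ 4 * D * 2 ^ (N * k + n * k + m * k) := by rw [mul_assoc]; omega
  · rw [hT]
    have h1 := Nat.mul_le_mul_left D ha
    have h2 := Nat.le_mul_of_pos_left (2 ^ (N * k)) hD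
    calc (2 ^ (N * k + n * k + m * k) + 2 ^ (N * k)) * D +
          (2 ^ (N * k + n * k + m * k) * D + 2 ^ (N * k)) =
        2 * (D * 2 ^ (N * k + n * k + m * k)) + D * 2 ^ (N * k) + 2 ^ (N * k) := by ring
      _ ≤ 4 * (D * 2 ^ (N * k + n * k + m * k)) + 2 * D := by omega
      _ = _ := by ring
  · rw [hT]; exact htime
  · rw [hT]
    exact le_trans (by omega) hcalls
  · rw [hT]
    exact le_trans (by omega) hcalls
  · rw [hT]
    exact le_trans (by omega) hcalls
  intro X Y hX hY
  refine ⟨?_, ?_⟩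
  · choose ax hax using fun d => ERM.exists_approximates hγ (hX d)
    choose ay hay using fun d => ERM.exists_approximates hγ (hY d)
    exact ⟨ax, ay, hax, hay⟩
  intro ax ay hax hay
  obtain ⟨J, hJ⟩ := ERM.exists_zero_set (O := ⟨k, f, ℓ, Φ⟩) (ERM.dataWords ax ay)
  replace hJ := (ERM.dataFace_eq_wordFace (O := ⟨k, f, ℓ, Φ⟩) hD ax ay).trans hJ
  refine ⟨ERM.isExposed_of_zero_set J (fun v hv j => (ERM.extend_nonneg_of_mem hD hv j).1) hJ,
    ⟨J, hJ⟩, ?_⟩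
  intro hdense objective
  have hgrid : ERM.GridDense k γ Φ := by
    rcases hdense with rfl | h
    · exact ERM.gridDense_box hγ
    · exact h
  have hproj := ERM.projFace_eq_convexHull (O := ⟨k, f, ℓ, Φ⟩) hD ax ay
  let pt : (Fin N → Fin k → Bool) → (Fin N → ℝ) × (Fin D → ℝ) := fun zφ =>
    (ERM.gridPoint zφ, fun d => ℓ (f (ERM.gridPoint (ax d)) (ERM.gridPoint zφ))
      (ERM.gridPoint (ay d)))
  replace hproj : (ERM.lpFormulation D ⟨k, f, ℓ, Φ⟩).projFace ax ay =
    convexHull ℝ (pt '' {zφ | ERM.gridPoint zφ ∈ Φ}) := hproj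
  have hobj : ∀ zφ, objective (pt zφ) = ERM.risk ℓ f (fun d => ERM.gridPoint (ax d))
    (fun d => ERM.gridPoint (ay d)) (ERM.gridPoint zφ) := fun _ => rfl
  rw [hproj]
  constructor
  · rintro ⟨φ, hφ⟩
    obtain ⟨zφ, hzφ, -⟩ := hgrid φ hφ
    let l : (Fin N → ℝ) × (Fin D → ℝ) →L[ℝ] ℝ :=
      (1 / (D : ℝ)) • (∑ d, ContinuousLinearMap.proj d) ∘L ContinuousLinearMap.snd ℝ _ _
    have hl : objective = l := by
      funext q
      simp [objective, l]
    rw [hl]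
    exact ERM.exists_extremePoint_isMinOn ((Set.toFinite _).image pt) ⟨_, zφ, hzφ, rfl⟩ l
  · intro q hq hmin
    -- Extreme points of a hull are generators: the parameter is a grid point in Φ, and the loss
    -- values are true losses on the rounded data.
    obtain ⟨zq, hzq, rfl⟩ := extremePoints_convexHull_subset hq
    refine ⟨hzq, fun φopt hopt hoptmin => ?_⟩
    obtain ⟨z, hz, hdist⟩ := hgrid φopt hopt
    have hX' : ∀ d, ERM.gridPoint (ax d) ∈ ERM.box n := fun d => ERM.gridPoint_mem_box _
    have hY' : ∀ d, ERM.gridPoint (ay d) ∈ ERM.box m := fun d => ERM.gridPoint_mem_box _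
    -- `h1` rounds the data at the computed parameter, `h2` rounds the data together with the
    -- optimal parameter; each costs ε. Minimality on the rounded data joins them in `h3`, and
    -- optimality of `φopt` in `h4` bounds the other sign.
    have h1 := ERM.abs_risk_sub_risk_le hD hL hX hX' hY hY' hzq hzq
      (fun d => (hax d).dist_le hγ₀) (fun d => (hay d).dist_le hγ₀)
      (by rw [dist_self]; positivity)
    have h2 := ERM.abs_risk_sub_risk_le hD hL hX hX' hY hY' hopt hz
      (fun d => (hax d).dist_le hγ₀) (fun d => (hay d).dist_le hγ₀) hdist
    have h3 : objective (pt zq) ≤ objective (pt z) := hmin (subset_convexHull _ _ ⟨z, hz, rfl⟩)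
    have h4 : ERM.risk ℓ f X Y φopt ≤ ERM.risk ℓ f X Y (pt zq).1 := hoptmin hzq
    rw [hobj, hobj] at h3
    rw [hLγ, abs_le] at h1 h2
    change |_ - ERM.risk ℓ f X Y (ERM.gridPoint zq)| ≤ _
    change _ ≤ ERM.risk ℓ f X Y (ERM.gridPoint zq) at h4
    rw [abs_le]
    constructor <;> linarith [h1.1, h1.2, h2.1, h2.2]
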